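/- Let $k$ be a field of characteristic $p>0$. A variety is a separated, geometrically integral $k$-scheme of finite type. A rational action of a finite $k$-group scheme $G$ on a variety $X$ is a rational map of $k$-schemes $a\colon G\times X\dashrightarrow X$ such that $(\mathrm{pr}_1,a)\colon G\times X\dashrightarrow G\times X$ is birational and $a\circ(\mathrm{id}_G\times a)=a\circ(m\times\mathrm{id}_X)$ as rational maps, where $m$ is the multiplication of $G$. It is faithful if every non-trivial subgroup scheme of $G$ acts non-trivially, and generically free if it restricts to a free action of $G$ (trivial stabilizers) on some dense open subset of $X$. Let $X$ be a variety of dimension $n$ over $k$ with function field $K=k(X)$, and let $kK^p$ be the composite of $k$ and $K^p$ in $K$. A $p$-basis of $K$ is a sequence $(x_1,\dots,x_n)\in K^n$ such that the monomials $x_1^{m_1}\cdots x_n^{m_n}$, $0\le m_i\le p-1$, form a basis of $K$ over $kK^p$. A rational action of $\mu_p^n$ on $X$ is standard in the $p$-basis $(x_1,\dots,x_n)$ if the action it induces on $\operatorname{Spec}K$ fixes $kK^p$ pointwise and satisfies $(t_1,\dots,t_n)\cdot(x_1,\dots,x_n)=(t_1x_1,\dots,t_nx_n)$, i.e. the co-action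 sends $x_i$ to $t_i\otimes x_i$ for all $i$, where $t_1,\dots,t_n$ are the coordinates on $\mu_p^n$. Then: 1. $X$ admits a faithful rational action of $\mu_p^n$. 2. Every faithful rational action $a$ of $\mu_p^n$ on $X$ is generically free and is standard in some $p$-basis $(x_1,\dots,x_n)$ of $K$. Moreover the $x_i$ are uniquely determined by $a$ up to multiplication by non-zero elements of $kK^p$: $a$ is standard in a $p$-basis $(y_1,\dots,y_n)$ if and only if $y_i=c_ix_i$ with $c_i\in kK^p\setminus\{0\}$ for $i=1,\dots,n$. 3. Let $a$ be a faithful rational action of $\mu_p^n$ on $X$, let $H$ be an infinitesimal $k$-group scheme of height at most $1$ containing $\mu_p^n$ as a normal subgroup scheme, and suppose that $a$ is the restriction to $\mu_p^n$ of a faithful rational action of $H$ on $X$. Then $H=\mu_p^n$. -/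

import Mathlib

open CategoryTheory MonoidalCategory CartesianMonoidalCategory MonObj AlgebraicGeometry

universe u

noncomputable section

namespace RatAct

variable {k : Type u} [Field k]

/-! ### Varieties, open subschemes, the generic point -/

/-- A variety over `k`: a separated, geometrically integral `k`-scheme of finite type. -/
class IsVariety (X : Over (Spec (.of k))) : Prop where
  separated : IsSeparated X.hom
  locallyOfFiniteType : LocallyOfFiniteType X.hom
  quasiCompact : QuasiCompact X.hom
  geometricallyIntegral : GeometricallyIntegral X.hom

instance IsVariety.isIntegral (X : Over (Spec (.of k))) [h : IsVariety X] : IsIntegral X.left :=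
  haveI := h.geometricallyIntegral
  GeometricallyIntegral.isIntegral_of_subsingleton X.hom

/-- An open subscheme of a `k`-scheme, as a `k`-scheme. -/
abbrev openSub {Y : Over (Spec (.of k))} (U : Y.left.Opens) : Over (Spec (.of k)) :=
  Over.mk (U.ι ≫ Y.hom)

/-- The inclusion of an open subscheme, as a morphism of `k`-schemes. -/
abbrev openIncl {Y : Over (Spec (.of k))} (U : Y.left.Opens) : openSub U ⟶ Y :=
  Over.homMk U.ι

/-- The generic point `Spec k(X)` of a variety, as a `k`-scheme. -/
abbrev gen (X : Over (Spec (.of k))) [IsVariety X] : Over (Spec (.of k)) :=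
  Over.mk (X.left.fromSpecStalk (genericPoint X.left) ≫ X.hom)

/-- The canonical morphism `Spec k(X) ⟶ X`. -/
abbrev genIncl (X : Over (Spec (.of k))) [IsVariety X] : gen X ⟶ X :=
  Over.homMk (X.left.fromSpecStalk (genericPoint X.left))

/-- The structure map `k → k(X)`. -/
def constMap (X : Over (Spec (.of k))) [IsVariety X] : k →+* X.left.functionField :=
  (Spec.preimage (gen X).hom).hom

/-- The pullback `β^* f ∈ Γ(T, 𝒪_T)` of `f ∈ k(X)` along a morphism `β : T ⟶ Spec k(X)`. -/
def pullFun {X : Over (Spec (.of k))} [IsVariety X] {T : Over (Spec (.of k))}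
    (β : T ⟶ gen X) (f : X.left.functionField) : Γ(T.left, ⊤) :=
  (Scheme.Hom.appTop (Y := Spec X.left.functionField) β.left).hom
    ((Scheme.ΓSpecIso X.left.functionField).inv.hom f)

/-! ### `p`-bases -/

/-- The composite `k K^p` of (the image of) `k` and `K^p` in `K`. -/
def frobSubfield {K : Type u} [Field K] (p : ℕ) (c : k →+* K) : Subfield K :=
  Subfield.closure (Set.range c ∪ Set.range (fun f : K => f ^ p))

/-- `(x_1, …, x_n)` is a `p`-basis of `K` over `k`: the monomials `x_1^{m_1} ⋯ x_n^{m_n}` with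
`0 ≤ m_i ≤ p - 1` form a basis of `K` over `k K^p`. -/
def IsPBasis {K : Type u} [Field K] (p : ℕ) (c : k →+* K) {n : ℕ} (x : Fin n → K) : Prop :=
  LinearIndependent (frobSubfield p c) (fun m : Fin n → Fin p => ∏ i, x i ^ (m i : ℕ)) ∧
  Submodule.span (frobSubfield p c)
    (Set.range (fun m : Fin n → Fin p => ∏ i, x i ^ (m i : ℕ))) = ⊤

/-! ### Group schemes -/

/-- A finite group scheme over `k` is infinitesimal if it has a unique point. -/
structure IsInfinitesimal (H : Over (Spec (.of k))) [GrpObj H] : Prop where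
  finite : IsFinite H.hom
  uniquePoint : Nonempty (Unique H.left)

/-- An affine group scheme `H` over a field of characteristic `p` has height at most one if its
relative Frobenius morphism is the trivial homomorphism. On functions, the relative Frobenius
is `f ⊗ c ↦ c f^p` and the trivial homomorphism is `f ⊗ c ↦ c f(e)^p`, so that the condition
reads `f^p = f(e)^p` for all `f ∈ 𝒪(H)`. -/
def HeightLEOne (p : ℕ) (H : Over (Spec (.of k))) [GrpObj H] : Prop :=
  ∀ f : Γ(H.left, ⊤), f ^ p = ((toUnit H ≫ η[H]).left.appTop.hom f) ^ p

/-- The subgroup scheme `i : G ⟶ H` is normal: the conjugate of a point of `G` by a point of `H`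
is again a point of `G`, for points with values in an arbitrary `k`-scheme `T`. -/
def IsNormalSub {G H : Over (Spec (.of k))} [GrpObj G] [GrpObj H] (i : G ⟶ H) : Prop :=
  ∀ (T : Over (Spec (.of k))) (h : T ⟶ H) (g : T ⟶ G),
    ∃ g' : T ⟶ G, g' ≫ i = h * (g ≫ i) * h⁻¹

/-- The group algebra `k[(ℤ/p)^n] = k[t_1, …, t_n]/(t_i^p - 1)`, with all `t_i` group-like. -/
abbrev MuAlg (k : Type u) [Field k] (p n : ℕ) : Type u :=
  MonoidAlgebra k (Multiplicative (Fin n → ZMod p))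

/-- The group scheme `μ_p^n` over `k`: the diagonalizable group scheme with character group
`(ℤ/p)^n`. -/
abbrev muP (k : Type u) [Field k] (p n : ℕ) : Over (Spec (.of k)) :=
  (Spec (.of (MuAlg k p n))).asOver (Spec (.of k))

instance (p n : ℕ) : GrpObj (muP k p n) :=
  instGrpObjSpecAsOverSpec (R := .of k) (A := .of (MuAlg k p n))

/-- The coordinate `t_i` of a point `t : T ⟶ μ_p^n`, a `p`-th root of unity in `Γ(T, 𝒪_T)`. -/
def muCoord {p n : ℕ} {T : Over (Spec (.of k))} (t : T ⟶ muP k p n) (i : Fin n) :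
    Γ(T.left, ⊤) :=
  (Scheme.Hom.appTop (Y := Spec (.of (MuAlg k p n))) t.left).hom
    ((Scheme.ΓSpecIso (.of (MuAlg k p n))).inv.hom
      (MonoidAlgebra.of k _ (Multiplicative.ofAdd (Pi.single i 1))))

/-! ### Rational actions -/

/-- The rational map `a : Y ⤏ Z` is defined at the `T`-valued point `t` of `Y`, with value `z`. -/
def EvalAt {Y Z : Over (Spec (.of k))} (a : Y.left ⤏ Z.left) {T : Over (Spec (.of k))}
    (t : T ⟶ Y) (z : T ⟶ Z) : Prop :=
  ∃ r : Y.left.PartialMap Z.left, r.toRationalMap = a ∧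
    ∃ t₀ : T.left ⟶ r.domain, t₀ ≫ r.domain.ι = t.left ∧ t₀ ≫ r.hom = z.left

/-- A rational action of the finite group scheme `G` on `X`: a rational map
`a : G × X ⤏ X` of `k`-schemes such that `(pr₁, a) : G × X ⤏ G × X` is birational and
`a ∘ (id × a) = a ∘ (m × id)` as rational maps `G × G × X ⤏ X`. -/
structure IsRationalAction (G X : Over (Spec (.of k))) [GrpObj G]
    (a : (G ⊗ X).left ⤏ X.left) : Prop where
  birational : ∃ U : (G ⊗ X).left.Opens, Dense (U : Set (G ⊗ X).left) ∧
    ∃ y : openSub U ⟶ X, EvalAt a (openIncl U) y ∧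
      IsOpenImmersion (lift (openIncl U ≫ fst G X) y).left ∧
      DenseRange (lift (openIncl U ≫ fst G X) y).left
  assoc : ∃ W : (G ⊗ (G ⊗ X)).left.Opens, Dense (W : Set (G ⊗ (G ⊗ X)).left) ∧
    ∃ y z : openSub W ⟶ X,
      EvalAt a (openIncl W ≫ snd G (G ⊗ X)) y ∧
      EvalAt a (lift (openIncl W ≫ fst G (G ⊗ X)) y) z ∧
      EvalAt a (openIncl W ≫ (α_ G G X).inv ≫ μ[G] ▷ X) z

/-- The restriction to `N` of the rational action `a` along `j : N ⟶ G` is the rational map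
`c : N × X ⤏ X`. -/
def RestrictsTo {N G X : Over (Spec (.of k))} (j : N ⟶ G)
    (a : (G ⊗ X).left ⤏ X.left) (c : (N ⊗ X).left ⤏ X.left) : Prop :=
  ∃ W : (N ⊗ X).left.Opens, Dense (W : Set (N ⊗ X).left) ∧
    ∃ y : openSub W ⟶ X, EvalAt a (openIncl W ≫ j ▷ X) y ∧ EvalAt c (openIncl W) y

/-- The rational action `a` is faithful: every subgroup scheme of `G` that acts trivially is
trivial. -/
def IsFaithful {G X : Over (Spec (.of k))} [GrpObj G] (a : (G ⊗ X).left ⤏ X.left) : Prop :=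
  ∀ (N : Over (Spec (.of k))) [GrpObj N] (j : N ⟶ G) [IsMonHom j],
    IsClosedImmersion j.left → RestrictsTo j a (snd N X).left.toRationalMap → IsIso N.hom

/-- The rational action `a` is generically free: it restricts to an action of `G` on a dense open
`U ⊆ X` that is free, i.e. the stabilizer of every `T`-valued point of `U` is trivial, for every
`k`-scheme `T`. (The action laws on `U` follow from those of `a`.) -/
def IsGenericallyFree {G X : Over (Spec (.of k))} [GrpObj G] (a : (G ⊗ X).left ⤏ X.left) : Prop :=
  ∃ U : X.left.Opens, Dense (U : Set X.left) ∧
    ∃ α : G ⊗ openSub U ⟶ openSub U, EvalAt a (G ◁ openIncl U) (α ≫ openIncl U) ∧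
      ∀ (T : Over (Spec (.of k))) (g : T ⟶ G) (x : T ⟶ openSub U), lift g x ≫ α = x → g = 1

/-- The rational action `a` of `μ_p^n` on `X` is standard in `(x_1, …, x_n) ∈ k(X)^n`: the action
`α` that it induces on the generic point `Spec k(X)` fixes `k K^p` pointwise, where `K = k(X)`,
and satisfies `α^* x_i = t_i x_i` for all `i`. -/
def IsStandard {p n : ℕ} {X : Over (Spec (.of k))} [IsVariety X]
    (a : (muP k p n ⊗ X).left ⤏ X.left) (x : Fin n → X.left.functionField) : Prop :=
  ∃ α : muP k p n ⊗ gen X ⟶ gen X,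
    EvalAt a (muP k p n ◁ genIncl X) (α ≫ genIncl X) ∧
    (∀ f ∈ frobSubfield p (constMap X), pullFun α f = pullFun (snd _ (gen X)) f) ∧
    ∀ i, pullFun α (x i) = muCoord (fst _ (gen X)) i * pullFun (snd _ (gen X)) (x i)

end RatAct

end

/-!
Write `K = k(X)`. A finite group scheme `G` with one point has the same open sets on `G × X` as on
`X`, so a rational action of `G` on `X` restricts to an action `α : G ⊗ gen X ⟶ gen X` on
`gen X = Spec K` (`IsRationalAction.exists_gen`). If `G` has height at most one, then `α` fixes
`k K^p` (`IsActionMap.pbK_pow`); conversely, an action on `Spec K` that fixes the `p`-th powers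
spreads out to a dense open subset, because inverting `d` is the same as inverting the invariant
function `d^p` (`exists_spread`). Rational actions are thus studied on `Spec K`, where everything is
expressed by functions: for affine `Y`, functions on `Y ⊗ Spec K` are uniquely of the form
`∑ b_i ⊗ f_i` for a basis `b_i` of `𝒪(Y)` over `k` (`bijective_expand`). The products `G × X` need
not be reduced, so that morphisms are compared on the scheme-theoretically dense `G ⊗ Spec K`
(`hom_ext_of_genTo`).

*Existence.* As `X` is geometrically integral, `K` has a separating transcendence basis, and this
is a `p`-basis of `n` elements (`exists_isPBasis`). Multiplying the elements of a `p`-basis by the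
coordinates of `μ_p^n` defines an action on `Spec K` (`IsPBasis.exists_algHom_twist`), which spreads
out and is faithful (`exists_faithful_rationalAction`).

*Structure of faithful actions.* An action of `μ_p^n` on `Spec K` is a grading of `K` by `(ℤ/p)^n`,
by eigenspaces. The weights that occur form a subgroup, and for a faithful action this is everything,
since otherwise a subgroup `μ_p` acts trivially (`exists_isEigen_of_isFaithful`). Nonzero
eigenfunctions `x_i` of weight `e_i` have `p^n` linearly independent monomials over `k K^p`, and
`[K : k K^p] = p^n` by the existence of some `p`-basis, hence they form a `p`-basis
(`isPBasis_of_isEigen`). So the invariants are `k K^p`, which gives the uniqueness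
(`isPBasis_and_isStandard_iff`), and the action is free where the `x_i` are invertible
(`isGenericallyFree_of_isEigen`).

*Extensions.* Let `μ_p^n` be normal in `H` of height at most one. Conjugation takes a
character of `μ_p^n` to a sum of characters whose coefficients are idempotents of `𝒪(H)`; these are
`p`-th powers, hence constant, so that `μ_p^n` is central (`conj_eq_of_isNormalSub`).
Therefore `u = β^* x_j / x_j` is invariant under `μ_p^n`, and its coefficients lie in `k K^p`, where
`H` acts trivially. This makes `u` multiplicative in `H`, so that its coefficients span a
finite-dimensional algebra over `k`; they lie in `k`, because `k` is algebraically closed in `K`.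
Hence `H` acts on `x_j` by a character (`exists_character`). These characters define a retraction
`H ⟶ μ_p^n` whose kernel acts trivially on `K`; the kernel is trivial by faithfulness, and
`H = μ_p^n` (`isIso_of_isNormalSub`).
-/

/-! ### Separably generated extensions and `p`-bases -/

namespace RatAct

section PBasis

variable {k K : Type u} [Field k] [Field K] [Algebra k K]

open scoped TensorProduct IntermediateField.algebraAdjoinAdjoin in
/-- The partial derivatives with respect to a separating transcendence basis: the module of
differentials of `K` is the base change of that of the polynomial ring, because a separable
algebraic extension is formally étale. -/
lemma exists_dual_derivation {I : Type*} [DecidableEq I] {x : I → K}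
    (hx : AlgebraicIndependent k x)
    [Algebra.IsSeparable (IntermediateField.adjoin k (Set.range x)) K] (i : I) :
    ∃ D : Derivation k K K, ∀ j, D (x j) = if j = i then 1 else 0 := by
  let A := MvPolynomial I k
  let F := IntermediateField.adjoin k (Set.range x)
  let A' := Algebra.adjoin k (Set.range x)
  have : Algebra.FormallyEtale F K := Algebra.FormallyEtale.of_isSeparable F K
  have : Algebra.FormallyEtale A' F := .of_isLocalization (nonZeroDivisors _)
  have : Algebra.FormallyEtale A' K := .comp A' F K
  let : Algebra A K := (MvPolynomial.aeval x).toAlgebra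
  have : IsScalarTower k A K := .of_algebraMap_eq' (MvPolynomial.aeval x).comp_algebraMap.symm
  let D₀ : Derivation k A K := MvPolynomial.mkDerivation k (Pi.single i (1 : K))
  let e : A ≃ₐ[k] A' := hx.aevalEquiv
  let D₁ : Derivation k A' K := Derivation.mk'
    (D₀.toLinearMap ∘ₗ e.symm.toLinearMap) (by
      intro a b
      have key : ∀ (a : A') (y : K), (e.symm a : A) • y = a • y := by
        intro a y
        change (algebraMap A K (e.symm a)) * y = (a : K) * y
        congr 1
        change MvPolynomial.aeval x (e.symm a) = _
        have := hx.aevalEquiv_apply_coe (e.symm a)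
        rw [← this]
        simp [e]
      have := D₀.leibniz (e.symm a) (e.symm b)
      simp only [LinearMap.comp_apply, AlgEquiv.toLinearMap_apply, map_mul]
      rw [← key, ← key]
      exact this)
  let φ : K ⊗[A'] Ω[A'⁄k] →ₗ[K] K :=
    TensorProduct.AlgebraTensorModule.lift
      ((LinearMap.lsmul K (Ω[A'⁄k] →ₗ[A'] K)).flip D₁.liftKaehlerDifferential)
  let ψ := φ ∘ₗ (KaehlerDifferential.tensorKaehlerEquivOfFormallyEtale k A' K).symm.toLinearMap
  refine ⟨ψ.compDer (KaehlerDifferential.D k K), fun j ↦ ?_⟩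
  have hj : x j ∈ A' := Algebra.subset_adjoin ⟨j, rfl⟩
  change φ ((KaehlerDifferential.tensorKaehlerEquivOfFormallyEtale k A' K).symm
    (KaehlerDifferential.D k K (algebraMap A' K ⟨x j, hj⟩))) = _
  rw [KaehlerDifferential.tensorKaehlerEquivOfFormallyEtale_symm_D_algebraMap]
  have : e (MvPolynomial.X j) = ⟨x j, hj⟩ := by
    apply Subtype.ext
    have := hx.aevalEquiv_apply_coe (MvPolynomial.X j)
    rw [MvPolynomial.aeval_X] at this
    exact this
  have h2 : D₁ ⟨x j, hj⟩ = if j = i then 1 else 0 := by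
    rw [← this]
    change D₀ (e.symm (e _)) = _
    rw [AlgEquiv.symm_apply_apply]
    refine (MvPolynomial.mkDerivation_X k _ j).trans ?_
    simp [Pi.single_apply]
  simp [φ, h2]

/-- Joint eigenvectors with pairwise distinct systems of eigenvalues are linearly independent. -/
lemma linearIndependent_of_joint_eigenvectors {F V I σ : Type*} [Field F] [AddCommGroup V]
    [Module F V] (E : I → V →ₗ[F] V) (v : σ → V) (χ : σ → I → F) (hv : ∀ m, v m ≠ 0)
    (hE : ∀ i m, E i (v m) = χ m i • v m) (hχ : Function.Injective χ) :
    LinearIndependent F v := by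
  classical
  rw [linearIndependent_iff']
  intro s
  induction s using Finset.strongInduction with
  | H s ih =>
    intro c hc m hm
    by_cases hs : ∃ l ∈ s, l ≠ m
    · obtain ⟨l, hl, hlm⟩ := hs
      obtain ⟨i, hi⟩ := Function.ne_iff.mp (hχ.ne hlm)
      have h1 : ∑ j ∈ s, (c j * (χ j i - χ l i)) • v j = 0 := by
        have := congrArg (fun y ↦ E i y - χ l i • y) hc
        simpa [hE, Finset.smul_sum, ← Finset.sum_sub_distrib, mul_sub, sub_smul, smul_smul,
          mul_comm] using this
      rw [← Finset.sum_erase_add _ _ hl] at h1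
      simp only [sub_self, mul_zero, zero_smul, add_zero] at h1
      have := ih (s.erase l) (Finset.erase_ssubset hl) _ h1 m (Finset.mem_erase.mpr ⟨hlm.symm, hm⟩)
      exact (mul_eq_zero.mp this).resolve_right (sub_ne_zero.mpr fun h ↦ hi h.symm)
    · push Not at hs
      have : s = {m} := Finset.eq_singleton_iff_unique_mem.mpr ⟨hm, hs⟩
      subst this
      simpa [hv] using hc

variable (p : ℕ)

lemma algebraMap_mem_frobSubfield (a : k) :
    algebraMap k K a ∈ frobSubfield p (algebraMap k K) :=
  Subfield.subset_closure (.inl ⟨a, rfl⟩)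

lemma pow_mem_frobSubfield {K : Type u} [Field K] (c : k →+* K) (f : K) : f ^ p ∈ frobSubfield p c :=
  Subfield.subset_closure (.inr ⟨f, rfl⟩)

/-- `k`-derivations of `K` vanish on `k K^p`. -/
lemma derivation_eq_zero_of_mem_frobSubfield [CharP K p] (D : Derivation k K K) {f : K}
    (hf : f ∈ frobSubfield p (algebraMap k K)) : D f = 0 := by
  refine Subfield.closure_induction (p := fun f _ ↦ D f = 0) ?_ (by simp) ?_ ?_ ?_ ?_ hf
  · rintro _ (⟨a, rfl⟩ | ⟨g, rfl⟩)
    · simp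
    · simp [Derivation.leibniz_pow]
  · intro a b _ _ ha hb; simp [ha, hb]
  · intro a _ ha; simp [ha]
  · intro a _ ha; simp [Derivation.leibniz_inv, ha]
  · intro a b _ _ ha hb; simp [ha, hb]

/-- The monomials in `x` with exponents less than `p`. -/
abbrev pMonomial {n : ℕ} (x : Fin n → K) (m : Fin n → Fin p) : K := ∏ i, x i ^ (m i : ℕ)

/-- Every monomial in `x` is a `k K^p`-multiple of one with exponents less than `p`. -/
lemma prod_pow_eq_mul_pMonomial [Fact p.Prime] {n : ℕ} (x : Fin n → K) (e : Fin n → ℕ) :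
    ∏ i, x i ^ e i = (∏ i, x i ^ (e i / p)) ^ p *
      pMonomial p x (fun i ↦ ⟨e i % p, Nat.mod_lt _ (Fact.out : p.Prime).pos⟩) := by
  rw [← Finset.prod_pow, ← Finset.prod_mul_distrib]
  refine Finset.prod_congr rfl fun i _ ↦ ?_
  rw [← pow_mul, ← pow_add]
  simp [Nat.div_add_mod']

/-- A separating transcendence basis is a `p`-basis. -/
lemma isPBasis_of_isSeparable [Fact p.Prime] [CharP k p] [CharP K p] {n : ℕ} {x : Fin n → K}
    (hx : AlgebraicIndependent k x)
    [Algebra.IsSeparable (IntermediateField.adjoin k (Set.range x)) K] :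
    IsPBasis p (algebraMap k K) x := by
  have hp : p.Prime := Fact.out
  set L := frobSubfield p (algebraMap k K) with hL
  have hx0 : ∀ i, x i ≠ 0 := fun i ↦ hx.ne_zero i
  constructor
  · -- The operators `x_i ∂/∂x_i` are `k K^p`-linear, with `x^m` a joint eigenvector of eigenvalues
    -- `m_i`, and these systems of eigenvalues are distinct because `0 ≤ m_i < p`.
    choose D hD using fun i ↦ exists_dual_derivation hx i
    let E : Fin n → K →ₗ[L] K := fun i ↦
      { toFun := fun y ↦ x i * D i y
        map_add' := fun a b ↦ by simp [mul_add]
        map_smul' := fun c y ↦ by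
          simp [Subfield.smul_def, Derivation.leibniz,
            derivation_eq_zero_of_mem_frobSubfield p (D i) c.2]
          ring }
    refine linearIndependent_of_joint_eigenvectors E _ (fun m i ↦ ((m i : ℕ) : L)) ?_ ?_ ?_
    · intro m; exact Finset.prod_ne_zero_iff.mpr fun i _ ↦ pow_ne_zero _ (hx0 i)
    · intro i m
      have hpow : ∀ j, D i (x j ^ (m j : ℕ)) = if j = i then (m i : ℕ) * x i ^ ((m i : ℕ) - 1)
          else 0 := by
        intro j
        rw [Derivation.leibniz_pow, hD]
        by_cases h : j = i
        · subst h; simp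
        · simp [h]
      have hrest : D i (∏ j ∈ Finset.univ.erase i, x j ^ (m j : ℕ)) = 0 := by
        refine Finset.prod_induction _ (fun y ↦ D i y = 0) ?_ (by simp) ?_
        · intro a b ha hb; simp [Derivation.leibniz, ha, hb]
        · intro j hj; rw [hpow, if_neg (Finset.ne_of_mem_erase hj)]
      change x i * D i (∏ j, x j ^ (m j : ℕ)) = _
      rw [← Finset.mul_prod_erase _ _ (Finset.mem_univ i), Derivation.leibniz, hrest, hpow]
      simp only [if_true, smul_eq_mul, Subfield.smul_def]
      by_cases hm : (m i : ℕ) = 0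
      · simp [hm]
      · obtain ⟨r, hr⟩ := Nat.exists_eq_succ_of_ne_zero hm
        rw [hr]
        push_cast
        simp
        ring
    · intro m m' h
      funext i
      have h1 : ((m i : ℕ) : L) = ((m' i : ℕ) : L) := congrFun h i
      have h2 : ((m i : ℕ) : K) = ((m' i : ℕ) : K) := by
        simpa using congrArg (Subtype.val) h1
      rw [CharP.natCast_eq_natCast K p] at h2
      exact Fin.ext (Nat.ModEq.eq_of_lt_of_lt h2 (m i).2 (m' i).2)
  · -- By separability `K = k(x)(K^p)`, so that `K` is the field generated over `k K^p` by the `x_i`,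
    -- which are integral over it.
    have : ExpChar K p := .prime hp
    set F := IntermediateField.adjoin k (Set.range x) with hF
    have : CharP F p := charP_of_injective_algebraMap (algebraMap k F).injective p
    have : ExpChar F p := .prime hp
    have htop : IntermediateField.adjoin F ((· ^ p) '' (Set.univ : Set K)) = ⊤ := by
      rw [← IntermediateField.adjoin_eq_adjoin_pow_expChar_of_isSeparable' F K Set.univ p]
      exact top_le_iff.mp fun y _ ↦ IntermediateField.subset_adjoin _ _ trivial
    let S : IntermediateField L K := IntermediateField.adjoin L (Set.range x)
    have hS : S = ⊤ := by
      have h1 : (F.toSubfield : Subfield K) ≤ S.toSubfield := by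
        refine Subfield.closure_le.mpr ?_
        rintro _ (⟨a, rfl⟩ | hy)
        · exact S.algebraMap_mem ⟨_, algebraMap_mem_frobSubfield p a⟩
        · exact IntermediateField.subset_adjoin L (Set.range x) hy
      have h2 : ∀ y ∈ IntermediateField.adjoin F ((· ^ p) '' (Set.univ : Set K)), y ∈ S := by
        intro y hy
        refine Subfield.closure_induction (p := fun y _ ↦ y ∈ S) ?_ S.one_mem
          (fun _ _ _ _ ↦ S.add_mem) (fun _ _ ↦ S.neg_mem) (fun _ _ ↦ S.inv_mem)
          (fun _ _ _ _ ↦ S.mul_mem) hy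
        rintro _ (⟨a, rfl⟩ | ⟨g, _, rfl⟩)
        · exact h1 a.2
        · exact S.algebraMap_mem ⟨_, pow_mem_frobSubfield p _ g⟩
      refine top_le_iff.mp fun y _ ↦ h2 y (htop ▸ trivial)
    have hint : ∀ y ∈ Set.range x, IsIntegral L y := by
      rintro _ ⟨i, rfl⟩
      refine ⟨Polynomial.X ^ p - Polynomial.C ⟨_, pow_mem_frobSubfield p _ (x i)⟩,
        Polynomial.monic_X_pow_sub_C _ hp.ne_zero, ?_⟩
      rw [Polynomial.eval₂_sub, Polynomial.eval₂_C, Polynomial.eval₂_X_pow]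
      exact sub_self _
    have hA : Algebra.adjoin L (Set.range x) = ⊤ := by
      have := IntermediateField.adjoin_toSubalgebra_of_isAlgebraic
        (fun y hy ↦ (hint y hy).isAlgebraic)
      rw [← this]
      change S.toSubalgebra = ⊤
      rw [hS, IntermediateField.top_toSubalgebra]
    rw [eq_top_iff, ← Algebra.top_toSubmodule, ← hA, Algebra.adjoin_eq_span, Submodule.span_le]
    intro y hy
    have : ∃ e : Fin n → ℕ, y = ∏ i, x i ^ e i := by
      refine Submonoid.closure_induction (motive := fun y _ ↦ ∃ e : Fin n → ℕ, y = ∏ i, x i ^ e i)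
        ?_ ⟨0, by simp⟩ ?_ hy
      · rintro _ ⟨i, rfl⟩
        exact ⟨Pi.single i 1, by simp [Pi.single_apply, pow_ite]⟩
      · rintro _ _ _ _ ⟨e, rfl⟩ ⟨e', rfl⟩
        exact ⟨e + e', by simp [pow_add, Finset.prod_mul_distrib]⟩
    obtain ⟨e, rfl⟩ := this
    rw [prod_pow_eq_mul_pMonomial p]
    exact Submodule.smul_mem _ (⟨_, pow_mem_frobSubfield p _ _⟩ : L)
      (Submodule.subset_span ⟨_, rfl⟩)

end PBasis

end RatAct

/-! ### Geometrically integral function fields -/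

namespace RatAct

section GeometricallyIntegral

open scoped TensorProduct

variable {k K : Type u} [Field k] [Field K] [Algebra k K]

/-- If `K ⊗ k̄` is reduced, then `p`-th powers of linearly independent elements are linearly
independent: a relation between the `p`-th powers is the `p`-th power of a relation over `k̄`. -/
lemma linearIndepOn_pow_of_isReduced (p : ℕ) [Fact p.Prime] [CharP k p]
    [IsReduced (AlgebraicClosure k ⊗[k] K)] (s : Finset K)
    (hs : LinearIndepOn k _root_.id (s : Set K)) : LinearIndepOn k (· ^ p) (s : Set K) := by
  classical
  have hp : p.Prime := Fact.out
  rw [linearIndepOn_finset_iff] at hs ⊢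
  intro c hc i hi
  choose d hd using fun j ↦ IsAlgClosed.exists_pow_nat_eq (algebraMap k (AlgebraicClosure k) (c j))
    hp.pos
  have : CharP (AlgebraicClosure k) p := charP_of_injective_algebraMap
    (algebraMap k (AlgebraicClosure k)).injective p
  have : CharP (AlgebraicClosure k ⊗[k] K) p :=
    charP_of_injective_algebraMap (algebraMap (AlgebraicClosure k) _).injective p
  have : ExpChar (AlgebraicClosure k ⊗[k] K) p := .prime hp
  have h0 : ∑ j ∈ s, d j ⊗ₜ[k] j = 0 := by
    refine (pow_eq_zero_iff hp.ne_zero).mp ?_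
    rw [sum_pow_char p]
    simp only [Algebra.TensorProduct.tmul_pow, hd]
    have := congrArg (fun y ↦ (1 : AlgebraicClosure k) ⊗ₜ[k] y) hc
    simp only [TensorProduct.tmul_sum, TensorProduct.tmul_zero] at this
    rw [← this]
    refine Finset.sum_congr rfl fun j _ ↦ ?_
    rw [TensorProduct.tmul_smul, TensorProduct.smul_tmul', Algebra.smul_def, _root_.mul_one]
  have hs' : LinearIndependent k (fun j : s ↦ (j : K)) := linearIndepOn_finset_iff.mpr hs
  have h1 := linearIndependent_iff'.mp (Module.Flat.linearIndependent_one_tmul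
    (S := AlgebraicClosure k) hs') Finset.univ (fun j ↦ d j) (by
      simp only [TensorProduct.smul_tmul', smul_eq_mul, _root_.mul_one]
      rw [← h0]
      exact Finset.sum_coe_sort s (fun j ↦ d j ⊗ₜ[k] j)) ⟨i, hi⟩ (Finset.mem_univ _)
  have h2 := hd i
  rw [h1, zero_pow hp.ne_zero] at h2
  exact (map_eq_zero _).mp h2.symm

/-- MacLane's criterion: if `k̄ ⊗ K` is reduced, then `K` is separably generated over `k`, hence has
a `p`-basis of length its transcendence degree. -/
lemma exists_isPBasis_of_isReduced (p : ℕ) [Fact p.Prime] [CharP k p]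
    [Algebra.EssFiniteType k K] [IsReduced (AlgebraicClosure k ⊗[k] K)] {n : ℕ}
    (hn : Algebra.trdeg k K = n) :
    ∃ x : Fin n → K, IsPBasis p (algebraMap k K) x := by
  have hp : p.Prime := Fact.out
  have : ExpChar k p := .prime hp
  have : CharP K p := charP_of_injective_algebraMap (algebraMap k K).injective p
  obtain ⟨s, hs, hsep⟩ :=
    exists_isTranscendenceBasis_and_isSeparable_of_linearIndepOn_pow_of_essFiniteType
      (k := k) (K := K) p hp (linearIndepOn_pow_of_isReduced p)
  have hcard : s.card = n := by
    have := hs.cardinalMk_eq_trdeg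
    rw [hn] at this
    simpa using this
  let e : Fin n ≃ s := (Fin.castOrderIso hcard.symm).toEquiv.trans s.equivFin.symm
  let x : Fin n → K := fun i ↦ e i
  have hx : AlgebraicIndependent k x := hs.1.comp e e.injective
  have hr : Set.range x = (s : Set K) := by
    rw [show x = Subtype.val ∘ e from rfl, e.surjective.range_comp]
    exact Subtype.range_coe
  have : Algebra.IsSeparable (IntermediateField.adjoin k (Set.range x)) K := by
    rw [hr]; exact hsep
  exact ⟨x, isPBasis_of_isSeparable p hx⟩

/-- If `K ⊗ k̄` is a domain, then `k` is algebraically closed in `K`. -/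
lemma mem_range_algebraMap_of_isAlgebraic [IsDomain (AlgebraicClosure k ⊗[k] K)] {f : K}
    (hf : IsAlgebraic k f) : f ∈ Set.range (algebraMap k K) := by
  let g := minpoly k f
  have hg0 : g ≠ 0 := minpoly.ne_zero hf.isIntegral
  have hsplit := IsAlgClosed.splits (g.map (algebraMap k (AlgebraicClosure k)))
  -- In the domain `k̄ ⊗ K` the element `1 ⊗ f` is a root of a polynomial that splits over `k̄`.
  obtain ⟨t, ht⟩ : ∃ t : AlgebraicClosure k, t ⊗ₜ[k] (1 : K) = 1 ⊗ₜ[k] f := by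
    have h1 : Polynomial.aeval ((1 : AlgebraicClosure k) ⊗ₜ[k] f)
        (g.map (algebraMap k (AlgebraicClosure k))) = 0 := by
      rw [Polynomial.aeval_map_algebraMap]
      have : (1 : AlgebraicClosure k) ⊗ₜ[k] f =
        (Algebra.TensorProduct.includeRight : K →ₐ[k] AlgebraicClosure k ⊗[k] K) f := rfl
      rw [this, Polynomial.aeval_algHom_apply, minpoly.aeval, map_zero]
    rw [hsplit.eq_prod_roots, map_mul, Polynomial.aeval_C, map_multiset_prod,
      Multiset.map_map] at h1
    rcases mul_eq_zero.mp h1 with h2 | h2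
    · exfalso
      have := (algebraMap (AlgebraicClosure k) (AlgebraicClosure k ⊗[k] K)).injective
        (h2.trans (map_zero _).symm)
      simp [hg0] at this
    · obtain ⟨t, -, ht⟩ := Multiset.mem_map.mp (Multiset.prod_eq_zero_iff.mp h2)
      refine ⟨t, ?_⟩
      simp only [Function.comp, map_sub, Polynomial.aeval_X, Polynomial.aeval_C] at ht
      exact (sub_eq_zero.mp ht).symm
  by_contra hcon
  have hli : LinearIndependent k ![1, f] := by
    rw [LinearIndependent.pair_iff]
    intro a b hab
    have hb : b = 0 := by
      by_contra hb
      refine hcon ⟨-a / b, ?_⟩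
      rw [Algebra.smul_def, Algebra.smul_def, _root_.mul_one] at hab
      have hb' : algebraMap k K b ≠ 0 := by simpa using hb
      rw [map_div₀, map_neg]
      field_simp
      linear_combination -hab
    subst hb
    simpa using hab
  have h1 := Fintype.linearIndependent_iff.mp (Module.Flat.linearIndependent_one_tmul
    (S := AlgebraicClosure k) hli) ![t, -1] (by
      simp [TensorProduct.smul_tmul', TensorProduct.neg_tmul, ht]) 1
  simp at h1

end GeometricallyIntegral

/-- The dimension of a finitely generated domain over a field is its transcendence degree. -/
lemma ringKrullDim_eq_trdeg {k A : Type u} [Field k] [CommRing A] [IsDomain A] [Algebra k A]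
    [Algebra.FiniteType k A] {n : ℕ} (hn : ringKrullDim A = n) : Algebra.trdeg k A = n := by
  obtain ⟨s, g, hg, hint⟩ := exists_integral_inj_algHom_of_fg k A
  let P := MvPolynomial (Fin s) k
  let : Algebra P A := g.toRingHom.toAlgebra
  have : IsScalarTower k P A := .of_algebraMap_eq' g.comp_algebraMap.symm
  have : Algebra.IsIntegral P A := ⟨hint⟩
  have hinj : Function.Injective (algebraMap P A) := hg
  have : FaithfulSMul P A := (faithfulSMul_iff_algebraMap_injective P A).mpr hinj
  have hdim : ringKrullDim P = s := by
    rw [MvPolynomial.ringKrullDim_of_isNoetherianRing, ringKrullDim_eq_zero_of_field]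
    simp
  have hle : ringKrullDim A ≤ ringKrullDim P := by
    refine Order.krullDim_le_of_strictMono (PrimeSpectrum.comap (algebraMap P A)) ?_
    intro a b hab
    exact Ideal.IsIntegral.comap_lt_comap (R := P) (A := A) hab
  have hge : ringKrullDim P ≤ ringKrullDim A := by
    refine iSup_le fun l ↦ ?_
    obtain ⟨Q, hQ, hQl⟩ := Ideal.exists_ideal_over_prime_of_isIntegral_of_isDomain
      (S := A) l.head.asIdeal (by simp [(RingHom.injective_iff_ker_eq_bot _).mp hinj])
    have : Q.LiesOver l.head.asIdeal := ⟨hQl.symm⟩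
    obtain ⟨L, hL, -⟩ := Ideal.exists_ltSeries_of_hasGoingUp l Q
    rw [← hL]
    exact Order.LTSeries.length_le_krullDim L
  have hs : s = n := by
    have := le_antisymm hle hge
    rw [hn, hdim] at this
    exact_mod_cast this.symm
  rw [← trdeg_add_eq k P (A := A), trdeg_eq_zero (R := P) (A := A),
    MvPolynomial.trdeg_of_isDomain, hs]
  simp

end RatAct

/-! ### The function field of a variety -/

namespace RatAct

open scoped TensorProduct

/-- Extending scalars to the fraction field of `A` keeps `k̄ ⊗ A` a domain. -/
lemma isDomain_tensorProduct_fractionRing {k L A K : Type u} [Field k] [Field L] [Algebra k L]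
    [CommRing A] [IsDomain A] [Field K] [Algebra k A] [Algebra k K] [Algebra A K]
    [IsScalarTower k A K] [IsFractionRing A K] [IsDomain (L ⊗[k] A)] : IsDomain (L ⊗[k] K) := by
  let φ : L ⊗[k] A →ₐ[k] L ⊗[k] K :=
    Algebra.TensorProduct.map (AlgHom.id k L) (IsScalarTower.toAlgHom k A K)
  have hφ : Function.Injective φ :=
    Module.Flat.lTensor_preserves_injective_linearMap (M := L)
      (IsScalarTower.toAlgHom k A K).toLinearMap (IsFractionRing.injective A K)
  -- Every element of `L ⊗ K` has a multiple by some `1 ⊗ a` with `a ≠ 0` coming from `L ⊗ A`.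
  have hden : ∀ z : L ⊗[k] K, ∃ a : A, a ≠ 0 ∧ ∃ w, φ w = (1 ⊗ₜ algebraMap A K a) * z := by
    intro z
    induction z with
    | zero => exact ⟨1, one_ne_zero, 0, by simp⟩
    | tmul l f =>
      obtain ⟨a, b, hb, rfl⟩ := IsFractionRing.div_surjective (A := A) f
      have hb0 : b ≠ 0 := nonZeroDivisors.ne_zero hb
      refine ⟨b, hb0, l ⊗ₜ a, ?_⟩
      have : algebraMap A K b ≠ 0 := by simpa using hb0
      simp [φ, mul_div_cancel₀ _ this]
    | add z₁ z₂ h₁ h₂ =>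
      obtain ⟨a, ha, w, hw⟩ := h₁
      obtain ⟨b, hb, v, hv⟩ := h₂
      refine ⟨a * b, mul_ne_zero ha hb, (1 ⊗ₜ b) * w + (1 ⊗ₜ a) * v, ?_⟩
      have e : (1 : L) ⊗ₜ[k] algebraMap A K (a * b) =
          (1 ⊗ₜ algebraMap A K a) * (1 ⊗ₜ algebraMap A K b) := by simp
      rw [map_add, map_mul, map_mul, hw, hv, e]
      simp only [φ, Algebra.TensorProduct.map_tmul, map_one, IsScalarTower.coe_toAlgHom']
      ring
  have hunit : ∀ a : A, a ≠ 0 → IsUnit ((1 : L) ⊗ₜ[k] algebraMap A K a) := by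
    intro a ha
    have : IsUnit (algebraMap A K a) := by simpa using ha
    exact this.map (Algebra.TensorProduct.includeRight : K →ₐ[k] L ⊗[k] K)
  have : Nontrivial (L ⊗[k] K) := hφ.nontrivial
  have : NoZeroDivisors (L ⊗[k] K) := by
    refine ⟨fun {x y} hxy ↦ ?_⟩
    obtain ⟨a, ha, w, hw⟩ := hden x
    obtain ⟨b, hb, v, hv⟩ := hden y
    have h0 : φ (w * v) = 0 := by
      rw [map_mul, hw, hv, _root_.mul_mul_mul_comm, hxy, mul_zero]
    rcases mul_eq_zero.mp ((map_eq_zero_iff φ hφ).mp h0) with h | h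
    · left; rw [h, map_zero] at hw; exact ((hunit a ha).mul_right_eq_zero).mp hw.symm
    · right; rw [h, map_zero] at hv; exact ((hunit b hb).mul_right_eq_zero).mp hv.symm
  exact NoZeroDivisors.to_isDomain _

variable {k : Type u} [Field k] (X : Over (Spec (.of k)))

/-- The algebra structure of the function field; its structure map is `constMap X` by definition. -/
noncomputable instance functionFieldAlgebra [IsVariety X] : Algebra k X.left.functionField :=
  (constMap X).toAlgebra

variable {X}

/-- The `k`-algebra structure on the sections over an affine open. -/
noncomputable abbrev sectionsAlgebra {U : X.left.Opens} (hU : IsAffineOpen U) :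
    Algebra k Γ(X.left, U) :=
  (Spec.preimage (hU.fromSpec ≫ X.hom)).hom.toAlgebra

lemma SpecMap_algebraMap_sections {U : X.left.Opens} (hU : IsAffineOpen U) :
    letI := sectionsAlgebra hU
    Spec.map (CommRingCat.ofHom (algebraMap k Γ(X.left, U))) = hU.fromSpec ≫ X.hom :=
  Spec.map_preimage _

variable [IsVariety X]

lemma finiteType_sections {U : X.left.Opens} (hU : IsAffineOpen U) :
    letI := sectionsAlgebra hU
    Algebra.FiniteType k Γ(X.left, U) := by
  let := sectionsAlgebra hU
  have := (inferInstance : IsVariety X).locallyOfFiniteType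
  have h : LocallyOfFiniteType (Spec.map (CommRingCat.ofHom (algebraMap k Γ(X.left, U)))) := by
    rw [SpecMap_algebraMap_sections hU]; infer_instance
  rw [HasRingHomProperty.Spec_iff (P := @LocallyOfFiniteType)] at h
  exact h

lemma isScalarTower_sections {U : X.left.Opens} (hU : IsAffineOpen U) [Nonempty U] :
    letI := sectionsAlgebra hU
    IsScalarTower k Γ(X.left, U) X.left.functionField := by
  let := sectionsAlgebra hU
  refine .of_algebraMap_eq' ?_
  have hx : genericPoint X.left ∈ U :=
    ((genericPoint_spec X.left).mem_open_set_iff U.isOpen).mpr (by simpa using ‹Nonempty U›)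
  have : Spec.preimage (gen X).hom =
      CommRingCat.ofHom (algebraMap k Γ(X.left, U)) ≫ X.left.germToFunctionField U := by
    apply Spec.map_injective
    rw [Spec.map_preimage, Spec.map_comp, SpecMap_algebraMap_sections hU, ← Category.assoc]
    change X.left.fromSpecStalk (genericPoint X.left) ≫ X.hom = _
    rw [← hU.fromSpecStalk_eq_fromSpecStalk hx]
    rfl
  change (Spec.preimage (gen X).hom).hom = _
  rw [this]
  rfl

lemma isDomain_tensorProduct_sections {U : X.left.Opens} (hU : IsAffineOpen U) [Nonempty U] :
    letI := sectionsAlgebra hU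
    IsDomain (AlgebraicClosure k ⊗[k] Γ(X.left, U)) := by
  let := sectionsAlgebra hU
  have := (inferInstance : IsVariety X).geometricallyIntegral
  let y : Spec (.of (AlgebraicClosure k)) ⟶ Spec (.of k) :=
    Spec.map (CommRingCat.ofHom (algebraMap k (AlgebraicClosure k)))
  have hZ : IsIntegral (Limits.pullback X.hom y) :=
    GeometricallyIntegral.geometrically_isIntegral y _ _ (.of_hasPullback _ _)
  let e : Limits.pullback hU.fromSpec (Limits.pullback.fst X.hom y) ≅
      Spec (.of (Γ(X.left, U) ⊗[k] AlgebraicClosure k)) :=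
    Limits.pullbackRightPullbackFstIso X.hom y hU.fromSpec ≪≫
      Limits.pullback.congrHom (SpecMap_algebraMap_sections hU).symm rfl ≪≫ pullbackSpecIso k _ _
  have : Nontrivial (Γ(X.left, U) ⊗[k] AlgebraicClosure k) := inferInstance
  have hne : Nonempty (Spec (.of (Γ(X.left, U) ⊗[k] AlgebraicClosure k))) :=
    inferInstanceAs (Nonempty (PrimeSpectrum _))
  have : IsIntegral (Spec (.of (Γ(X.left, U) ⊗[k] AlgebraicClosure k))) :=
    isIntegral_of_isOpenImmersion (e.inv ≫ Limits.pullback.snd _ _)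
  have : IsDomain (Γ(X.left, U) ⊗[k] AlgebraicClosure k) :=
    (affine_isIntegral_iff (.of (Γ(X.left, U) ⊗[k] AlgebraicClosure k))).mp this
  exact (Algebra.TensorProduct.comm k (AlgebraicClosure k) Γ(X.left, U)).toMulEquiv.isDomain _

/-- An affine open of full dimension exists: a chain of irreducible closed subsets of `X` of
maximal length restricts to a chain in any affine open that meets its smallest member. -/
lemma exists_isAffineOpen_ringKrullDim {Y : Scheme.{u}} {n : ℕ}
    (hn : topologicalKrullDim Y = n) :
    ∃ U : Y.Opens, IsAffineOpen U ∧ Nonempty U ∧ ringKrullDim Γ(Y, U) = n := by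
  obtain ⟨l, hl⟩ := Order.le_krullDim_iff.mp hn.ge
  obtain ⟨x, hx⟩ := l.head.isIrreducible.nonempty
  obtain ⟨_, ⟨U, hU, rfl⟩, hxU, -⟩ :=
    Y.isBasis_affineOpens.exists_subset_of_mem_open (Set.mem_univ x) isOpen_univ
  let f : Spec Γ(Y, U) → Y := hU.fromSpec
  have := hU.isOpenImmersion_fromSpec
  have hf : Topology.IsOpenEmbedding f := hU.fromSpec.isOpenEmbedding
  refine ⟨U, hU, ⟨⟨x, hxU⟩⟩, le_antisymm ?_ ?_⟩
  · rw [← hn, ← PrimeSpectrum.topologicalKrullDim_eq_ringKrullDim]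
    exact hf.isInducing.topologicalKrullDim_le
  · have hne : (f ⁻¹' l.head).Nonempty := by
      have : x ∈ Set.range f := by
        have := hU.range_fromSpec
        rw [show Set.range f = (U : Set Y) from this]; exact hxU
      obtain ⟨z, rfl⟩ := this
      exact ⟨z, hx⟩
    let Z := (TopologicalSpace.IrreducibleCloseds.orderIsoOfIsOpenEmbedding f hf).symm ⟨l.head, hne⟩
    have hZ : TopologicalSpace.IrreducibleCloseds.map f hf.continuous Z = l.head :=
      congrArg Subtype.val
        ((TopologicalSpace.IrreducibleCloseds.orderIsoOfIsOpenEmbedding f hf).apply_symm_apply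
          ⟨l.head, hne⟩)
    have h1 : (n : ℕ∞) ≤ Order.coheight Z := by
      rw [← hf.coheight_map Z, hZ, ← hl]
      exact Order.length_le_coheight_head
    have h2 : (Order.coheight Z : WithBot ℕ∞) ≤ topologicalKrullDim (Spec Γ(Y, U)) :=
      Order.coheight_le_krullDim Z
    rw [← PrimeSpectrum.topologicalKrullDim_eq_ringKrullDim]
    refine le_trans ?_ h2
    exact_mod_cast h1

variable (X)

lemma exists_isAffineOpen_nonempty : ∃ U : X.left.Opens, IsAffineOpen U ∧ Nonempty U := by
  obtain ⟨_, ⟨U, hU, rfl⟩, hxU, -⟩ :=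
    X.left.isBasis_affineOpens.exists_subset_of_mem_open
      (Set.mem_univ (genericPoint X.left)) isOpen_univ
  exact ⟨U, hU, ⟨⟨_, hxU⟩⟩⟩

instance isDomain_tensorProduct_functionField :
    IsDomain (AlgebraicClosure k ⊗[k] X.left.functionField) := by
  obtain ⟨U, hU, hne⟩ := exists_isAffineOpen_nonempty X
  let := sectionsAlgebra hU
  have := isScalarTower_sections hU
  have := isDomain_tensorProduct_sections hU
  have := functionField_isFractionRing_of_isAffineOpen X.left U hU
  exact isDomain_tensorProduct_fractionRing (A := Γ(X.left, U))

instance essFiniteType_functionField : Algebra.EssFiniteType k X.left.functionField := by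
  obtain ⟨U, hU, hne⟩ := exists_isAffineOpen_nonempty X
  let := sectionsAlgebra hU
  have := isScalarTower_sections hU
  have := finiteType_sections hU
  have := functionField_isFractionRing_of_isAffineOpen X.left U hU
  have : Algebra.EssFiniteType Γ(X.left, U) X.left.functionField :=
    .of_isLocalization _ (nonZeroDivisors Γ(X.left, U))
  exact .comp k Γ(X.left, U) _

lemma trdeg_functionField {n : ℕ} (hn : topologicalKrullDim X.left = n) :
    Algebra.trdeg k X.left.functionField = n := by
  obtain ⟨U, hU, hne, hdim⟩ := exists_isAffineOpen_ringKrullDim hn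
  let := sectionsAlgebra hU
  have := isScalarTower_sections hU
  have := finiteType_sections hU
  have := functionField_isFractionRing_of_isAffineOpen X.left U hU
  have : FaithfulSMul k Γ(X.left, U) := (faithfulSMul_iff_algebraMap_injective _ _).mpr
    (algebraMap k Γ(X.left, U)).injective
  have : FaithfulSMul Γ(X.left, U) X.left.functionField :=
    (faithfulSMul_iff_algebraMap_injective _ _).mpr (IsFractionRing.injective _ _)
  have : Algebra.IsAlgebraic Γ(X.left, U) X.left.functionField :=
    IsLocalization.isAlgebraic _ (nonZeroDivisors _)
  rw [← trdeg_add_eq k Γ(X.left, U) (A := X.left.functionField), trdeg_eq_zero (R := Γ(X.left, U)),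
    ringKrullDim_eq_trdeg hdim, add_zero]

lemma exists_isPBasis (p : ℕ) [Fact p.Prime] [CharP k p] {n : ℕ}
    (hn : topologicalKrullDim X.left = n) :
    ∃ x : Fin n → X.left.functionField, IsPBasis p (constMap X) x :=
  exists_isPBasis_of_isReduced p (trdeg_functionField X hn)

end RatAct

/-! ### Products with infinitesimal groups -/

namespace RatAct

section Cartesian

variable {C : Type*} [Category C] [CartesianMonoidalCategory C]

lemma isPullback_whiskerLeft (Y : C) {Z Z' : C} (f : Z ⟶ Z') :
    IsPullback (Y ◁ f) (snd Y Z) (snd Y Z') f where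
  w := by simp
  isLimit' := ⟨Limits.PullbackCone.IsLimit.mk _ (fun s ↦ lift (s.fst ≫ fst _ _) s.snd)
    (fun s ↦ by
      ext
      · simp
      · simp [s.condition])
    (fun s ↦ by simp)
    (fun s m h₁ h₂ ↦ by
      ext
      · simp [← h₁]
      · simp [← h₂])⟩

/-- The unit section `Y ⟶ G ⊗ Y`. -/
abbrev unitSection (G Y : C) [MonObj G] : Y ⟶ G ⊗ Y := lift 1 (𝟙 Y)

lemma isPullback_unitSection (G Y : C) [MonObj G] :
    IsPullback (unitSection G Y) (toUnit Y) (fst G Y) η[G] where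
  w := by simp [Hom.one_def]
  isLimit' := ⟨Limits.PullbackCone.IsLimit.mk _ (fun s ↦ s.fst ≫ snd G Y)
    (fun s ↦ by
      have := s.condition
      ext
      · simp only [comp_lift, lift_fst, Hom.one_def, Category.assoc, this]
        rw [toUnit_unique s.snd (s.fst ≫ snd G Y ≫ toUnit Y)]
        simp
      · simp)
    (fun s ↦ toUnit_unique (X := s.pt) _ _)
    (fun s m h₁ h₂ ↦ by simp [← h₁])⟩

end Cartesian

variable {k : Type u} [Field k]

section Topology

variable {G : Over (Spec (.of k))} [GrpObj G] [Subsingleton G.left]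

/-- An infinitesimal group is covered, as a topological space, by its unit point, and hence the
unit section of `G ⊗ Y` is surjective. -/
instance surjective_unitSection (Y : Over (Spec (.of k))) :
    Surjective (unitSection G Y).left := by
  have h1 : Surjective η[G].left := by
    have : Nonempty (𝟙_ (Over (Spec (.of k)))).left := inferInstanceAs (Nonempty (Spec (.of k)))
    exact ⟨fun x ↦ ⟨this.some, Subsingleton.elim _ _⟩⟩
  exact MorphismProperty.of_isPullback
    ((isPullback_unitSection G Y).map (Over.forget _)).flip h1

lemma unitSection_snd_apply (Y : Over (Spec (.of k))) (z : (G ⊗ Y).left) :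
    (unitSection G Y).left ((snd G Y).left z) = z := by
  obtain ⟨y, rfl⟩ := (unitSection G Y).left.surjective z
  rw [← Scheme.Hom.comp_apply (unitSection G Y).left, ← Over.comp_left, lift_snd]
  simp

omit [Subsingleton G.left] in
lemma snd_unitSection_apply (Y : Over (Spec (.of k))) (y : Y.left) :
    (snd G Y).left ((unitSection G Y).left y) = y := by
  rw [← Scheme.Hom.comp_apply, ← Over.comp_left, lift_snd]
  simp

/-- Every open subset of `G ⊗ Y` is the preimage of an open subset of `Y`. -/
lemma snd_preimage_unitSection_preimage (Y : Over (Spec (.of k))) (W : (G ⊗ Y).left.Opens) :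
    (snd G Y).left ⁻¹ᵁ ((unitSection G Y).left ⁻¹ᵁ W) = W := by
  ext z
  change (unitSection G Y).left ((snd G Y).left z) ∈ W ↔ z ∈ W
  rw [unitSection_snd_apply]

omit [Subsingleton G.left] in
lemma snd_surjective (Y : Over (Spec (.of k))) : Function.Surjective (snd G Y).left :=
  fun y ↦ ⟨_, snd_unitSection_apply Y y⟩

lemma dense_unitSection_preimage {Y : Over (Spec (.of k))} {W : (G ⊗ Y).left.Opens}
    (hW : Dense (W : Set (G ⊗ Y).left)) :
    Dense (((unitSection G Y).left ⁻¹ᵁ W : Y.left.Opens) : Set Y.left) := by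
  have := (snd_surjective (G := G) Y).denseRange.dense_image (snd G Y).left.continuous hW
  refine this.mono ?_
  rintro _ ⟨z, hz, rfl⟩
  change (unitSection G Y).left ((snd G Y).left z) ∈ W
  rwa [unitSection_snd_apply]

lemma dense_snd_preimage {Y : Over (Spec (.of k))} {V : Y.left.Opens}
    (hV : Dense (V : Set Y.left)) :
    Dense (((snd G Y).left ⁻¹ᵁ V : (G ⊗ Y).left.Opens) : Set (G ⊗ Y).left) := by
  have := (unitSection G Y).left.surjective.denseRange.dense_image
    (unitSection G Y).left.continuous hV
  refine this.mono ?_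
  rintro _ ⟨y, hy, rfl⟩
  change (snd G Y).left ((unitSection G Y).left y) ∈ V
  rwa [snd_unitSection_apply]

end Topology

/-! ### Points over the generic point -/

/-- A morphism `t : T ⟶ Y` is generic if its image lies in every dense open subset of `Y`. -/
def IsGenericPt {T Y : Over (Spec (.of k))} (t : T ⟶ Y) : Prop :=
  ∀ W : Y.left.Opens, Dense (W : Set Y.left) → ∀ s : T.left, t.left s ∈ W

lemma IsGenericPt.comp {T T' Y : Over (Spec (.of k))} {t : T ⟶ Y} (ht : IsGenericPt t)
    (s : T' ⟶ T) : IsGenericPt (s ≫ t) := by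
  intro W hW z
  rw [Over.comp_left, Scheme.Hom.comp_apply]
  exact ht W hW _

lemma IsGenericPt.lift {G T Y : Over (Spec (.of k))} [GrpObj G] [Subsingleton G.left] {t : T ⟶ Y}
    (ht : IsGenericPt t) (g : T ⟶ G) : IsGenericPt (lift g t) := by
  intro W hW s
  have h1 := ht _ (dense_unitSection_preimage hW) s
  have h2 : (snd G Y).left ((CartesianMonoidalCategory.lift g t).left s) = t.left s := by
    rw [← Scheme.Hom.comp_apply, ← Over.comp_left, lift_snd]
  rw [← h2] at h1
  change (unitSection G Y).left ((snd G Y).left _) ∈ W at h1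
  rwa [unitSection_snd_apply] at h1

section Gen

variable (X : Over (Spec (.of k))) [IsVariety X]

lemma genIncl_apply (s : (gen X).left) : (genIncl X).left s = genericPoint X.left := by
  have h : X.left.fromSpecStalk (genericPoint X.left) s ⤳ genericPoint X.left := by
    have := X.left.range_fromSpecStalk (x := genericPoint X.left)
    exact this.subset ⟨s, rfl⟩
  exact (h.antisymm (genericPoint_specializes _)).eq

lemma isGenericPt_genIncl : IsGenericPt (genIncl X) := by
  intro W hW s
  rw [genIncl_apply]
  exact ((genericPoint_spec X.left).mem_open_set_iff W.isOpen).mpr (by simpa using hW.nonempty)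

instance mono_genIncl : Mono (genIncl X) := by
  have : Mono (genIncl X).left :=
    inferInstanceAs (Mono (X.left.fromSpecStalk (genericPoint X.left)))
  exact (Over.forget _).mono_of_mono_map this

instance mono_openIncl {Y : Over (Spec (.of k))} (U : Y.left.Opens) : Mono (openIncl U) := by
  have : Mono (openIncl U).left := inferInstanceAs (Mono U.ι)
  exact (Over.forget _).mono_of_mono_map this

variable {X}

lemma exists_lift_openIncl {Y T : Over (Spec (.of k))} (U : Y.left.Opens) (t : T ⟶ Y)
    (h : ∀ s, t.left s ∈ U) : ∃ s : T ⟶ openSub U, s ≫ openIncl U = t := by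
  have hr : Set.range t.left ⊆ Set.range U.ι := by
    rintro _ ⟨s, rfl⟩
    simpa using h s
  refine ⟨Over.homMk (IsOpenImmersion.lift U.ι t.left hr) ?_, ?_⟩
  · simp only [Over.mk_hom]
    rw [IsOpenImmersion.lift_fac_assoc, Over.w]
  · ext
    simp

lemma openIncl_apply_mem {Y T : Over (Spec (.of k))} (U : Y.left.Opens) (s : T ⟶ openSub U)
    (z : T.left) : (s ≫ openIncl U).left z ∈ U := by
  rw [Over.comp_left, Scheme.Hom.comp_apply]
  exact (s.left z).2

variable (X) in
lemma exists_genTo (U : X.left.Opens) [hU : Nonempty U] :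
    ∃ j : gen X ⟶ openSub U, j ≫ openIncl U = genIncl X :=
  exists_lift_openIncl U _ fun s ↦ isGenericPt_genIncl X U
    (U.isOpen.dense (by obtain ⟨x⟩ := hU; exact ⟨x.1, x.2⟩)) s

variable (X) in
/-- The canonical map from the generic point to a nonempty open subset. -/
noncomputable def genTo (U : X.left.Opens) [Nonempty U] : gen X ⟶ openSub U :=
  (exists_genTo X U).choose

@[simp]
lemma genTo_openIncl (U : X.left.Opens) [Nonempty U] : genTo X U ≫ openIncl U = genIncl X :=
  (exists_genTo X U).choose_spec

lemma _root_.AlgebraicGeometry.exists_comp_fromSpecStalk {R : CommRingCat.{u}} [IsLocalRing R]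
    {Z : Scheme.{u}} (f : Spec R ⟶ Z) (z : Z)
    (h : f.base (IsLocalRing.closedPoint R : PrimeSpectrum R) = z) :
    ∃ φ : Spec R ⟶ Spec (Z.presheaf.stalk z), φ ≫ Z.fromSpecStalk z = f := by
  subst h
  exact ⟨Spec.map (Scheme.stalkClosedPointTo f), Scheme.Spec_stalkClosedPointTo_fromSpecStalk f⟩

/-- A morphism to `X` all of whose values are the generic point factors through the generic
point, if the source is local. -/
lemma exists_lift_genIncl {R : CommRingCat.{u}} [IsLocalRing R] {T : Over (Spec (.of k))}
    (e : T.left ≅ Spec R) (t : T ⟶ X) (h : ∀ s, t.left s = genericPoint X.left) :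
    ∃ s : T ⟶ gen X, s ≫ genIncl X = t := by
  obtain ⟨φ, hφ⟩ : ∃ φ : Spec R ⟶ Spec X.left.functionField,
      φ ≫ X.left.fromSpecStalk (genericPoint X.left) = e.inv ≫ t.left :=
    exists_comp_fromSpecStalk _ _ ((Scheme.Hom.comp_apply _ _ _).trans (h _))
  refine ⟨Over.homMk (e.hom ≫ φ) ?_, ?_⟩
  · change (e.hom ≫ φ) ≫ X.left.fromSpecStalk (genericPoint X.left) ≫ X.hom = T.hom
    rw [Category.assoc, reassoc_of% hφ, Iso.hom_inv_id_assoc, Over.w]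
  · ext : 1
    change (e.hom ≫ φ) ≫ X.left.fromSpecStalk _ = t.left
    rw [Category.assoc, hφ, Iso.hom_inv_id_assoc]

instance quasiCompact_genTo (U : X.left.Opens) [Nonempty U] : QuasiCompact (genTo X U).left := by
  have := (inferInstance : IsVariety X).separated
  have : QuasiSeparated (U.ι ≫ X.hom) := inferInstance
  have : QuasiCompact ((genTo X U).left ≫ (openSub U).hom) := by
    rw [Over.w]
    have : IsAffine (gen X).left := inferInstanceAs (IsAffine (Spec X.left.functionField))
    infer_instance
  have : QuasiSeparated (openSub U).hom := ‹QuasiSeparated (U.ι ≫ X.hom)›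
  exact .of_comp _ (openSub U).hom

instance irreducibleSpace_openSub (U : X.left.Opens) [Nonempty U] :
    IrreducibleSpace (openSub U).left :=
  inferInstanceAs (IrreducibleSpace (U : Scheme))

instance isDominant_genTo (U : X.left.Opens) [Nonempty U] : IsDominant (genTo X U).left := by
  refine ⟨?_⟩
  have : Nonempty (gen X).left := inferInstanceAs (Nonempty (Spec X.left.functionField))
  obtain ⟨s⟩ := this
  have h1 : (genTo X U).left s = genericPoint (openSub U).left := by
    apply U.ι.isOpenEmbedding.injective
    have h2 : U.ι (genericPoint (U : Scheme)) = genericPoint X.left :=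
      genericPoint_eq_of_isOpenImmersion U.ι
    refine Eq.trans ?_ h2.symm
    rw [← genIncl_apply X s, ← genTo_openIncl U, Over.comp_left, Scheme.Hom.comp_apply]
    rfl
  refine Dense.mono (Set.singleton_subset_iff.mpr ⟨s, h1⟩) ?_
  exact dense_iff_closure_eq.mpr (genericPoint_closure _)

instance isSchemeTheoreticallyDominant_whiskerLeft_genTo (Y : Over (Spec (.of k)))
    (U : X.left.Opens) [Nonempty U] :
    IsSchemeTheoreticallyDominant (Y ◁ genTo X U).left := by
  have : IsReduced (openSub U).left := inferInstanceAs (IsReduced (U : Scheme))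
  have : IsSchemeTheoreticallyDominant (genTo X U).left := .of_isDominant _
  have : Flat Y.hom := inferInstance
  have : Flat (snd Y (openSub U)).left :=
    inferInstanceAs (Flat (Limits.pullback.snd Y.hom (openSub U).hom))
  have h : IsPullback (Y ◁ genTo X U).left (snd Y (gen X)).left (snd Y (openSub U)).left
      (genTo X U).left := (isPullback_whiskerLeft Y (genTo X U)).map (Over.forget _)
  exact .of_isPullback h.flip

instance quasiCompact_whiskerLeft_genTo (Y : Over (Spec (.of k)))
    (U : X.left.Opens) [Nonempty U] : QuasiCompact (Y ◁ genTo X U).left :=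
  MorphismProperty.of_isPullback
    ((isPullback_whiskerLeft Y (genTo X U)).map (Over.forget _)).flip
    (inferInstanceAs (QuasiCompact (genTo X U).left))

/-- Two morphisms from `Y ⊗ U` to a variety that agree on `Y ⊗ Spec k(X)` are equal: `Y` is flat
over `k`, so `Y ⊗ Spec k(X)` is scheme-theoretically dense in `Y ⊗ U`. This replaces the usual
density argument, as `Y ⊗ U` need not be reduced. -/
lemma hom_ext_of_genTo {Y Z : Over (Spec (.of k))} [hZ : IsSeparated Z.hom] (U : X.left.Opens)
    [Nonempty U] {f g : Y ⊗ openSub U ⟶ Z} (h : Y ◁ genTo X U ≫ f = Y ◁ genTo X U ≫ g) :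
    f = g := by
  let i := Limits.equalizer.ι f g
  have hi : IsClosedImmersion i.left := isClosedImmersion_equalizer_ι_left f g
  have hfac : (Limits.equalizer.lift _ h).left ≫ i.left = (Y ◁ genTo X U).left := by
    rw [← Over.comp_left, Limits.equalizer.lift_ι]
  have hker : i.left.ker = ⊥ := by
    rw [eq_bot_iff, ← (Y ◁ genTo X U).left.ker_eq_bot, ← hfac]
    exact Scheme.Hom.le_ker_comp _ _
  have : IsIso i.left := IsClosedImmersion.isIso_iff_ker_eq_bot.mpr hker
  have : IsIso ((Over.forget _).map i) := this
  have : IsIso i := isIso_of_reflects_iso i (Over.forget _)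
  rw [← cancel_epi i]
  exact Limits.equalizer.condition f g

end Gen

end RatAct

/-! ### Values of rational maps -/

namespace RatAct

variable {k : Type u} [Field k]

section EvalAt

variable {Y Z T T' : Over (Spec (.of k))} {a : Y.left ⤏ Z.left}

lemma EvalAt.comp {t : T ⟶ Y} {z : T ⟶ Z} (h : EvalAt a t z) (s : T' ⟶ T) :
    EvalAt a (s ≫ t) (s ≫ z) := by
  obtain ⟨r, hr, t₀, h₁, h₂⟩ := h
  exact ⟨r, hr, s.left ≫ t₀, by simp [h₁], by simp [h₂]⟩

lemma EvalAt.unique {t : T ⟶ Y} (ht : IsGenericPt t) {z z' : T ⟶ Z} (h : EvalAt a t z)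
    (h' : EvalAt a t z') : z = z' := by
  obtain ⟨r, hr, t₀, h₁, h₂⟩ := h
  obtain ⟨r', hr', t₀', h₁', h₂'⟩ := h'
  obtain ⟨W, hW, hl, hl', e⟩ :=
    Scheme.PartialMap.toRationalMap_eq_iff.mp (hr.trans hr'.symm)
  obtain ⟨w, hw⟩ := exists_lift_openIncl W t (ht W hW)
  have hw' : w.left ≫ W.ι = t.left := congrArg (·.left) hw
  have e1 : t₀ = w.left ≫ Y.left.homOfLE hl := by
    rw [← cancel_mono r.domain.ι, h₁, Category.assoc, Scheme.homOfLE_ι, hw']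
  have e2 : t₀' = w.left ≫ Y.left.homOfLE hl' := by
    rw [← cancel_mono r'.domain.ι, h₁', Category.assoc, Scheme.homOfLE_ι, hw']
  ext : 1
  rw [← h₂, ← h₂', e1, e2, Category.assoc, Category.assoc]
  exact congrArg (w.left ≫ ·) e

/-- A morphism on a dense open subset, as a rational map. -/
noncomputable abbrev ratMap (W : Y.left.Opens) (hW : Dense (W : Set Y.left)) (y : openSub W ⟶ Z) :
    Y.left ⤏ Z.left :=
  Scheme.PartialMap.toRationalMap ⟨W, hW, y.left⟩

lemma evalAt_ratMap (W : Y.left.Opens) (hW : Dense (W : Set Y.left)) (y : openSub W ⟶ Z) :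
    EvalAt (ratMap W hW y) (openIncl W) y :=
  ⟨_, rfl, 𝟙 _, Category.id_comp _, Category.id_comp _⟩

lemma EvalAt.eq_ratMap {W : Y.left.Opens} (hW : Dense (W : Set Y.left)) {y : openSub W ⟶ Z}
    (h : EvalAt a (openIncl W) y) : a = ratMap W hW y := by
  obtain ⟨r, rfl, t₀, h₁, h₂⟩ := h
  have hle : W ≤ r.domain := by
    intro w hw
    let w' : (W : Scheme) := ⟨w, hw⟩
    have h3 : (t₀ ≫ r.domain.ι) w' ∈ r.domain := by
      rw [Scheme.Hom.comp_apply]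
      exact (t₀ w').2
    rw [h₁] at h3
    exact h3
  refine Scheme.PartialMap.toRationalMap_eq_iff.mpr ⟨W, hW, hle, le_rfl, ?_⟩
  have e1 : Y.left.homOfLE hle = t₀ := by
    rw [← cancel_mono r.domain.ι, Scheme.homOfLE_ι]; exact h₁.symm
  simp only [Scheme.PartialMap.restrict_hom, e1]
  refine h₂.trans ?_
  simp

lemma evalAt_toRationalMap (f : Y ⟶ Z) (t : T ⟶ Y) :
    EvalAt f.left.toRationalMap t (t ≫ f) :=
  ⟨f.left.toPartialMap, rfl, t.left ≫ Y.left.topIso.inv, by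
    change (t.left ≫ Y.left.topIso.inv) ≫ Y.left.topIso.hom = _
    rw [Category.assoc, Iso.inv_hom_id, Category.comp_id], by
    change (t.left ≫ Y.left.topIso.inv) ≫ Y.left.topIso.hom ≫ f.left = _
    rw [Category.assoc, Iso.inv_hom_id_assoc, Over.comp_left]⟩

end EvalAt

section Whisker

variable {G Y Z : Over (Spec (.of k))}

instance mono_whiskerLeft {Z' : Over (Spec (.of k))} (f : Z ⟶ Z') [Mono f] : Mono (G ◁ f) where
  right_cancellation g h e := by
    ext1
    · simpa using congrArg (· ≫ fst _ _) e
    · rw [← cancel_mono f]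
      simpa using congrArg (· ≫ snd _ _) e

lemma exists_iso_openSub_snd_preimage (U : Y.left.Opens) :
    ∃ e : G ⊗ openSub U ≅ openSub ((snd G Y).left ⁻¹ᵁ U), e.hom ≫ openIncl _ = G ◁ openIncl U := by
  obtain ⟨f, hf⟩ := exists_lift_openIncl ((snd G Y).left ⁻¹ᵁ U) (G ◁ openIncl U) fun s ↦ by
    change (snd G Y).left ((G ◁ openIncl U).left s) ∈ U
    rw [← Scheme.Hom.comp_apply, ← Over.comp_left, whiskerLeft_snd]
    exact openIncl_apply_mem _ _ _
  obtain ⟨g, hg⟩ := exists_lift_openIncl U (openIncl ((snd G Y).left ⁻¹ᵁ U) ≫ snd G Y) fun s ↦ by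
    rw [Over.comp_left, Scheme.Hom.comp_apply]
    exact s.2
  have h2 : lift (openIncl _ ≫ fst G Y) g ≫ G ◁ openIncl U =
      openIncl ((snd G Y).left ⁻¹ᵁ U) := by
    ext1
    · rw [Category.assoc, whiskerLeft_fst, lift_fst]
    · rw [Category.assoc, whiskerLeft_snd, lift_snd_assoc, hg]
  refine ⟨⟨f, lift (openIncl _ ≫ fst G Y) g, ?_, ?_⟩, hf⟩
  · rw [← cancel_mono (G ◁ openIncl U), Category.assoc, h2, hf, Category.id_comp]
  · rw [← cancel_mono (openIncl ((snd G Y).left ⁻¹ᵁ U)), Category.assoc, hf, h2, Category.id_comp]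

variable [GrpObj G] [Subsingleton G.left]

/-- A rational map defined over `k` is given by a morphism on `G ⊗ U` for some dense open `U`. -/
lemma exists_evalAt_whiskerLeft_openIncl {a : (G ⊗ Y).left ⤏ Z.left} {W : (G ⊗ Y).left.Opens}
    (hW : Dense (W : Set (G ⊗ Y).left)) {y : openSub W ⟶ Z} (h : EvalAt a (openIncl W) y) :
    ∃ U : Y.left.Opens, Dense (U : Set Y.left) ∧ ∃ z : G ⊗ openSub U ⟶ Z,
      EvalAt a (G ◁ openIncl U) z := by
  refine ⟨_, dense_unitSection_preimage hW, ?_⟩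
  obtain ⟨e, he⟩ := exists_iso_openSub_snd_preimage (G := G) ((unitSection G Y).left ⁻¹ᵁ W)
  revert e
  rw [snd_preimage_unitSection_preimage]
  intro e he
  exact ⟨e.hom ≫ y, he ▸ h.comp e.hom⟩

/-- The rational map given by a morphism on `G ⊗ U`. -/
lemma exists_ratMap (U : Y.left.Opens) (hU : Dense (U : Set Y.left)) (z : G ⊗ openSub U ⟶ Z) :
    ∃ a : (G ⊗ Y).left ⤏ Z.left, EvalAt a (G ◁ openIncl U) z ∧
      ∃ e : openSub ((snd G Y).left ⁻¹ᵁ U) ⟶ G ⊗ openSub U, IsIso e ∧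
        e ≫ G ◁ openIncl U = openIncl _ ∧ EvalAt a (openIncl ((snd G Y).left ⁻¹ᵁ U)) (e ≫ z) := by
  obtain ⟨e, he⟩ := exists_iso_openSub_snd_preimage (G := G) U
  have h := evalAt_ratMap _ (dense_snd_preimage (G := G) hU) (e.inv ≫ z)
  refine ⟨_, ?_, e.inv, inferInstance, by rw [← he, Iso.inv_hom_id_assoc], h⟩
  have := h.comp e.hom
  rwa [he, Iso.hom_inv_id_assoc] at this

lemma EvalAt.eq_of_whiskerLeft {a b : (G ⊗ Y).left ⤏ Z.left} (U : Y.left.Opens)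
    (hU : Dense (U : Set Y.left)) {z : G ⊗ openSub U ⟶ Z} (ha : EvalAt a (G ◁ openIncl U) z)
    (hb : EvalAt b (G ◁ openIncl U) z) : a = b := by
  obtain ⟨e, he⟩ := exists_iso_openSub_snd_preimage (G := G) U
  have h1 := ha.comp e.inv
  have h2 := hb.comp e.inv
  rw [← he, Iso.inv_hom_id_assoc] at h1 h2
  exact (h1.eq_ratMap (dense_snd_preimage hU)).trans (h2.eq_ratMap (dense_snd_preimage hU)).symm

end Whisker

section GenericPoint

variable {G X Z : Over (Spec (.of k))} [IsVariety X] [GrpObj G] [Subsingleton G.left]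

lemma dense_of_nonempty (U : X.left.Opens) [hU : Nonempty U] : Dense (U : Set X.left) :=
  U.isOpen.dense (by obtain ⟨x⟩ := hU; exact ⟨x.1, x.2⟩)

lemma isGenericPt_whiskerLeft_genIncl : IsGenericPt (G ◁ genIncl X) := by
  have : G ◁ genIncl X = lift (fst _ _) (snd _ _ ≫ genIncl X) := by ext1 <;> simp
  rw [this]
  exact ((isGenericPt_genIncl X).comp _).lift _

/-- A rational map is given by `z` on `G ⊗ U` if it is so at the generic point. The hypothesis `h`
says that the rational map is defined over `k`. -/
lemma EvalAt.of_genTo [IsSeparated Z.hom] {a : (G ⊗ X).left ⤏ Z.left} {W : (G ⊗ X).left.Opens}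
    (hW : Dense (W : Set (G ⊗ X).left)) {y : openSub W ⟶ Z} (h : EvalAt a (openIncl W) y)
    (U : X.left.Opens) [Nonempty U] (z : G ⊗ openSub U ⟶ Z)
    (hz : EvalAt a (G ◁ genIncl X) (G ◁ genTo X U ≫ z)) : EvalAt a (G ◁ openIncl U) z := by
  obtain ⟨V, hV, v, hv⟩ := exists_evalAt_whiskerLeft_openIncl hW h
  obtain ⟨b, hb, -⟩ := exists_ratMap U (dense_of_nonempty U) z
  have hd : Dense ((V ⊓ U : X.left.Opens) : Set X.left) :=
    hV.inter_of_isOpen_left (dense_of_nonempty U) V.isOpen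
  have : Nonempty (V ⊓ U : X.left.Opens) := by
    obtain ⟨x, hx⟩ := hd.nonempty
    exact ⟨⟨x, hx⟩⟩
  obtain ⟨s, hs⟩ := exists_lift_openIncl V (openIncl (V ⊓ U)) fun x ↦ x.2.1
  obtain ⟨t, ht⟩ := exists_lift_openIncl U (openIncl (V ⊓ U)) fun x ↦ x.2.2
  have h1 : EvalAt a (G ◁ openIncl (V ⊓ U)) (G ◁ s ≫ v) := by
    have := hv.comp (G ◁ s)
    rwa [← whiskerLeft_comp, hs] at this
  have h2 : EvalAt b (G ◁ openIncl (V ⊓ U)) (G ◁ t ≫ z) := by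
    have := hb.comp (G ◁ t)
    rwa [← whiskerLeft_comp, ht] at this
  have h3 : G ◁ s ≫ v = G ◁ t ≫ z := by
    apply hom_ext_of_genTo
    have h4 := h1.comp (G ◁ genTo X (V ⊓ U))
    rw [← whiskerLeft_comp, genTo_openIncl] at h4
    rw [h4.unique isGenericPt_whiskerLeft_genIncl hz, ← whiskerLeft_comp_assoc]
    congr 2
    rw [← cancel_mono (openIncl U), Category.assoc, ht, genTo_openIncl, genTo_openIncl]
  rw [h3] at h1
  rw [h1.eq_of_whiskerLeft _ hd h2]
  exact hb

/-! ### Actions on points, and schemes with one point -/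

/-- The laws of an action of a group object, on points. -/
structure IsActionMap {Y : Over (Spec (.of k))} (α : G ⊗ Y ⟶ Y) : Prop where
  one {T : Over (Spec (.of k))} (x : T ⟶ Y) : lift 1 x ≫ α = x
  mul {T : Over (Spec (.of k))} (g h : T ⟶ G) (x : T ⟶ Y) :
    lift g (lift h x ≫ α) ≫ α = lift (g * h) x ≫ α

instance isSeparated_hom : IsSeparated X.hom := IsVariety.separated

instance : IsAffine (gen X).left := inferInstanceAs (IsAffine (Spec X.left.functionField))

instance : Subsingleton (gen X).left :=
  inferInstanceAs (Subsingleton (PrimeSpectrum X.left.functionField))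

instance : Nonempty (gen X).left :=
  inferInstanceAs (Nonempty (PrimeSpectrum X.left.functionField))

instance subsingleton_tensor (Y : Over (Spec (.of k))) [Subsingleton Y.left] :
    Subsingleton (G ⊗ Y).left :=
  (unitSection G Y).left.surjective.subsingleton

lemma exists_iso_spec_isLocalRing {T : Over (Spec (.of k))} [IsAffine T.left]
    [Subsingleton T.left] [Nonempty T.left] :
    ∃ R : CommRingCat.{u}, ∃ _ : IsLocalRing R, Nonempty (T.left ≅ Spec R) := by
  refine ⟨_, ?_, ⟨T.left.isoSpec⟩⟩
  have h1 : Subsingleton (PrimeSpectrum Γ(T.left, ⊤)) :=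
    T.left.isoSpec.hom.homeomorph.surjective.subsingleton
  have h2 : Nonempty (PrimeSpectrum Γ(T.left, ⊤)) := (‹Nonempty T.left›).map T.left.isoSpec.hom.homeomorph
  have : Nontrivial Γ(T.left, ⊤) := PrimeSpectrum.nonempty_iff_nontrivial.mp h2
  refine IsLocalRing.of_unique_max_ideal ?_
  obtain ⟨m, hm⟩ := Ideal.exists_maximal Γ(T.left, ⊤)
  exact ⟨m, hm, fun n hn ↦ congrArg PrimeSpectrum.asIdeal
    (Subsingleton.elim (⟨n, hn.isPrime⟩ : PrimeSpectrum Γ(T.left, ⊤)) ⟨m, hm.isPrime⟩)⟩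

instance isAffine_tensor [IsFinite G.hom] (Y : Over (Spec (.of k))) [IsAffine Y.left] :
    IsAffine (G ⊗ Y).left := by
  have : IsAffine G.left := isAffine_of_isAffineHom G.hom
  exact inferInstanceAs (IsAffine (Limits.pullback G.hom Y.hom))

end GenericPoint

end RatAct

namespace RatAct

variable {k : Type u} [Field k]

/-! ### Rational actions at the generic point -/

section GenericAction

variable {G X : Over (Spec (.of k))} [IsVariety X] [GrpObj G] [Subsingleton G.left]

lemma dense_of_nonempty_tensor {W : (G ⊗ X).left.Opens} (hW : (W : Set (G ⊗ X).left).Nonempty) :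
    Dense (W : Set (G ⊗ X).left) := by
  rw [← snd_preimage_unitSection_preimage X W]
  apply dense_snd_preimage
  refine IsOpen.dense ((unitSection G X).left ⁻¹ᵁ W).isOpen ?_
  obtain ⟨w, hw⟩ := hW
  refine ⟨(snd G X).left w, ?_⟩
  change (unitSection G X).left ((snd G X).left w) ∈ W
  rwa [unitSection_snd_apply]

/-- An idempotent endomorphism of the spectrum of a field is the identity. -/
lemma eq_id_of_comp_self {K : Type u} [Field K] (e : Spec (.of K) ⟶ Spec (.of K))
    (h : e ≫ e = e) : e = 𝟙 _ := by
  obtain ⟨φ, rfl⟩ := Spec.map_surjective e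
  rw [← Spec.map_comp] at h
  have h1 := Spec.map_injective h
  have : φ = 𝟙 _ := by
    ext f
    have h2 := congrArg (fun ψ ↦ ψ.hom f) h1
    exact φ.hom.injective h2
  rw [this, Spec.map_id]

/-- A rational action of an infinitesimal group scheme restricts to an action on the generic point:
the product `G ⊗ Spec k(X)` is the spectrum of a local ring whose point is mapped to the generic
point of `X`, as the action is dominant. -/
theorem IsRationalAction.exists_gen [IsFinite G.hom] {a : (G ⊗ X).left ⤏ X.left}
    (ha : IsRationalAction G X a) :
    ∃ α : G ⊗ gen X ⟶ gen X, EvalAt a (G ◁ genIncl X) (α ≫ genIncl X) ∧ IsActionMap α := by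
  obtain ⟨U, hU, y, hy, -, hd⟩ := ha.birational
  obtain ⟨t, ht⟩ := exists_lift_openIncl U (G ◁ genIncl X) (isGenericPt_whiskerLeft_genIncl U hU)
  have hval : ∀ s, (t ≫ y).left s = genericPoint X.left := by
    intro s
    have hy' : DenseRange y.left := by
      have := (snd_surjective (G := G) X).denseRange.comp hd (snd G X).left.continuous
      have h2 : y.left = (lift (openIncl U ≫ fst G X) y).left ≫ (snd G X).left := by
        rw [← Over.comp_left, lift_snd]
      rw [h2]
      simpa [Scheme.Hom.comp_base] using this
    have hξ : closure {t.left s} = Set.univ := by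
      rw [← dense_iff_closure_eq, dense_iff_inter_open]
      intro V hV ⟨v, hv⟩
      have hne : ((U.ι ''ᵁ ⟨V, hV⟩ : (G ⊗ X).left.Opens) : Set (G ⊗ X).left).Nonempty :=
        ⟨_, v, hv, rfl⟩
      have := isGenericPt_whiskerLeft_genIncl (G := G) (X := X) _ (dense_of_nonempty_tensor hne) s
      rw [← ht, Over.comp_left, Scheme.Hom.comp_apply] at this
      obtain ⟨v', hv', e⟩ := this
      refine ⟨t.left s, ?_, rfl⟩
      rwa [← U.ι.isOpenEmbedding.injective e]
    have hgen : closure {(t ≫ y).left s} = Set.univ := by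
      rw [← dense_iff_closure_eq]
      have : Dense ({t.left s} : Set _) := dense_iff_closure_eq.mpr hξ
      have := hy'.dense_image y.left.continuous this
      rw [Set.image_singleton] at this
      rwa [Over.comp_left, Scheme.Hom.comp_apply]
    exact IsGenericPoint.eq hgen (genericPoint_spec X.left)
  have : Nonempty (G ⊗ gen X).left := ⟨(unitSection G (gen X)).left (Classical.arbitrary _)⟩
  obtain ⟨R, hR, ⟨e⟩⟩ := exists_iso_spec_isLocalRing (T := G ⊗ gen X)
  obtain ⟨α, hα⟩ := exists_lift_genIncl e (t ≫ y) hval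
  have hev : EvalAt a (G ◁ genIncl X) (α ≫ genIncl X) := by
    rw [hα, ← ht]
    exact hy.comp t
  have hmul {T : Over (Spec (.of k))} (g h : T ⟶ G) (x : T ⟶ gen X) :
      lift g (lift h x ≫ α) ≫ α = lift (g * h) x ≫ α := by
    obtain ⟨W, hW, v, z, h1, h2, h3⟩ := ha.assoc
    have hg : IsGenericPt (G ◁ (G ◁ genIncl X)) := by
      have : G ◁ (G ◁ genIncl X) = lift (fst _ _) (snd _ _ ≫ G ◁ genIncl X) := by ext1 <;> simp
      rw [this]
      exact (isGenericPt_whiskerLeft_genIncl.comp _).lift _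
    obtain ⟨w, hw⟩ := exists_lift_openIncl W (G ◁ (G ◁ genIncl X)) (hg W hW)
    have e1 := h1.comp w
    rw [reassoc_of% hw, whiskerLeft_snd] at e1
    have e2 : w ≫ v = snd G (G ⊗ gen X) ≫ α ≫ genIncl X :=
      e1.unique (isGenericPt_whiskerLeft_genIncl.comp _) (hev.comp _)
    have e3 : w ≫ lift (openIncl W ≫ fst G (G ⊗ X)) v =
        lift (fst _ _) (snd G (G ⊗ gen X) ≫ α) ≫ G ◁ genIncl X := by
      ext1
      · rw [Category.assoc, lift_fst, reassoc_of% hw, Category.assoc, whiskerLeft_fst,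
          whiskerLeft_fst, lift_fst]
      · rw [Category.assoc, lift_snd, e2, Category.assoc, whiskerLeft_snd, lift_snd_assoc,
          Category.assoc]
    have e4 : w ≫ openIncl W ≫ (α_ G G X).inv ≫ μ[G] ▷ X =
        lift (fst _ _ * (snd G (G ⊗ gen X) ≫ fst _ _)) (snd _ _ ≫ snd _ _) ≫ G ◁ genIncl X := by
      have e5 : G ◁ G ◁ genIncl X ≫ (α_ G G X).inv ≫ fst _ _ =
          lift (fst _ _) (snd _ _ ≫ fst _ _) := by ext1 <;> simp
      rw [reassoc_of% hw]
      ext1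
      · simp [Hom.mul_def, ← e5]
      · simp
    have e5 := h2.comp w
    have e6 := h3.comp w
    rw [e3] at e5
    rw [e4] at e6
    have e7 := (hev.comp _).unique (isGenericPt_whiskerLeft_genIncl.comp _) e5
    have e8 := (hev.comp _).unique (isGenericPt_whiskerLeft_genIncl.comp _) e6
    have e9 := e7.trans e8.symm
    rw [← Category.assoc, ← Category.assoc, cancel_mono] at e9
    have := congrArg (lift g (lift h x) ≫ ·) e9
    simpa only [← Category.assoc, comp_lift, lift_fst, lift_snd, comp_mul] using this
  refine ⟨α, hev, ⟨fun x ↦ ?_, hmul⟩⟩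
  -- The unit acts by an endomorphism `e` of `Spec k(X)`, which is idempotent by associativity.
  let e : gen X ⟶ gen X := lift 1 (𝟙 _) ≫ α
  have he {T : Over (Spec (.of k))} (x : T ⟶ gen X) : lift 1 x ≫ α = x ≫ e := by
    simp only [e, ← Category.assoc, comp_lift, comp_one, Category.comp_id]
  have hee : e ≫ e = e := by
    rw [← he e]
    simp only [e]
    rw [hmul, _root_.mul_one]
  have : e = 𝟙 _ := by
    ext1
    exact eq_id_of_comp_self (K := X.left.functionField) e.left (congrArg (·.left) hee)
  rw [he, this, Category.comp_id]

variable {N : Over (Spec (.of k))} [GrpObj N] [Subsingleton N.left]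

/-- A rational action restricts to the restricted action on the generic point. -/
lemma RestrictsTo.comp_eq {j : N ⟶ G} {a : (G ⊗ X).left ⤏ X.left} {b : (N ⊗ X).left ⤏ X.left}
    {z : G ⊗ gen X ⟶ X} {w : N ⊗ gen X ⟶ X} (h : RestrictsTo j a b)
    (ha : EvalAt a (G ◁ genIncl X) z) (hb : EvalAt b (N ◁ genIncl X) w) :
    j ▷ gen X ≫ z = w := by
  obtain ⟨W, hW, y, h1, h2⟩ := h
  obtain ⟨t, ht⟩ := exists_lift_openIncl W (N ◁ genIncl X) (isGenericPt_whiskerLeft_genIncl W hW)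
  have e1 := h1.comp t
  have e2 := h2.comp t
  rw [reassoc_of% ht, whisker_exchange] at e1
  rw [ht] at e2
  rw [hb.unique isGenericPt_whiskerLeft_genIncl e2]
  exact (ha.comp _).unique (isGenericPt_whiskerLeft_genIncl.comp _) e1

/-- If the action of a subgroup is trivial at the generic point, then it is trivial as a rational
action. -/
lemma restrictsTo_snd (j : N ⟶ G) {a : (G ⊗ X).left ⤏ X.left}
    {W : (G ⊗ X).left.Opens} (hW : Dense (W : Set (G ⊗ X).left)) {y : openSub W ⟶ X}
    (h : EvalAt a (openIncl W) y) {α : G ⊗ gen X ⟶ gen X}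
    (ha : EvalAt a (G ◁ genIncl X) (α ≫ genIncl X)) (hj : j ▷ gen X ≫ α = snd _ _) :
    RestrictsTo j a (snd N X).left.toRationalMap := by
  obtain ⟨U, hU, z, hz⟩ := exists_evalAt_whiskerLeft_openIncl hW h
  obtain ⟨e, he⟩ := exists_iso_openSub_snd_preimage (G := N) U
  have : Nonempty U := by
    obtain ⟨x, hx⟩ := hU.nonempty
    exact ⟨⟨x, hx⟩⟩
  have h2 : j ▷ openSub U ≫ z = snd _ _ ≫ openIncl U := by
    apply hom_ext_of_genTo
    have h4 := hz.comp (G ◁ genTo X U)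
    rw [← whiskerLeft_comp, genTo_openIncl] at h4
    rw [whisker_exchange_assoc, h4.unique isGenericPt_whiskerLeft_genIncl ha, reassoc_of% hj,
      whiskerLeft_snd_assoc, genTo_openIncl]
  refine ⟨_, dense_snd_preimage hU, openIncl _ ≫ snd N X, ?_, evalAt_toRationalMap _ _⟩
  have h3 := (hz.comp (j ▷ openSub U)).comp e.inv
  rw [h2] at h3
  have e1 : openIncl ((snd N X).left ⁻¹ᵁ U) = e.inv ≫ N ◁ openIncl U := by
    rw [← he, Iso.inv_hom_id_assoc]
  rw [e1, Category.assoc, Category.assoc, whiskerLeft_snd, whisker_exchange]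
  exact h3

end GenericAction

end RatAct

/-! ### Functions on products -/

namespace RatAct

open scoped TensorProduct

variable {k : Type u} [Field k]

/-- The ring of global functions on a `k`-scheme. -/
def Fn (T : Over (Spec (.of k))) : Type u := Γ(T.left, ⊤)

noncomputable instance (T : Over (Spec (.of k))) : CommRing (Fn T) :=
  inferInstanceAs (CommRing Γ(T.left, ⊤))

noncomputable instance (T : Over (Spec (.of k))) : Algebra k (Fn T) :=
  RingHom.toAlgebra (S := Γ(T.left, ⊤))
    ((Scheme.ΓSpecIso (.of k)).inv ≫ Scheme.Hom.appTop (Y := Spec (.of k)) T.hom).hom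

section pb

variable {S T U Y : Over (Spec (.of k))}

/-- Pullback of functions along a morphism of `k`-schemes. -/
noncomputable def pb (f : S ⟶ T) : Fn T →ₐ[k] Fn S where
  toRingHom := (f.left.appTop).hom
  commutes' c := by
    have : (Scheme.Hom.appTop (Y := Spec (.of k)) T.hom) ≫ f.left.appTop =
        Scheme.Hom.appTop (Y := Spec (.of k)) S.hom := by
      rw [← Over.w f, Scheme.Hom.comp_appTop]
    exact congrArg (fun φ ↦ φ.hom ((Scheme.ΓSpecIso (.of k)).inv.hom c)) this

lemma pb_comp_apply (f : S ⟶ T) (g : T ⟶ U) (z : Fn U) : pb (f ≫ g) z = pb f (pb g z) := by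
  change (Scheme.Hom.appTop (f.left ≫ g.left)).hom z = _
  rw [Scheme.Hom.comp_appTop]
  rfl

lemma pb_id_apply (z : Fn T) : pb (𝟙 T) z = z := by
  change (Scheme.Hom.appTop (𝟙 T.left)).hom z = _
  rw [Scheme.Hom.id_appTop]
  rfl

/-- Morphisms to an affine scheme are determined by the pullback of functions. -/
lemma hom_ext_of_isAffine [IsAffine T.left] {f g : S ⟶ T} (h : ∀ z, pb f z = pb g z) : f = g := by
  ext : 1
  apply AlgebraicGeometry.ext_of_isAffine
  ext z
  exact h z

/-- Morphisms to an affine scheme are given by homomorphisms of algebras. -/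
lemma exists_pb_eq [IsAffine T.left] (φ : Fn T →ₐ[k] Fn S) : ∃ f : S ⟶ T, pb f = φ := by
  let φ' : Γ(T.left, ⊤) ⟶ Γ(S.left, ⊤) := CommRingCat.ofHom φ.toRingHom
  let f : S.left ⟶ T.left := S.left.toSpecΓ ≫ Spec.map φ' ≫ T.left.isoSpec.inv
  have hf : f.appTop = φ' := by
    have h1 := Scheme.toSpecΓ_naturality f
    have h2 : S.left.toSpecΓ ≫ Spec.map f.appTop = S.left.toSpecΓ ≫ Spec.map φ' := by
      rw [← h1]
      simp only [f, Category.assoc]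
      rw [← T.left.isoSpec_hom, Iso.inv_hom_id, Category.comp_id]
    have h3 := congrArg (fun ψ ↦ (Scheme.ΓSpecIso _).inv ≫ Scheme.Hom.appTop ψ) h2
    simpa using h3
  refine ⟨Over.homMk f ?_, ?_⟩
  · apply AlgebraicGeometry.ext_of_isAffine
    rw [Scheme.Hom.comp_appTop, hf, ← cancel_epi (Scheme.ΓSpecIso (.of k)).inv]
    ext c
    exact φ.commutes c
  · ext z
    exact congrArg (fun ψ ↦ ψ.hom z) hf

variable (Y T) in
/-- The functions on a product of affine schemes form the tensor product. -/
lemma bijective_productMap [IsAffine Y.left] [IsAffine T.left] :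
    Function.Bijective (Algebra.TensorProduct.productMap (pb (fst Y T)) (pb (snd Y T))) := by
  have hp : IsPullback (fst Y T).left (snd Y T).left Y.hom T.hom :=
    IsPullback.of_hasPullback Y.hom T.hom
  have h1 := isPushout_appTop_of_isPullback hp
  have h2 : IsPushout (CommRingCat.ofHom (algebraMap k (Fn Y)))
      (CommRingCat.ofHom (algebraMap k (Fn T)))
      (CommRingCat.ofHom (pb (fst Y T)).toRingHom) (CommRingCat.ofHom (pb (snd Y T)).toRingHom) := by
    refine h1.of_iso (Scheme.ΓSpecIso (.of k)) (Iso.refl _) (Iso.refl _) (Iso.refl _) ?_ ?_ ?_ ?_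
    · exact (Category.comp_id _).trans (Iso.hom_inv_id_assoc _ _).symm
    · exact (Category.comp_id _).trans (Iso.hom_inv_id_assoc _ _).symm
    · exact (Category.comp_id _).trans (Category.id_comp _).symm
    · exact (Category.comp_id _).trans (Category.id_comp _).symm
  let e := (CommRingCat.isPushout_tensorProduct k (Fn Y) (Fn T)).isoIsPushout _ _ h2
  have he : (Algebra.TensorProduct.productMap (pb (fst Y T)) (pb (snd Y T))).toRingHom
      = e.hom.hom := by
    have hl := (CommRingCat.isPushout_tensorProduct k (Fn Y) (Fn T)).inl_isoIsPushout_hom _ _ h2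
    have hr := (CommRingCat.isPushout_tensorProduct k (Fn Y) (Fn T)).inr_isoIsPushout_hom _ _ h2
    apply RingHom.coe_addMonoidHom_injective
    apply AddMonoidHom.toIntLinearMap_injective
    ext z
    change Algebra.TensorProduct.productMap (pb (fst Y T)) (pb (snd Y T)) z = e.hom.hom z
    induction z with
    | zero => simp
    | add a b ha hb => rw [map_add, map_add, ha, hb]
    | tmul a b =>
      have ha := congrArg (fun ψ ↦ ψ.hom a) hl
      have hb := congrArg (fun ψ ↦ ψ.hom b) hr
      have : a ⊗ₜ[k] b = (a ⊗ₜ 1) * (1 ⊗ₜ b) := by simp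
      rw [this, map_mul, map_mul]
      simp only [Algebra.TensorProduct.productMap_apply_tmul, map_one, _root_.mul_one, _root_.one_mul]
      exact congrArg₂ (· * ·) ha.symm hb.symm
  have h3 : Function.Bijective e.hom.hom :=
    ConcreteCategory.bijective_of_isIso e.hom
  rw [← he] at h3
  exact h3

/-- The function `∑ b_i ⊗ f_i` on `Y ⊗ T`. -/
noncomputable def expand {I : Type*} [Fintype I] (b : I → Fn Y) (f : I → Fn T) : Fn (Y ⊗ T) :=
  ∑ i, pb (fst Y T) (b i) * pb (snd Y T) (f i)

/-- Functions on `Y ⊗ T` are uniquely of the form `∑ b_i ⊗ f_i`, for a basis `b_i` of `𝒪(Y)`. -/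
lemma bijective_expand [IsAffine Y.left] [IsAffine T.left] {I : Type*} [Fintype I]
    (b : Module.Basis I k (Fn Y)) : Function.Bijective (expand (T := T) b) := by
  classical
  let e : (I → Fn T) ≃ₗ[k] Fn Y ⊗[k] Fn T :=
    (Finsupp.linearEquivFunOnFinite k (Fn T) I).symm ≪≫ₗ
      (TensorProduct.equivFinsuppOfBasisLeft b).symm
  have : (expand (T := T) b) = Algebra.TensorProduct.productMap (pb (fst Y T)) (pb (snd Y T)) ∘ e := by
    ext f
    simp [expand, e, TensorProduct.equivFinsuppOfBasisLeft_symm_apply, Finsupp.sum_fintype]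
  rw [this]
  exact Function.Bijective.comp (bijective_productMap (Y := Y) (T := T))
    (show Function.Bijective (fun f ↦ e f) from e.bijective)

lemma pb_whiskerLeft_expand (f : T ⟶ U) {I : Type*} [Fintype I] (b : I → Fn Y) (g : I → Fn U) :
    pb (Y ◁ f) (expand b g) = expand b (fun i ↦ pb f (g i)) := by
  simp only [expand, map_sum, map_mul, ← pb_comp_apply, whiskerLeft_fst, whiskerLeft_snd]

lemma pb_lift_expand (g : S ⟶ Y) (x : S ⟶ T) {I : Type*} [Fintype I] (b : I → Fn Y)
    (f : I → Fn T) : pb (lift g x) (expand b f) = ∑ i, pb g (b i) * pb x (f i) := by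
  simp only [expand, map_sum, map_mul, ← pb_comp_apply, lift_fst, lift_snd]

end pb

section Gen

variable {X T S : Over (Spec (.of k))} [IsVariety X]

variable (X) in
/-- The functions on the generic point are the elements of the function field. -/
noncomputable def fnGen : X.left.functionField ≃ₐ[k] Fn (gen X) :=
  AlgEquiv.ofRingEquiv
    (f := (Scheme.ΓSpecIso X.left.functionField).symm.commRingCatIsoToRingEquiv) fun c ↦ by
      have h : Spec.map (CommRingCat.ofHom (constMap X)) = (gen X).hom := Spec.map_preimage _
      have h2 := Scheme.ΓSpecIso_inv_naturality (CommRingCat.ofHom (constMap X))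
      rw [h] at h2
      exact congrArg (fun ψ ↦ ψ.hom c) h2

/-- The pullback of rational functions along a morphism to the generic point. -/
noncomputable def pbK (β : T ⟶ gen X) : X.left.functionField →ₐ[k] Fn T :=
  (pb β).comp (fnGen X).toAlgHom

lemma pbK_apply (β : T ⟶ gen X) (f : X.left.functionField) : pbK β f = pb β (fnGen X f) := rfl

lemma pb_apply_gen (β : T ⟶ gen X) (f : Fn (gen X)) : pb β f = pbK β ((fnGen X).symm f) := by
  rw [pbK_apply, AlgEquiv.apply_symm_apply]

lemma pbK_comp (s : S ⟶ T) (β : T ⟶ gen X) (f : X.left.functionField) :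
    pbK (s ≫ β) f = pb s (pbK β f) := by
  rw [pbK_apply, pbK_apply, pb_comp_apply]

lemma pbK_id (f : X.left.functionField) : pbK (𝟙 (gen X)) f = fnGen X f := by
  rw [pbK_apply, pb_id_apply]

lemma hom_gen_ext {β β' : T ⟶ gen X} (h : ∀ f, pbK β f = pbK β' f) : β = β' :=
  hom_ext_of_isAffine fun z ↦ by rw [pb_apply_gen, pb_apply_gen, h]

lemma exists_pbK_eq (φ : X.left.functionField →ₐ[k] Fn T) : ∃ β : T ⟶ gen X, pbK β = φ := by
  obtain ⟨f, hf⟩ := exists_pb_eq (T := gen X) (φ.comp (fnGen X).symm.toAlgHom)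
  refine ⟨f, ?_⟩
  ext z
  rw [pbK_apply, hf]
  simp

end Gen

end RatAct

/-! ### Group schemes of height at most one -/

namespace RatAct

open scoped TensorProduct

variable {k : Type u} [Field k]

section Counit

variable (k) in
/-- Functions on the base are scalars. -/
lemma bijective_algebraMap_fn_unit :
    Function.Bijective (algebraMap k (Fn (𝟙_ (Over (Spec (.of k)))))) := by
  have : IsIso ((Scheme.ΓSpecIso (.of k)).inv ≫
      Scheme.Hom.appTop (Y := Spec (.of k)) (𝟙_ (Over (Spec (.of k)))).hom) := by
    have : (𝟙_ (Over (Spec (.of k)))).hom = 𝟙 (Spec (.of k)) := rfl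
    rw [this, Scheme.Hom.id_appTop]
    infer_instance
  exact ConcreteCategory.bijective_of_isIso ((Scheme.ΓSpecIso (.of k)).inv ≫
      Scheme.Hom.appTop (Y := Spec (.of k)) (𝟙_ (Over (Spec (.of k)))).hom)

/-- Evaluation of a function at the unit of a group scheme. -/
noncomputable def counit (H : Over (Spec (.of k))) [GrpObj H] : Fn H →ₐ[k] k :=
  ((AlgEquiv.ofBijective (Algebra.ofId k (Fn (𝟙_ (Over (Spec (.of k))))))
    (bijective_algebraMap_fn_unit k)).symm.toAlgHom).comp (pb η[H])

variable {H T : Over (Spec (.of k))} [GrpObj H]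

lemma pb_one (f : Fn H) : pb (1 : T ⟶ H) f = algebraMap k (Fn T) (counit H f) := by
  rw [Hom.one_def, pb_comp_apply]
  have : pb η[H] f = algebraMap k _ (counit H f) :=
    ((AlgEquiv.ofBijective (Algebra.ofId k (Fn (𝟙_ (Over (Spec (.of k))))))
      (bijective_algebraMap_fn_unit k)).apply_symm_apply _).symm
  rw [this, AlgHom.commutes]

lemma heightLEOne_iff {p : ℕ} :
    HeightLEOne p H ↔ ∀ f : Fn H, f ^ p = algebraMap k (Fn H) (counit H f) ^ p := by
  have h (f : Fn H) : (toUnit H ≫ η[H]).left.appTop.hom f = algebraMap k (Fn H) (counit H f) :=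
    pb_one f
  exact forall_congr' fun f ↦ by rw [← h f]; rfl

lemma subsingleton_of_heightLEOne [IsAffine H.left] {p : ℕ} (hp : p ≠ 0) (h : HeightLEOne p H) :
    Subsingleton H.left := by
  rw [heightLEOne_iff] at h
  have : Subsingleton (PrimeSpectrum (Fn H)) := by
    refine ⟨fun P Q ↦ PrimeSpectrum.ext (Ideal.ext fun f ↦ ?_)⟩
    have key (P : PrimeSpectrum (Fn H)) : f ∈ P.asIdeal ↔ counit H f = 0 := by
      rw [← P.2.pow_mem_iff_mem p (Nat.pos_of_ne_zero hp), h, P.2.pow_mem_iff_mem p (Nat.pos_of_ne_zero hp)]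
      refine ⟨fun h0 ↦ ?_, fun h0 ↦ by simp [h0]⟩
      by_contra hne
      exact P.2.ne_top (Ideal.eq_top_of_isUnit_mem _ h0 ((isUnit_iff_ne_zero.mpr hne).map _))
    rw [key, key]
  have : Subsingleton (Spec Γ(H.left, ⊤)) := this
  exact H.left.isoSpec.hom.homeomorph.injective.subsingleton

end Counit

/-! ### The group scheme `μ_p^n` -/

section Mu

variable {p n : ℕ} {T S : Over (Spec (.of k))}

variable (k p n) in
/-- The ring of functions on `μ_p^n`. -/
noncomputable def fnMu : MuAlg k p n ≃ₐ[k] Fn (muP k p n) :=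
  AlgEquiv.ofRingEquiv
    (f := (Scheme.ΓSpecIso (.of (MuAlg k p n))).symm.commRingCatIsoToRingEquiv) fun c ↦ by
      have h2 := Scheme.ΓSpecIso_inv_naturality (CommRingCat.ofHom (algebraMap k (MuAlg k p n)))
      exact congrArg (fun ψ ↦ ψ.hom c) h2

/-- The value of the character `m ∈ (ℤ/p)^n` at a point of `μ_p^n`. -/
noncomputable def chi (t : T ⟶ muP k p n) (m : Fin n → ZMod p) : Fn T :=
  pb t (fnMu k p n (MonoidAlgebra.of k _ (Multiplicative.ofAdd m)))

lemma chi_zero (t : T ⟶ muP k p n) : chi t 0 = 1 := by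
  rw [chi, ofAdd_zero, map_one, map_one, map_one]

lemma chi_add (t : T ⟶ muP k p n) (m m' : Fin n → ZMod p) :
    chi t (m + m') = chi t m * chi t m' := by
  rw [chi, ofAdd_add, map_mul, map_mul, map_mul, chi, chi]

lemma chi_comp (s : S ⟶ T) (t : T ⟶ muP k p n) (m : Fin n → ZMod p) :
    chi (s ≫ t) m = pb s (chi t m) := pb_comp_apply _ _ _

lemma chi_nsmul (t : T ⟶ muP k p n) (r : ℕ) (m : Fin n → ZMod p) :
    chi t (r • m) = chi t m ^ r := by
  induction r with
  | zero => rw [zero_smul, chi_zero, pow_zero]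
  | succ r ih => rw [succ_nsmul, chi_add, ih, pow_succ]

lemma chi_pow (t : T ⟶ muP k p n) (m : Fin n → ZMod p) : chi t m ^ p = 1 := by
  rw [← chi_nsmul, show p • m = 0 by ext i; simp, chi_zero]

lemma isUnit_chi (t : T ⟶ muP k p n) (m : Fin n → ZMod p) : IsUnit (chi t m) :=
  IsUnit.of_mul_eq_one (chi t (-m)) (by rw [← chi_add, add_neg_cancel, chi_zero])

lemma chi_sum (t : T ⟶ muP k p n) {I : Type*} (s : Finset I) (m : I → Fin n → ZMod p) :
    chi t (∑ i ∈ s, m i) = ∏ i ∈ s, chi t (m i) := by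
  classical
  induction s using Finset.induction_on with
  | empty => simp [chi_zero]
  | insert a s ha ih => rw [Finset.sum_insert ha, Finset.prod_insert ha, chi_add, ih]

lemma eq_sum_single [NeZero p] (m : Fin n → ZMod p) :
    m = ∑ i, (m i).val • (Pi.single i 1 : Fin n → ZMod p) := by
  ext j
  rw [Finset.sum_apply, Finset.sum_eq_single j]
  · simp
  · intro i _ hij
    simp [hij.symm]
  · simp

lemma chi_eq_prod [NeZero p] (t : T ⟶ muP k p n) (m : Fin n → ZMod p) :
    chi t m = ∏ i, chi t (Pi.single i 1) ^ (m i).val := by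
  conv_lhs => rw [eq_sum_single m]
  simp only [chi_sum, chi_nsmul]

instance : IsAffine (muP k p n).left := inferInstanceAs (IsAffine (Spec (.of (MuAlg k p n))))

lemma muP_hom_ext {t t' : T ⟶ muP k p n} (h : ∀ m, chi t m = chi t' m) : t = t' := by
  have h1 : (pb t).comp (fnMu k p n).toAlgHom = (pb t').comp (fnMu k p n).toAlgHom :=
    MonoidAlgebra.algHom_ext (fun m ↦ h m.toAdd) (by ext)
  refine hom_ext_of_isAffine fun z ↦ ?_
  simpa using congrArg (fun φ ↦ φ ((fnMu k p n).symm z)) h1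

lemma exists_chi_eq (φ : Multiplicative (Fin n → ZMod p) →* Fn T) :
    ∃ t : T ⟶ muP k p n, ∀ m, chi t m = φ (Multiplicative.ofAdd m) := by
  obtain ⟨t, ht⟩ := exists_pb_eq (T := muP k p n)
    ((MonoidAlgebra.lift k (Fn T) (Multiplicative (Fin n → ZMod p)) φ).comp (fnMu k p n).symm.toAlgHom)
  refine ⟨t, fun m ↦ ?_⟩
  rw [chi, ht]
  simp

lemma chi_comul (m : Fin n → ZMod p) :
    chi (μ[muP k p n]) m = chi (fst (muP k p n) (muP k p n)) m * chi (snd _ _) m := by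
  let A := MuAlg k p n
  let x : A := MonoidAlgebra.of k _ (Multiplicative.ofAdd m)
  have h0 : μ[muP k p n].left = (pullbackSpecIso k A A).hom ≫
      Spec.map (CommRingCat.ofHom (Bialgebra.comulAlgHom k A : A →+* A ⊗[k] A)) := rfl
  have h1 : (fst (muP k p n) (muP k p n)).left = (pullbackSpecIso k A A).hom ≫
      Spec.map (CommRingCat.ofHom (algebraMap A (A ⊗[k] A))) :=
    (pullbackSpecIso_hom_fst k A A).symm
  have h2 : (snd (muP k p n) (muP k p n)).left = (pullbackSpecIso k A A).hom ≫
      Spec.map (CommRingCat.ofHom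
        (Algebra.TensorProduct.includeRight : A →ₐ[k] A ⊗[k] A).toRingHom) :=
    (pullbackSpecIso_hom_snd k A A).symm
  -- All three functions come from `A ⊗ A`.
  have key (f : muP k p n ⊗ muP k p n ⟶ muP k p n) (φ : A →+* A ⊗[k] A)
      (hf : f.left = (pullbackSpecIso k A A).hom ≫ Spec.map (CommRingCat.ofHom φ)) :
      chi f m = ((pullbackSpecIso k A A).hom.appTop).hom
        ((Scheme.ΓSpecIso (.of (A ⊗[k] A))).inv.hom (φ x)) := by
    change (Scheme.Hom.appTop (Y := Spec (.of A)) f.left).hom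
      ((Scheme.ΓSpecIso (.of A)).inv.hom x) = _
    rw [hf, Scheme.Hom.comp_appTop]
    have := Scheme.ΓSpecIso_inv_naturality (CommRingCat.ofHom φ)
    exact congrArg (fun ψ ↦ ((pullbackSpecIso k A A).hom.appTop).hom (ψ.hom x)) this.symm
  rw [key _ _ h0, key _ _ h1, key _ _ h2]
  refine Eq.trans ?_ (map_mul _ _ _)
  congr 1
  refine Eq.trans ?_ (map_mul _ _ _)
  congr 1
  change Coalgebra.comul (R := k) x = (x ⊗ₜ[k] 1) * (1 ⊗ₜ[k] x)
  simp [x, A]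

lemma chi_mul (g h : T ⟶ muP k p n) (m : Fin n → ZMod p) :
    chi (g * h) m = chi g m * chi h m := by
  rw [Hom.mul_def, chi_comp, chi_comul, map_mul, ← chi_comp, ← chi_comp, lift_fst, lift_snd]

lemma chi_one (m : Fin n → ZMod p) : chi (1 : T ⟶ muP k p n) m = 1 := by
  have h := chi_mul (1 : T ⟶ muP k p n) 1 m
  rw [_root_.mul_one] at h
  exact ((isUnit_chi (1 : T ⟶ muP k p n) m).mul_left_cancel ((_root_.mul_one _).trans h)).symm

lemma counit_chi (m : Fin n → ZMod p) : counit (muP k p n) (chi (𝟙 _) m) = 1 := by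
  apply (bijective_algebraMap_fn_unit k).1
  have := pb_one (T := 𝟙_ (Over (Spec (.of k)))) (chi (𝟙 (muP k p n)) m)
  rw [← chi_comp, Category.comp_id, chi_one] at this
  rw [← this, map_one]

variable (k p n) in
/-- The characters form a basis of the functions on `μ_p^n`. -/
noncomputable def muBasis : Module.Basis (Fin n → ZMod p) k (Fn (muP k p n)) :=
  ((MonoidAlgebra.basis (Multiplicative (Fin n → ZMod p)) k).map (fnMu k p n).toLinearEquiv).reindex Multiplicative.toAdd

@[simp]
lemma muBasis_apply (m : Fin n → ZMod p) : muBasis k p n m = chi (𝟙 _) m := by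
  rw [chi, pb_id_apply]
  simp [muBasis]

lemma pb_muBasis (t : T ⟶ muP k p n) (m : Fin n → ZMod p) : pb t (muBasis k p n m) = chi t m := by
  rw [muBasis_apply, ← chi_comp, Category.comp_id]

variable [hp : Fact p.Prime]

instance : Module.Finite k (MuAlg k p n) :=
  .of_basis (MonoidAlgebra.basis (Multiplicative (Fin n → ZMod p)) k)

instance : IsFinite (muP k p n).hom :=
  (IsFinite.SpecMap_iff _).mpr (RingHom.finite_algebraMap.mpr inferInstance)

variable [CharP k p]

omit hp in
lemma charP_fn [Nontrivial (Fn T)] : CharP (Fn T) p :=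
  charP_of_injective_algebraMap (algebraMap k (Fn T)).injective p

lemma heightLEOne_muP : HeightLEOne p (muP k p n) := by
  rw [heightLEOne_iff]
  intro f
  have : Nontrivial (Fn (muP k p n)) := (fnMu k p n).symm.toEquiv.nontrivial
  have := charP_fn (T := muP k p n) (p := p)
  rw [← (muBasis k p n).sum_repr f]
  simp only [map_sum, map_smul, muBasis_apply, counit_chi, smul_eq_mul, _root_.mul_one]
  rw [sum_pow_char, sum_pow_char]
  refine Finset.sum_congr rfl fun m _ ↦ ?_
  rw [Algebra.smul_def, mul_pow, chi_pow, _root_.mul_one]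

instance : Subsingleton (muP k p n).left :=
  subsingleton_of_heightLEOne hp.out.ne_zero heightLEOne_muP

end Mu

end RatAct

namespace RatAct

/-! ### Homomorphisms out of a field with a `p`-basis -/

section Frob

variable {k K : Type u} [Field k] [Field K] [Algebra k K] {R : Type*} [CommRing R] [Algebra k R]
  {p : ℕ} {φ ψ : K →ₐ[k] R}

lemma algHom_eq_inv {f : K} (h : φ f = ψ f) : φ f⁻¹ = ψ f⁻¹ := by
  by_cases hf : f = 0
  · simp [hf]
  · have h1 : φ f * φ f⁻¹ = 1 := by rw [← map_mul, mul_inv_cancel₀ hf, map_one]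
    have h2 : ψ f * ψ f⁻¹ = 1 := by rw [← map_mul, mul_inv_cancel₀ hf, map_one]
    rw [← h] at h2
    exact (IsUnit.of_mul_eq_one _ h1).mul_left_cancel (h1.trans h2.symm)

lemma algHom_eq_of_mem_frobSubfield (h : ∀ f, φ (f ^ p) = ψ (f ^ p)) {f : K}
    (hf : f ∈ frobSubfield p (algebraMap k K)) : φ f = ψ f := by
  induction hf using Subfield.closure_induction with
  | mem x hx =>
    rcases hx with ⟨a, rfl⟩ | ⟨g, rfl⟩
    · rw [AlgHom.commutes, AlgHom.commutes]
    · exact h g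
  | one => rw [map_one, map_one]
  | add x y _ _ hx hy => rw [map_add, map_add, hx, hy]
  | neg x _ hx => rw [map_neg, map_neg, hx]
  | inv x _ hx => exact algHom_eq_inv hx
  | mul x y _ _ hx hy => rw [map_mul, map_mul, hx, hy]

lemma algHom_ext_of_isPBasis {n : ℕ} {x : Fin n → K} (hx : IsPBasis p (algebraMap k K) x)
    (h : ∀ f ∈ frobSubfield p (algebraMap k K), φ f = ψ f) (hi : ∀ i, φ (x i) = ψ (x i)) :
    φ = ψ := by
  ext f
  have hf : f ∈ Submodule.span (frobSubfield p (algebraMap k K))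
    (Set.range (fun m : Fin n → Fin p => ∏ i, x i ^ (m i : ℕ))) := hx.2 ▸ Submodule.mem_top
  induction hf using Submodule.span_induction with
  | mem y hy =>
    obtain ⟨m, rfl⟩ := hy
    simp [map_prod, hi]
  | zero => simp
  | add y z _ _ hy hz => rw [map_add, map_add, hy, hz]
  | smul c y _ hy => rw [Subfield.smul_def, smul_eq_mul, map_mul, map_mul, hy, h _ c.2]

end Frob

variable {k : Type u} [Field k]

section FixFrob

variable {G T X : Over (Spec (.of k))} [GrpObj G] [IsVariety X]

lemma module_finite_fn (Y : Over (Spec (.of k))) [IsFinite Y.hom] : Module.Finite k (Fn Y) := by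
  have h1 : (Scheme.Hom.appTop (Y := Spec (.of k)) Y.hom).hom.Finite :=
    IsFinite.finite_app (f := Y.hom) ⊤ (isAffineOpen_top _)
  have h2 : (Scheme.ΓSpecIso (.of k)).inv.hom.Finite :=
    RingHom.Finite.of_surjective _ (ConcreteCategory.bijective_of_isIso (Scheme.ΓSpecIso (.of k)).inv).2
  exact RingHom.finite_algebraMap.mp (h1.comp h2)

instance : Nontrivial (Fn (gen X)) := (fnGen X).symm.toEquiv.nontrivial

instance : Nontrivial (Fn (G ⊗ gen X)) :=
  (pb (unitSection G (gen X))).toRingHom.domain_nontrivial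

/-- A group scheme of height at most one fixes `p`-th powers: if `α^* f = ∑ b_i ⊗ f_i`, then
`α^* (f^p) = ∑ b_i^p ⊗ f_i^p = ∑ b_i(e)^p f_i^p = f^p`. -/
lemma IsActionMap.pbK_pow {p : ℕ} [Fact p.Prime] [CharP k p] [IsFinite G.hom]
    (hG : HeightLEOne p G) {α : G ⊗ gen X ⟶ gen X} (hα : IsActionMap α) (f : X.left.functionField) :
    pbK α (f ^ p) = pbK (snd G (gen X)) (f ^ p) := by
  have : IsAffine G.left := isAffine_of_isAffineHom G.hom
  have := module_finite_fn G
  let b := Module.finBasis k (Fn G)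
  obtain ⟨c, hc⟩ := (bijective_expand (T := gen X) b).2 (pbK α f)
  have hunit : ∑ i, algebraMap k _ (counit G (b i)) * c i = fnGen X f := by
    have h1 := pb_lift_expand (1 : gen X ⟶ G) (𝟙 (gen X)) b c
    rw [hc, ← pbK_comp, hα.one, pbK_id] at h1
    rw [h1]
    simp only [pb_one, pb_id_apply]
  have := charP_fn (T := G ⊗ gen X) (p := p)
  rw [map_pow, map_pow, ← hc, expand, sum_pow_char, pbK_apply, ← hunit, map_sum, sum_pow_char]
  refine Finset.sum_congr rfl fun i _ ↦ ?_
  rw [mul_pow, ← map_pow, (heightLEOne_iff.mp hG), map_mul, mul_pow, map_pow, AlgHom.commutes,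
    AlgHom.commutes]

end FixFrob

/-! ### Regular functions on open subsets of a variety -/

section Reg

variable {X : Over (Spec (.of k))} [IsVariety X]

/-- The rational functions that are regular on the open set `U`. -/
noncomputable def regFn (U : X.left.Opens) [Nonempty U] : Subalgebra k X.left.functionField :=
  ((pb (genTo X U)).range).comap (fnGen X).toAlgHom

lemma mem_regFn_iff {U : X.left.Opens} [Nonempty U] {f : X.left.functionField} :
    f ∈ regFn U ↔ ∃ s : Fn (openSub U), pb (genTo X U) s = fnGen X f := Iff.rfl

/-- In terms of sections over `U`, the canonical map from the local scheme at `x` to `U` is the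
germ map. -/
lemma _root_.AlgebraicGeometry.appTop_of_comp_ι_eq_fromSpecStalk {Y : Scheme.{u}} {U : Y.Opens}
    {x : Y} (hx : x ∈ U) {f : Spec (Y.presheaf.stalk x) ⟶ U} (hf : f ≫ U.ι = Y.fromSpecStalk x) :
    U.topIso.inv ≫ f.appTop = Y.presheaf.germ U x hx ≫ (Scheme.ΓSpecIso _).inv := by
  have hle : (⊤ : (U : Scheme).Opens) ≤ U.ι ⁻¹ᵁ U := by simp
  have h1 := Scheme.Hom.appLE_comp_appLE f U.ι U ⊤ ⊤ hle le_rfl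
  simp only [hf] at h1
  have h2 : U.ι.appLE U ⊤ hle = U.topIso.inv := by
    rw [Scheme.Opens.ι_appLE]
    rfl
  have h3 : f.appLE ⊤ ⊤ le_rfl = f.appTop :=
    (Scheme.Hom.app_eq_appLE f).symm
  rw [h2, h3] at h1
  rw [h1]
  change (Y.fromSpecStalk x).app U ≫ (Spec (Y.presheaf.stalk x)).presheaf.map _ = _
  rw [Scheme.fromSpecStalk_app hx, Category.assoc, Category.assoc, ← Functor.map_comp]
  congr 1

lemma mem_regFn_iff_germ {U : X.left.Opens} [Nonempty U] {f : X.left.functionField} :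
    f ∈ regFn U ↔ ∃ s : Γ(X.left, U), algebraMap Γ(X.left, U) X.left.functionField s = f := by
  have hx : genericPoint X.left ∈ U :=
    ((genericPoint_spec X.left).mem_open_set_iff U.isOpen).mpr (by simpa using ‹Nonempty U›)
  have h (s : Γ(X.left, U)) : pb (genTo X U) (U.topIso.inv.hom s) =
      fnGen X (algebraMap Γ(X.left, U) X.left.functionField s) :=
    congrArg (fun ψ ↦ ψ.hom s) (appTop_of_comp_ι_eq_fromSpecStalk (f := (genTo X U).left) hx
      (congrArg (·.left) (genTo_openIncl U)))
  rw [mem_regFn_iff]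
  constructor
  · rintro ⟨s, hs⟩
    obtain ⟨t, rfl⟩ := (ConcreteCategory.bijective_of_isIso U.topIso.inv).2 s
    exact ⟨t, (fnGen X).injective ((h t).symm.trans hs)⟩
  · rintro ⟨s, rfl⟩
    exact ⟨_, h s⟩

lemma regFn_mono {U V : X.left.Opens} [Nonempty U] [Nonempty V] (h : U ≤ V) :
    regFn V ≤ regFn U := by
  intro f hf
  rw [mem_regFn_iff_germ] at hf ⊢
  obtain ⟨s, rfl⟩ := hf
  exact ⟨X.left.presheaf.map (homOfLE h).op s, X.left.presheaf.germ_res_apply _ _ _ _⟩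

lemma exists_adjoin_eq_regFn {U : X.left.Opens} (hU : IsAffineOpen U) [Nonempty U] :
    ∃ t : Finset X.left.functionField, Algebra.adjoin k (t : Set X.left.functionField) = regFn U := by
  let := sectionsAlgebra hU
  have := isScalarTower_sections hU
  have := finiteType_sections hU
  have h : regFn U = (IsScalarTower.toAlgHom k Γ(X.left, U) X.left.functionField).range := by
    ext f
    exact mem_regFn_iff_germ
  have h1 : (⊤ : Subalgebra k Γ(X.left, U)).FG := Algebra.FiniteType.out
  have h2 := h1.map (IsScalarTower.toAlgHom k Γ(X.left, U) X.left.functionField)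
  rw [Algebra.map_top, ← h] at h2
  exact h2

/-- Inverting a common denominator: any finite set of rational functions is regular on some
basic open subset of an affine open set. -/
lemma exists_regFn_of_finset {U : X.left.Opens} (hU : IsAffineOpen U) [Nonempty U]
    (S : Finset X.left.functionField) :
    ∃ (V : X.left.Opens) (_ : Nonempty V) (d : X.left.functionField), V ≤ U ∧ IsAffineOpen V ∧
      d ≠ 0 ∧ d ∈ regFn U ∧ d⁻¹ ∈ regFn V ∧ (∀ f ∈ S, f ∈ regFn V) ∧
      ∀ f ∈ regFn V, ∃ r : ℕ, f * d ^ r ∈ regFn U := by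
  have := functionField_isFractionRing_of_isAffineOpen X.left U hU
  obtain ⟨⟨d, hd⟩, hS⟩ := IsLocalization.exist_integer_multiples_of_finset
    (nonZeroDivisors Γ(X.left, U)) S
  have hd0 : d ≠ 0 := nonZeroDivisors.ne_zero hd
  have hV : IsAffineOpen (X.left.basicOpen d) := hU.basicOpen d
  have hne : Nonempty (X.left.basicOpen d) := by
    by_contra h
    apply hd0
    rw [← AlgebraicGeometry.basicOpen_eq_bot_iff]
    ext x
    simp only [TopologicalSpace.Opens.coe_bot, Set.mem_empty_iff_false, iff_false]
    exact fun hx ↦ h ⟨⟨x, hx⟩⟩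
  have hdK : algebraMap Γ(X.left, U) X.left.functionField d ≠ 0 := by
    rwa [Ne, IsFractionRing.to_map_eq_zero_iff]
  have hloc := hU.isLocalization_basicOpen d
  have hres (s : Γ(X.left, U)) : algebraMap Γ(X.left, X.left.basicOpen d) X.left.functionField
      (algebraMap Γ(X.left, U) Γ(X.left, X.left.basicOpen d) s) =
      algebraMap Γ(X.left, U) X.left.functionField s :=
    X.left.presheaf.germ_res_apply _ _ _ _
  have hdinv : (algebraMap Γ(X.left, U) X.left.functionField d)⁻¹ ∈ regFn (X.left.basicOpen d) := by
    rw [mem_regFn_iff_germ]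
    refine ⟨IsLocalization.Away.invSelf d, ?_⟩
    apply eq_inv_of_mul_eq_one_right
    rw [← hres, ← map_mul, IsLocalization.Away.mul_invSelf, map_one]
  refine ⟨X.left.basicOpen d, hne, algebraMap Γ(X.left, U) X.left.functionField d,
    X.left.basicOpen_le d, hV, hdK, mem_regFn_iff_germ.mpr ⟨d, rfl⟩, hdinv, fun f hf ↦ ?_,
    fun f hf ↦ ?_⟩
  · obtain ⟨s, hs⟩ := hS f hf
    change _ = d • f at hs
    rw [Algebra.smul_def] at hs
    have : f = algebraMap Γ(X.left, U) X.left.functionField s *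
        (algebraMap Γ(X.left, U) X.left.functionField d)⁻¹ := by
      rw [hs]; field_simp
    rw [this]
    exact mul_mem (regFn_mono (X.left.basicOpen_le d) (mem_regFn_iff_germ.mpr ⟨s, rfl⟩)) hdinv
  · obtain ⟨s, rfl⟩ := mem_regFn_iff_germ.mp hf
    obtain ⟨⟨a, ⟨_, r, rfl⟩⟩, h⟩ := IsLocalization.surj (Submonoid.powers d) s
    refine ⟨r, mem_regFn_iff_germ.mpr ⟨a, ?_⟩⟩
    rw [← hres a, ← h, map_mul, hres, map_pow]

end Reg

end RatAct

/-! ### Spreading out an action from the generic point -/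

namespace RatAct

variable {k : Type u} [Field k]

section Spread

/-- Factoring an algebra homomorphism through an injective one. -/
lemma exists_algHom_comp_eq {A B C : Type*} [CommRing A] [CommRing B] [CommRing C] [Algebra k A]
    [Algebra k B] [Algebra k C] {i : B →ₐ[k] C} (hi : Function.Injective i) (g : A →ₐ[k] C)
    (h : ∀ a, g a ∈ i.range) : ∃ φ : A →ₐ[k] B, ∀ a, i (φ a) = g a := by
  refine ⟨(AlgEquiv.ofInjective i hi).symm.toAlgHom.comp (g.codRestrict i.range h), fun a ↦ ?_⟩
  exact congrArg Subtype.val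
    ((AlgEquiv.ofInjective i hi).apply_symm_apply (g.codRestrict i.range h a))

variable {G X : Over (Spec (.of k))} [IsVariety X]

lemma pb_whiskerLeft_genTo_injective (Y : Over (Spec (.of k))) (U : X.left.Opens) [Nonempty U] :
    Function.Injective (pb (Y ◁ genTo X U)) :=
  Scheme.Hom.app_injective (Y ◁ genTo X U).left ⊤

instance (U : X.left.Opens) : IsSeparated (openSub U).hom :=
  inferInstanceAs (IsSeparated (U.ι ≫ X.hom))

/-- Spreading out: a morphism `α : G ⊗ Spec k(X) ⟶ Spec k(X)` which fixes `p`-th powers extends to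
`G ⊗ U` for an arbitrarily small affine open `U`. If `a_j` generate the functions on an affine open
and `d` is a common denominator of the coefficients of the `α^* a_j`, then `U = D(d)` works, since
`α^*` fixes `d^{-p}`. -/
lemma exists_spread [IsFinite G.hom] {p : ℕ} (hp : p ≠ 0) {α : G ⊗ gen X ⟶ gen X}
    (hα : ∀ f, pbK α (f ^ p) = pbK (snd G (gen X)) (f ^ p)) (S : Finset X.left.functionField) :
    ∃ (U : X.left.Opens) (_ : Nonempty U), IsAffineOpen U ∧ (∀ f ∈ S, f ∈ regFn U) ∧
      ∃ β : G ⊗ openSub U ⟶ openSub U, G ◁ genTo X U ≫ β = α ≫ genTo X U := by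
  classical
  have : IsAffine G.left := isAffine_of_isAffineHom G.hom
  have := module_finite_fn G
  let b := Module.finBasis k (Fn G)
  obtain ⟨U₀, hU₀, _⟩ := exists_isAffineOpen_nonempty X
  obtain ⟨t, ht⟩ := exists_adjoin_eq_regFn hU₀
  have hc (f : X.left.functionField) := (bijective_expand (T := gen X) b).2 (pbK α f)
  choose c hc using hc
  obtain ⟨U, hne, d, hle, hU, hd, hdU₀, hdU, hSU, hpow⟩ := exists_regFn_of_finset hU₀
    (S ∪ t.biUnion fun f ↦ Finset.univ.image fun i ↦ (fnGen X).symm (c f i))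
  refine ⟨U, hne, hU, fun f hf ↦ hSU f (Finset.mem_union_left _ hf), ?_⟩
  have : IsAffine (openSub U).left := hU
  -- the rational functions whose pullback is regular on `G ⊗ U`
  let R : Subalgebra k X.left.functionField := ((pb (G ◁ genTo X U)).range).comap (pbK α)
  have hR (f) : f ∈ R ↔ ∃ s, pb (G ◁ genTo X U) s = pbK α f := Iff.rfl
  have h₀ : regFn U₀ ≤ R := by
    rw [← ht, Algebra.adjoin_le_iff]
    intro f hf
    have h1 (i) : ∃ s : Fn (openSub U), pb (genTo X U) s = c f i := by
      have : (fnGen X).symm (c f i) ∈ regFn U := hSU _ <| Finset.mem_union_right _ <|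
        Finset.mem_biUnion.mpr ⟨f, hf, Finset.mem_image.mpr ⟨i, Finset.mem_univ _, rfl⟩⟩
      obtain ⟨s, hs⟩ := mem_regFn_iff.mp this
      exact ⟨s, hs.trans ((fnGen X).apply_symm_apply _)⟩
    choose s hs using h1
    refine (hR f).mpr ⟨expand b s, ?_⟩
    rw [pb_whiskerLeft_expand, ← hc f]
    exact congrArg _ (funext hs)
  have hdinv : d⁻¹ ∈ R := by
    have h1 : (d⁻¹) ^ p ∈ R := by
      obtain ⟨s, hs⟩ := mem_regFn_iff.mp (pow_mem hdU p)
      refine (hR _).mpr ⟨pb (snd _ _) s, ?_⟩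
      rw [hα, ← pb_comp_apply, whiskerLeft_snd, pb_comp_apply, hs, pbK_apply]
    have h2 : d⁻¹ = d ^ (p - 1) * d⁻¹ ^ p := by
      obtain ⟨q, rfl⟩ := Nat.exists_eq_succ_of_ne_zero hp
      rw [Nat.succ_sub_one, pow_succ, ← _root_.mul_assoc, ← mul_pow, mul_inv_cancel₀ hd, one_pow,
        _root_.one_mul]
    rw [h2]
    exact mul_mem (pow_mem (h₀ hdU₀) _) h1
  have hR' : regFn U ≤ R := by
    intro f hf
    obtain ⟨r, hr⟩ := hpow f hf
    have : f = f * d ^ r * d⁻¹ ^ r := by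
      rw [_root_.mul_assoc, ← mul_pow, mul_inv_cancel₀ hd, one_pow, _root_.mul_one]
    rw [this]
    exact mul_mem (h₀ hr) (pow_mem hdinv r)
  obtain ⟨φ, hφ⟩ := exists_algHom_comp_eq (pb_whiskerLeft_genTo_injective G U)
    ((pb α).comp (pb (genTo X U))) fun s ↦ by
      have : (fnGen X).symm (pb (genTo X U) s) ∈ R :=
        hR' (mem_regFn_iff.mpr ⟨s, ((fnGen X).apply_symm_apply _).symm⟩)
      obtain ⟨s', hs'⟩ := (hR _).mp this
      refine ⟨s', hs'.trans ?_⟩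
      rw [pbK_apply, AlgEquiv.apply_symm_apply]
      rfl
  obtain ⟨β, hβ⟩ := exists_pb_eq φ
  refine ⟨β, hom_ext_of_isAffine fun z ↦ ?_⟩
  rw [pb_comp_apply, hβ, hφ, pb_comp_apply]
  rfl

variable [GrpObj G]

/-- The action laws extend from the generic point. -/
lemma IsActionMap.of_genTo {α : G ⊗ gen X ⟶ gen X} (hα : IsActionMap α) {U : X.left.Opens}
    [Nonempty U] {β : G ⊗ openSub U ⟶ openSub U}
    (hβ : G ◁ genTo X U ≫ β = α ≫ genTo X U) : IsActionMap β := by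
  have key {T : Over (Spec (.of k))} (g : T ⟶ G) (x : T ⟶ gen X) :
      lift g (x ≫ genTo X U) ≫ β = (lift g x ≫ α) ≫ genTo X U := by
    rw [Category.assoc, ← hβ, ← Category.assoc]
    congr 1
    ext1 <;> simp
  have h1 : lift 1 (snd (𝟙_ _) (openSub U)) ≫ β = snd (𝟙_ _) (openSub U) := by
    apply hom_ext_of_genTo
    rw [← Category.assoc, comp_lift, comp_one, whiskerLeft_snd, key, hα.one]
  have h2 : lift (fst (G ⊗ G) (openSub U) ≫ fst G G)
      (lift (fst (G ⊗ G) (openSub U) ≫ snd G G) (snd _ _) ≫ β) ≫ β =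
      lift ((fst (G ⊗ G) (openSub U) ≫ fst G G) * (fst (G ⊗ G) (openSub U) ≫ snd G G)) (snd _ _) ≫
        β := by
    apply hom_ext_of_genTo
    simp only [← Category.assoc, comp_lift, comp_mul, whiskerLeft_fst, whiskerLeft_snd]
    rw [key, key, key, hα.mul]
  constructor
  · intro T x
    have := congrArg (lift (toUnit T) x ≫ ·) h1
    simpa only [← Category.assoc, comp_lift, comp_one, lift_snd] using this
  · intro T g h x
    have := congrArg (lift (lift g h) x ≫ ·) h2
    simpa only [← Category.assoc, comp_lift, comp_mul, lift_snd, lift_fst] using this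

lemma IsActionMap.isIso_lift {Y : Over (Spec (.of k))} {β : G ⊗ Y ⟶ Y} (hβ : IsActionMap β) :
    IsIso (lift (fst G Y) β) := by
  have h0 : lift (fst G Y) (snd G Y) ≫ β = β := by rw [lift_fst_snd, Category.id_comp]
  refine ⟨lift (fst _ _) (lift (fst _ _)⁻¹ (snd _ _) ≫ β), ?_, ?_⟩
  · ext1
    · rw [Category.assoc, lift_fst, lift_fst, Category.id_comp]
    · rw [Category.assoc, lift_snd, ← Category.assoc, comp_lift, GrpObj.comp_inv, lift_fst,
        lift_snd, Category.id_comp]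
      conv_lhs => enter [1, 2]; rw [← h0]
      rw [hβ.mul, inv_mul_cancel, hβ.one]
  · ext1
    · rw [Category.assoc, lift_fst, lift_fst, Category.id_comp]
    · rw [Category.assoc, lift_snd, Category.id_comp, hβ.mul, mul_inv_cancel, hβ.one]

/-- An action on `G ⊗ U` defines a rational action on `X`. -/
lemma IsActionMap.exists_isRationalAction [Subsingleton G.left] {U : X.left.Opens} [Nonempty U]
    {β : G ⊗ openSub U ⟶ openSub U} (hβ : IsActionMap β) :
    ∃ a : (G ⊗ X).left ⤏ X.left, IsRationalAction G X a ∧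
      EvalAt a (G ◁ openIncl U) (β ≫ openIncl U) := by
  have hU := dense_of_nonempty U
  obtain ⟨a, ha, e, he, heU, hae⟩ := exists_ratMap (G := G) U hU (β ≫ openIncl U)
  refine ⟨a, ⟨⟨_, dense_snd_preimage hU, _, hae, ?_⟩, ?_⟩, ha⟩
  · have := hβ.isIso_lift
    have h1 : lift (openIncl ((snd G X).left ⁻¹ᵁ U) ≫ fst G X) (e ≫ β ≫ openIncl U) =
        (e ≫ lift (fst _ _) β ≫ inv e) ≫ openIncl ((snd G X).left ⁻¹ᵁ U) := by
      rw [← heU, Category.assoc, Category.assoc, Category.assoc, IsIso.inv_hom_id_assoc]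
      ext1
      · rw [lift_fst, Category.assoc, whiskerLeft_fst, Category.assoc,
          whiskerLeft_fst, lift_fst]
      · rw [lift_snd, Category.assoc, Category.assoc, whiskerLeft_snd, lift_snd_assoc]
    rw [h1, Over.comp_left]
    have hiso : IsIso (e ≫ lift (fst _ _) β ≫ inv e).left :=
      inferInstanceAs (IsIso ((Over.forget _).map (e ≫ lift (fst _ _) β ≫ inv e)))
    have hopen : IsOpenImmersion (openIncl ((snd G X).left ⁻¹ᵁ U)).left :=
      inferInstanceAs (IsOpenImmersion ((snd G X).left ⁻¹ᵁ U).ι)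
    refine ⟨inferInstance, ?_⟩
    have hd : DenseRange (openIncl ((snd G X).left ⁻¹ᵁ U)).left := by
      have := dense_snd_preimage (G := G) hU
      change Dense (Set.range ((snd G X).left ⁻¹ᵁ U).ι)
      rwa [Scheme.Opens.range_ι]
    have := hd.comp (e ≫ lift (fst _ _) β ≫ inv e).left.surjective.denseRange
      (openIncl ((snd G X).left ⁻¹ᵁ U)).left.continuous
    rwa [← TopCat.coe_comp, ← Scheme.Hom.comp_base] at this
  · obtain ⟨e', he'⟩ :=
      exists_iso_openSub_snd_preimage (G := G) (Y := G ⊗ X) ((snd G X).left ⁻¹ᵁ U)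
    obtain ⟨w, hw⟩ : ∃ w : openSub ((snd G (G ⊗ X)).left ⁻¹ᵁ (snd G X).left ⁻¹ᵁ U) ⟶
        G ⊗ (G ⊗ openSub U), w ≫ G ◁ G ◁ openIncl U = openIncl _ := by
      refine ⟨e'.inv ≫ G ◁ e, ?_⟩
      rw [Category.assoc, ← whiskerLeft_comp, heU, ← he', Iso.inv_hom_id_assoc]
    have e1 : w ≫ snd _ _ ≫ G ◁ openIncl U = openIncl _ ≫ snd G (G ⊗ X) := by
      rw [← hw, Category.assoc, whiskerLeft_snd]
    have e2 : (w ≫ lift (fst _ _) (snd _ _ ≫ β)) ≫ G ◁ openIncl U =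
        lift (openIncl _ ≫ fst G (G ⊗ X)) ((w ≫ snd _ _) ≫ β ≫ openIncl U) := by
      rw [← hw]
      ext1
      · rw [Category.assoc, whiskerLeft_fst, Category.assoc, lift_fst, lift_fst, Category.assoc,
          whiskerLeft_fst]
      · rw [Category.assoc, whiskerLeft_snd, Category.assoc, lift_snd_assoc, lift_snd,
          Category.assoc, Category.assoc]
    have e3 : (w ≫ lift (fst _ _ * (snd _ _ ≫ fst _ _)) (snd _ _ ≫ snd _ _)) ≫ G ◁ openIncl U =
        openIncl _ ≫ (α_ G G X).inv ≫ μ[G] ▷ X := by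
      have e5 : G ◁ G ◁ openIncl U ≫ (α_ G G X).inv ≫ fst _ _ =
          lift (fst _ _) (snd _ _ ≫ fst _ _) := by ext1 <;> simp
      rw [← hw, Category.assoc, Category.assoc]
      congr 1
      ext1
      · simp [Hom.mul_def, ← e5]
      · simp
    refine ⟨_, dense_snd_preimage (dense_snd_preimage hU), (w ≫ snd _ _) ≫ β ≫ openIncl U,
      (w ≫ lift (fst _ _) (snd _ _ ≫ β)) ≫ β ≫ openIncl U, ?_, ?_, ?_⟩
    · rw [← e1, ← Category.assoc w]
      exact ha.comp _
    · rw [← e2]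
      exact ha.comp _
    · rw [← e3]
      have e4 : lift (fst G (G ⊗ openSub U)) (snd _ _ ≫ β) ≫ β =
          lift (fst _ _ * (snd _ _ ≫ fst _ _)) (snd _ _ ≫ snd _ _) ≫ β := by
        rw [← hβ.mul, ← comp_lift, lift_fst_snd, Category.comp_id]
      have e6 : (w ≫ lift (fst _ _) (snd _ _ ≫ β)) ≫ β ≫ openIncl U = (w ≫
          lift (fst _ _ * (snd _ _ ≫ fst _ _)) (snd _ _ ≫ snd _ _)) ≫ β ≫ openIncl U := by
        rw [Category.assoc, reassoc_of% e4, Category.assoc]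
      rw [e6]
      exact ha.comp _

end Spread

end RatAct

/-! ### Standard actions of `μ_p^n` -/

namespace RatAct

open scoped TensorProduct

/-- A `p`-basis allows to twist a homomorphism of algebras by `p`-th roots of unity. -/
lemma IsPBasis.exists_algHom_twist {k K : Type u} [Field k] [Field K] [Algebra k K] {R : Type*}
    [CommRing R] [Algebra k R] {p : ℕ} [Fact p.Prime] {n : ℕ} {x : Fin n → K}
    (hx : IsPBasis p (algebraMap k K) x) (σ : K →ₐ[k] R) (v : Fin n → R) (hv : ∀ i, v i ^ p = 1) :
    ∃ φ : K →ₐ[k] R, (∀ f ∈ frobSubfield p (algebraMap k K), φ f = σ f) ∧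
      ∀ i, φ (x i) = v i * σ (x i) := by
  let F := frobSubfield p (algebraMap k K)
  let _ : Algebra F R := ((σ : K →+* R).comp F.subtype).toAlgebra
  have hF (c : F) : algebraMap F R c = σ (c : K) := rfl
  let b : Module.Basis (Fin n → Fin p) F K := .mk hx.1 hx.2.ge
  have hb (m) : b m = pMonomial p x m := by simp [b]
  let φ : K →ₗ[F] R := b.constr F fun m ↦ (∏ i, v i ^ (m i : ℕ)) * σ (pMonomial p x m)
  have hφb (m) : φ (pMonomial p x m) = (∏ i, v i ^ (m i : ℕ)) * σ (pMonomial p x m) := by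
    rw [← hb, Module.Basis.constr_basis, hb]
  have hφ (e : Fin n → ℕ) : φ (∏ i, x i ^ e i) = (∏ i, v i ^ e i) * σ (∏ i, x i ^ e i) := by
    have hmem := pow_mem_frobSubfield p (algebraMap k K) (∏ i, x i ^ (e i / p))
    have h1 (i) : v i ^ e i = v i ^ (e i % p) := by
      conv_lhs => rw [← Nat.div_add_mod (e i) p, pow_add, pow_mul, hv, one_pow, _root_.one_mul]
    rw [prod_pow_eq_mul_pMonomial p x e]
    have h2 : ∀ y, φ ((∏ i, x i ^ (e i / p)) ^ p * y) = σ ((∏ i, x i ^ (e i / p)) ^ p) * φ y := by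
      intro y
      have := φ.map_smul (⟨_, hmem⟩ : F) y
      rwa [Algebra.smul_def, Algebra.smul_def, hF] at this
    rw [h2, hφb, map_mul, Finset.prod_congr rfl fun i _ ↦ h1 i]
    ring
  have hone : φ 1 = 1 := by simpa using hφ 0
  have hmul : (LinearMap.mul F K).compr₂ φ = (LinearMap.mul F R).compl₁₂ φ φ := by
    refine b.ext fun m ↦ b.ext fun m' ↦ ?_
    simp only [LinearMap.compr₂_apply, LinearMap.mul_apply', LinearMap.compl₁₂_apply, hb]
    have e : pMonomial p x m * pMonomial p x m' = ∏ i, x i ^ ((m i : ℕ) + m' i) := by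
      simp only [pMonomial, ← Finset.prod_mul_distrib, pow_add]
    rw [e, hφ, ← e, hφb, hφb, map_mul]
    simp only [pow_add, Finset.prod_mul_distrib]
    ring
  let ψ : K →ₐ[F] R := AlgHom.ofLinearMap φ hone fun y z ↦
    congrArg (fun l ↦ l y z) hmul
  have hψ (f) (hf : f ∈ F) : φ f = σ f := ψ.commutes ⟨f, hf⟩
  refine ⟨{ ψ.toRingHom with
    commutes' := fun a ↦ (hψ _ (algebraMap_mem_frobSubfield p a)).trans (σ.commutes a) }, hψ, ?_⟩
  intro i
  have h := hφ (Pi.single i 1)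
  simp only [Pi.single_apply, pow_ite, pow_one, pow_zero, Finset.prod_ite_eq', Finset.mem_univ,
    if_true] at h
  exact h

lemma IsPBasis.ne_zero {k K : Type u} [Field k] [Field K] {c : k →+* K} {p : ℕ}
    [hp : Fact p.Prime] {n : ℕ} {x : Fin n → K} (hx : IsPBasis p c x) (i : Fin n) : x i ≠ 0 := by
  have h := hx.1.ne_zero fun j ↦ if j = i then ⟨1, hp.out.one_lt⟩ else ⟨0, hp.out.pos⟩
  intro h0
  exact h (Finset.prod_eq_zero (Finset.mem_univ i) (by simp [h0]))

variable {k : Type u} [Field k]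

section Standard

variable {p n : ℕ} {X T : Over (Spec (.of k))} [IsVariety X]

/-- The rational function `f` is an eigenfunction of weight `m`: `α^* f = t^m f`. -/
def IsEigen (α : muP k p n ⊗ gen X ⟶ gen X) (m : Fin n → ZMod p) (f : X.left.functionField) :
    Prop :=
  pbK α f = chi (fst _ (gen X)) m * pbK (snd _ (gen X)) f

variable {α : muP k p n ⊗ gen X ⟶ gen X} {m m' : Fin n → ZMod p} {f g : X.left.functionField}

lemma isEigen_zero_iff : IsEigen α 0 f ↔ pbK α f = pbK (snd _ (gen X)) f := by
  rw [IsEigen, chi_zero, _root_.one_mul]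

lemma IsEigen.mul (hf : IsEigen α m f) (hg : IsEigen α m' g) : IsEigen α (m + m') (f * g) := by
  rw [IsEigen, map_mul, map_mul, chi_add, hf, hg]
  ring

lemma isEigen_one : IsEigen α 0 (1 : X.left.functionField) := by
  rw [isEigen_zero_iff, map_one, map_one]

lemma IsEigen.inv (hf : IsEigen α m f) : IsEigen α (-m) f⁻¹ := by
  by_cases h0 : f = 0
  · simp [IsEigen, h0]
  · have h1 : IsUnit (pbK α f) := (isUnit_iff_ne_zero.mpr h0).map _
    apply h1.mul_left_cancel
    rw [← map_mul, mul_inv_cancel₀ h0, map_one, hf, _root_.mul_mul_mul_comm, ← chi_add, ← map_mul,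
      mul_inv_cancel₀ h0, map_one, add_neg_cancel, chi_zero, _root_.one_mul]

lemma IsEigen.pow (hf : IsEigen α m f) (r : ℕ) : IsEigen α (r • m) (f ^ r) := by
  rw [IsEigen, map_pow, map_pow, chi_nsmul, hf, mul_pow]

lemma IsEigen.prod {I : Type*} (s : Finset I) {m : I → Fin n → ZMod p}
    {f : I → X.left.functionField} (hf : ∀ i ∈ s, IsEigen α (m i) (f i)) :
    IsEigen α (∑ i ∈ s, m i) (∏ i ∈ s, f i) := by
  rw [IsEigen, map_prod, map_prod, chi_sum, ← Finset.prod_mul_distrib]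
  exact Finset.prod_congr rfl hf

lemma IsEigen.pbK_lift (hf : IsEigen α m f) (t : T ⟶ muP k p n) (y : T ⟶ gen X) :
    pbK (lift t y ≫ α) f = chi t m * pbK y f := by
  rw [pbK_comp, hf, map_mul, ← chi_comp, ← pbK_comp, lift_fst, lift_snd]

lemma pbK_lift_of_isEigen_zero (hf : IsEigen α 0 f) (t : T ⟶ muP k p n) (y : T ⟶ gen X) :
    pbK (lift t y ≫ α) f = pbK y f := by
  rw [hf.pbK_lift, chi_zero, _root_.one_mul]

lemma isStandard_iff {a : (muP k p n ⊗ X).left ⤏ X.left} {x : Fin n → X.left.functionField} :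
    IsStandard a x ↔ ∃ α : muP k p n ⊗ gen X ⟶ gen X,
      EvalAt a (muP k p n ◁ genIncl X) (α ≫ genIncl X) ∧
      (∀ f ∈ frobSubfield p (algebraMap k X.left.functionField), IsEigen α 0 f) ∧
      ∀ i, IsEigen α (Pi.single i 1) (x i) := by
  refine exists_congr fun α ↦ and_congr Iff.rfl (and_congr ?_ Iff.rfl)
  exact forall_congr' fun f ↦ imp_congr Iff.rfl isEigen_zero_iff.symm

variable {x : Fin n → X.left.functionField}

/-- A map that multiplies a `p`-basis by the coordinates of `μ_p^n` is an action. -/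
lemma isActionMap_of_isPBasis (hx : IsPBasis p (algebraMap k X.left.functionField) x)
    (hF : ∀ f ∈ frobSubfield p (algebraMap k X.left.functionField), IsEigen α 0 f)
    (hi : ∀ i, IsEigen α (Pi.single i 1) (x i)) : IsActionMap α := by
  constructor
  · intro T y
    refine hom_gen_ext fun f ↦ DFunLike.congr_fun (algHom_ext_of_isPBasis hx ?_ ?_) f
    · intro f hf
      rw [pbK_lift_of_isEigen_zero (hF f hf)]
    · intro i
      rw [(hi i).pbK_lift, chi_one, _root_.one_mul]
  · intro T g h y
    refine hom_gen_ext fun f ↦ DFunLike.congr_fun (algHom_ext_of_isPBasis hx ?_ ?_) f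
    · intro f hf
      simp only [pbK_lift_of_isEigen_zero (hF f hf)]
    · intro i
      simp only [(hi i).pbK_lift, chi_mul, _root_.mul_assoc]

lemma exists_standard_action [Fact p.Prime]
    (hx : IsPBasis p (algebraMap k X.left.functionField) x) :
    ∃ α : muP k p n ⊗ gen X ⟶ gen X,
      (∀ f ∈ frobSubfield p (algebraMap k X.left.functionField), IsEigen α 0 f) ∧
      ∀ i, IsEigen α (Pi.single i 1) (x i) := by
  obtain ⟨φ, h1, h2⟩ := hx.exists_algHom_twist (pbK (snd (muP k p n) (gen X)))
    (fun i ↦ chi (fst _ _) (Pi.single i 1)) fun i ↦ chi_pow _ _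
  obtain ⟨α, rfl⟩ := exists_pbK_eq φ
  exact ⟨α, fun f hf ↦ isEigen_zero_iff.mpr (h1 f hf), h2⟩

lemma eq_one_of_chi_single [NeZero p] {t : T ⟶ muP k p n} (h : ∀ i, chi t (Pi.single i 1) = 1) :
    t = 1 := by
  refine muP_hom_ext fun m ↦ ?_
  rw [chi_one, chi_eq_prod]
  simp [h]

lemma pb_fst_injective (Y : Over (Spec (.of k))) [IsAffine Y.left] :
    Function.Injective (pb (fst Y (gen X))) := by
  have h1 : Function.Injective (Algebra.TensorProduct.includeLeft (R := k) (S := k) (A := Fn Y) (B := Fn (gen X))) :=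
    Algebra.TensorProduct.includeLeft_injective (algebraMap k (Fn (gen X))).injective
  have h2 := (bijective_productMap (Y := Y) (T := gen X)).1.comp h1
  convert h2 using 1
  ext z
  simp

/-- A subgroup scheme is trivial if its inclusion is. -/
lemma isIso_hom_of_eq_one {N G : Over (Spec (.of k))} [GrpObj N] [GrpObj G] (j : N ⟶ G)
    [IsMonHom j] [Mono j] (h : j = 1) : IsIso N.hom := by
  have h1 : toUnit N ≫ η[N] = 𝟙 N := by
    rw [← cancel_mono j, Category.assoc, IsMonHom.one_hom, Category.id_comp]
    exact h.symm
  have h2 : IsIso (toUnit N) := ⟨η[N], h1, toUnit_unique _ _⟩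
  have h3 : IsIso ((Over.forget _).map (toUnit N)) := inferInstance
  have h4 : N.hom = (toUnit N).left := by
    have := Over.w (toUnit N)
    rw [← this]
    exact Category.comp_id _
  rw [h4]
  exact h3

lemma mono_of_isClosedImmersion {N G : Over (Spec (.of k))} (j : N ⟶ G) [IsClosedImmersion j.left] :
    Mono j := by
  have : Mono ((Over.forget _).map j) := inferInstanceAs (Mono j.left)
  exact (Over.forget _).mono_of_mono_map this

lemma subsingleton_of_isClosedImmersion {N G : Over (Spec (.of k))} (j : N ⟶ G)
    [IsClosedImmersion j.left] [Subsingleton G.left] : Subsingleton N.left :=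
  j.left.isClosedEmbedding.injective.subsingleton

variable [hp : Fact p.Prime] [CharP k p]

/-- An action with eigenfunctions of weights `e_1, …, e_n` is faithful: on a subgroup scheme that acts
trivially, all coordinates of `μ_p^n` are equal to `1`. -/
lemma isFaithful_of_isEigen (hx : ∀ i, x i ≠ 0) (hi : ∀ i, IsEigen α (Pi.single i 1) (x i))
    {a : (muP k p n ⊗ X).left ⤏ X.left}
    (ha : EvalAt a (muP k p n ◁ genIncl X) (α ≫ genIncl X)) : IsFaithful a := by
  intro N _ j _ hj hN
  have := mono_of_isClosedImmersion j
  have := subsingleton_of_isClosedImmersion j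
  have : IsFinite N.hom := by
    rw [← Over.w j]; infer_instance
  have : IsAffine N.left := isAffine_of_isAffineHom N.hom
  apply isIso_hom_of_eq_one j
  have h1 := hN.comp_eq ha (evalAt_toRationalMap (snd N X) (N ◁ genIncl X))
  rw [whiskerLeft_snd, ← Category.assoc, cancel_mono] at h1
  apply eq_one_of_chi_single
  intro i
  apply pb_fst_injective (X := X) N
  have h2 : j ▷ gen X = lift (fst _ _ ≫ j) (snd _ _) := by ext1 <;> simp
  have h3 := congrArg (fun β ↦ pbK β (x i)) h1
  simp only [h2, (hi i).pbK_lift] at h3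
  rw [← chi_comp, map_one]
  exact ((isUnit_iff_ne_zero.mpr (hx i)).map (pbK (snd N (gen X)))).mul_right_cancel
    (h3.trans (_root_.one_mul _).symm)

variable (X) in
/-- A variety of dimension `n` admits a faithful rational action of `μ_p^n`. -/
theorem exists_faithful_rationalAction (hn : topologicalKrullDim X.left = n) :
    ∃ a : (muP k p n ⊗ X).left ⤏ X.left, IsRationalAction (muP k p n) X a ∧ IsFaithful a := by
  obtain ⟨x, hx⟩ := exists_isPBasis X p hn
  obtain ⟨α, hF, hi⟩ := exists_standard_action hx
  obtain ⟨U, hU, -, -, β, hβ⟩ := exists_spread (p := p) hp.out.ne_zero (α := α)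
    (fun f ↦ isEigen_zero_iff.mp (hF _ (pow_mem_frobSubfield p _ f))) ∅
  obtain ⟨a, ha, haβ⟩ := ((isActionMap_of_isPBasis hx hF hi).of_genTo hβ).exists_isRationalAction
  refine ⟨a, ha, isFaithful_of_isEigen (α := α) (x := x) hx.ne_zero hi ?_⟩
  have := haβ.comp (muP k p n ◁ genTo X U)
  rwa [← whiskerLeft_comp, genTo_openIncl, reassoc_of% hβ, genTo_openIncl] at this

end Standard

end RatAct

/-! ### Faithful actions of `μ_p^n` are standard -/

namespace RatAct

variable {k : Type u} [Field k]

section Eigen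

variable {p n : ℕ} [hp : Fact p.Prime] {X T : Over (Spec (.of k))} [IsVariety X]
  {α : muP k p n ⊗ gen X ⟶ gen X} {x : Fin n → X.left.functionField}

/-- Independence of the characters of `μ_p^n` over functions on `T`. -/
lemma sum_chi_injective [IsAffine T.left] {c d : (Fin n → ZMod p) → Fn T}
    (h : ∑ m, chi (fst (muP k p n) T) m * pb (snd _ T) (c m) =
      ∑ m, chi (fst (muP k p n) T) m * pb (snd _ T) (d m)) : c = d := by
  apply (bijective_expand (T := T) (muBasis k p n)).1
  simpa only [expand, pb_muBasis] using h

lemma sum_chi_injective_gen {c d : (Fin n → ZMod p) → X.left.functionField}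
    (h : ∑ m, chi (fst (muP k p n) (gen X)) m * pbK (snd _ (gen X)) (c m) =
      ∑ m, chi (fst (muP k p n) (gen X)) m * pbK (snd _ (gen X)) (d m)) : c = d := by
  have := sum_chi_injective (c := fun m ↦ fnGen X (c m)) (d := fun m ↦ fnGen X (d m)) h
  exact funext fun m ↦ (fnGen X).injective (congrFun this m)

/-- Every rational function is a sum of eigenfunctions. -/
lemma IsActionMap.exists_eigen_decomposition [CharP k p] (hα : IsActionMap α)
    (f : X.left.functionField) :
    ∃ c : (Fin n → ZMod p) → X.left.functionField, (∀ m, IsEigen α m (c m)) ∧ ∑ m, c m = f := by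
  obtain ⟨c, hc⟩ := (bijective_expand (T := gen X) (muBasis k p n)).2 (pbK α f)
  have key {T : Over (Spec (.of k))} (g : T ⟶ muP k p n) (y : T ⟶ gen X) :
      pbK (lift g y ≫ α) f = ∑ m, chi g m * pb y (c m) := by
    rw [pbK_comp, ← hc, pb_lift_expand]
    simp only [pb_muBasis]
  refine ⟨fun m ↦ (fnGen X).symm (c m), fun m ↦ ?_, ?_⟩
  · have h1 := hα.mul (fst (muP k p n) (muP k p n ⊗ gen X)) (snd _ _ ≫ fst _ _) (snd _ _ ≫ snd _ _)
    have h2 : lift (snd (muP k p n) (muP k p n ⊗ gen X) ≫ fst _ _) (snd _ _ ≫ snd _ _) =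
        snd _ _ := by rw [← comp_lift, lift_fst_snd, Category.comp_id]
    have h3 := congrArg (fun β ↦ pbK β f) h1
    simp only [key, h2, chi_mul, pb_comp_apply, chi_comp, _root_.mul_assoc, ← map_mul] at h3
    have h4 := congrFun (sum_chi_injective h3) m
    rw [IsEigen, pbK_apply, pbK_apply, AlgEquiv.apply_symm_apply]
    exact h4
  · have h1 := key 1 (𝟙 (gen X))
    rw [hα.one, pbK_id] at h1
    simp only [chi_one, _root_.one_mul, pb_id_apply] at h1
    rw [← map_sum, ← h1, AlgEquiv.symm_apply_apply]

/-- The exponents of a reduced monomial, as a weight. -/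
def weight (m : Fin n → Fin p) : Fin n → ZMod p := fun i ↦ ((m i : ℕ) : ZMod p)

lemma weight_injective : Function.Injective (weight : (Fin n → Fin p) → Fin n → ZMod p) := by
  intro m m' h
  ext i
  have := congrFun h i
  rw [weight, weight, ZMod.natCast_eq_natCast_iff'] at this
  rwa [Nat.mod_eq_of_lt (m i).2, Nat.mod_eq_of_lt (m' i).2] at this

lemma weight_surjective : Function.Surjective (weight : (Fin n → Fin p) → Fin n → ZMod p) := by
  intro m
  refine ⟨fun i ↦ ⟨(m i).val, ZMod.val_lt _⟩, ?_⟩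
  ext i
  simp [weight]

lemma isEigen_pMonomial (hi : ∀ i, IsEigen α (Pi.single i 1) (x i)) (m : Fin n → Fin p) :
    IsEigen α (weight m) (pMonomial p x m) := by
  have h := IsEigen.prod Finset.univ fun i _ ↦ (hi i).pow (m i)
  have h2 : ∑ i, (m i : ℕ) • (Pi.single i 1 : Fin n → ZMod p) = weight m := by
    conv_rhs => rw [eq_sum_single (weight m)]
    refine Finset.sum_congr rfl fun i _ ↦ ?_
    rw [weight, ZMod.val_natCast, Nat.mod_eq_of_lt (m i).2]
  rwa [h2] at h

/-- Eigenfunctions of distinct weights are linearly independent. -/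
lemma eq_zero_of_sum_eigen {c : (Fin n → Fin p) → X.left.functionField}
    (hc : ∀ m, IsEigen α (weight m) (c m)) (h : ∑ m, c m = 0) (m : Fin n → Fin p) : c m = 0 := by
  let e : (Fin n → Fin p) ≃ (Fin n → ZMod p) := .ofBijective weight ⟨weight_injective, weight_surjective⟩
  have h1 := congrArg (pbK α) h
  rw [map_sum, map_zero, Finset.sum_congr rfl fun m _ ↦ hc m, ← e.symm.sum_comp] at h1
  have h2 : (fun m ↦ c (e.symm m)) = 0 := by
    apply sum_chi_injective_gen
    simp only [Pi.zero_apply, map_zero, mul_zero, Finset.sum_const_zero]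
    rw [← h1]
    refine Finset.sum_congr rfl fun m _ ↦ ?_
    congr 2
    exact (e.apply_symm_apply m).symm
  simpa using congrFun h2 (e m)

/-- Nonzero eigenfunctions of weights `e_1, …, e_n` form a `p`-basis: their monomials have distinct
weights, so they are linearly independent over `k K^p`, and there are as many as the degree. -/
lemma isPBasis_of_isEigen [CharP k p] (hn : topologicalKrullDim X.left = n)
    (hF : ∀ f ∈ frobSubfield p (algebraMap k X.left.functionField), IsEigen α 0 f)
    (hx : ∀ i, x i ≠ 0) (hi : ∀ i, IsEigen α (Pi.single i 1) (x i)) :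
    IsPBasis p (algebraMap k X.left.functionField) x := by
  have hli : LinearIndependent (frobSubfield p (algebraMap k X.left.functionField))
      (fun m : Fin n → Fin p ↦ ∏ i, x i ^ (m i : ℕ)) := by
    rw [Fintype.linearIndependent_iff]
    intro c hc m
    have h1 := eq_zero_of_sum_eigen (α := α) (c := fun m ↦ c m • ∏ i, x i ^ (m i : ℕ)) (fun m ↦ ?_)
      hc m
    · rw [Subfield.smul_def, smul_eq_mul, mul_eq_zero] at h1
      exact Subtype.ext (h1.resolve_right (Finset.prod_ne_zero_iff.mpr fun i _ ↦ pow_ne_zero _ (hx i)))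
    · have := (hF _ (c m).2).mul (isEigen_pMonomial hi m)
      rwa [zero_add] at this
  obtain ⟨x₀, hx₀⟩ := exists_isPBasis X p hn
  let b : Module.Basis (Fin n → Fin p) (frobSubfield p (algebraMap k X.left.functionField))
    X.left.functionField := .mk hx₀.1 hx₀.2.ge
  have : Module.Finite (frobSubfield p (algebraMap k X.left.functionField)) X.left.functionField :=
    .of_basis b
  exact ⟨hli, hli.span_eq_top_of_card_eq_finrank (Module.finrank_eq_card_basis b).symm⟩

/-- The invariants are `k K^p`. -/
lemma mem_frobSubfield_of_isEigen_zero
    (hx : IsPBasis p (algebraMap k X.left.functionField) x)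
    (hF : ∀ f ∈ frobSubfield p (algebraMap k X.left.functionField), IsEigen α 0 f)
    (hi : ∀ i, IsEigen α (Pi.single i 1) (x i)) {f : X.left.functionField} (hf : IsEigen α 0 f) :
    f ∈ frobSubfield p (algebraMap k X.left.functionField) := by
  let b : Module.Basis (Fin n → Fin p) (frobSubfield p (algebraMap k X.left.functionField))
    X.left.functionField := .mk hx.1 hx.2.ge
  have hb (m) : b m = pMonomial p x m := by simp [b]
  have hsum := b.sum_repr f
  let m₀ : Fin n → Fin p := fun _ ↦ ⟨0, hp.out.pos⟩
  have hm₀ : weight m₀ = (0 : Fin n → ZMod p) := by ext; simp [weight, m₀]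
  have hpm₀ : pMonomial p x m₀ = 1 := by simp [m₀, pMonomial]
  have hc (m) : IsEigen α (weight m) ((b.repr f m : X.left.functionField) * pMonomial p x m -
      if m = m₀ then f else 0) := by
    have := (hF _ (b.repr f m).2).mul (isEigen_pMonomial hi m)
    rw [zero_add] at this
    rw [IsEigen, map_sub, map_sub, mul_sub, this]
    congr 1
    split_ifs with h
    · rw [h, hm₀]; exact hf
    · simp
  have h1 := eq_zero_of_sum_eigen hc (by
    rw [Finset.sum_sub_distrib, Finset.sum_ite_eq' Finset.univ m₀, if_pos (Finset.mem_univ _),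
      sub_eq_zero]
    conv_rhs => rw [← hsum]
    exact Finset.sum_congr rfl fun m _ ↦ by rw [hb, Subfield.smul_def, smul_eq_mul]) m₀
  rw [if_pos rfl, hpm₀, _root_.mul_one, sub_eq_zero] at h1
  exact h1 ▸ (b.repr f m₀).2

end Eigen

section Faithful

variable {p n : ℕ} [hp : Fact p.Prime] {X : Over (Spec (.of k))} [IsVariety X]
  {α : muP k p n ⊗ gen X ⟶ gen X}

lemma not_isIso_hom_muP_one : ¬ IsIso (muP k p 1).hom := by
  intro h
  have : IsIso (Scheme.Hom.appTop (Y := Spec (.of k)) (muP k p 1).hom) :=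
    inferInstanceAs (IsIso (Scheme.Hom.app (Y := Spec (.of k)) (muP k p 1).hom ⊤))
  have h1 : Function.Surjective (algebraMap k (Fn (muP k p 1))) :=
    (ConcreteCategory.bijective_of_isIso ((Scheme.ΓSpecIso (.of k)).inv ≫
      Scheme.Hom.appTop (Y := Spec (.of k)) (muP k p 1).hom)).2
  obtain ⟨c, hc⟩ := h1 (muBasis k p 1 1)
  have h2 : algebraMap k (Fn (muP k p 1)) c = c • muBasis k p 1 0 := by
    rw [muBasis_apply, chi_zero, Algebra.smul_def, _root_.mul_one]
  have h3 := congrArg (fun z ↦ (muBasis k p 1).repr z 1) (hc.symm.trans h2)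
  have h4 : (0 : Fin 1 → ZMod p) ≠ 1 := zero_ne_one
  simp only [map_smul, Module.Basis.repr_self, Finsupp.smul_apply, Finsupp.single_eq_same] at h3
  rw [Finsupp.single_eq_of_ne h4.symm, smul_zero] at h3
  exact one_ne_zero h3

/-- The homomorphism `μ_p ⟶ μ_p^n` that is dual to a linear form. -/
lemma exists_muP_hom (l : (Fin n → ZMod p) →ₗ[ZMod p] ZMod p) (hl : l ≠ 0) :
    ∃ j : muP k p 1 ⟶ muP k p n, IsMonHom j ∧ IsClosedImmersion j.left ∧
      ∀ m, l m = 0 → chi j m = 1 := by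
  let φ : Multiplicative (Fin n → ZMod p) →* Fn (muP k p 1) :=
    { toFun m := chi (𝟙 _) fun _ ↦ l m.toAdd
      map_one' := by
        simp only [toAdd_one, map_zero]
        exact chi_zero _
      map_mul' m m' := by
        rw [← chi_add]
        congr 1
        ext
        simp }
  obtain ⟨j, hj⟩ := exists_chi_eq φ
  have hj' (m) : chi j m = chi (𝟙 (muP k p 1)) fun _ ↦ l m := hj m
  have hjt {T : Over (Spec (.of k))} (t : T ⟶ muP k p 1) (m) : chi (t ≫ j) m = chi t fun _ ↦ l m := by
    rw [chi_comp, hj', ← chi_comp, Category.comp_id]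
  have hsurj := LinearMap.surjective hl
  refine ⟨j, ⟨?_, ?_⟩, ?_, ?_⟩
  · refine muP_hom_ext fun m ↦ ?_
    rw [hjt]
    have e1 : η[muP k p 1] = (1 : 𝟙_ _ ⟶ muP k p 1) := by rw [Hom.one_def, toUnit_unit, Category.id_comp]
    have e2 : η[muP k p n] = (1 : 𝟙_ _ ⟶ muP k p n) := by rw [Hom.one_def, toUnit_unit, Category.id_comp]
    rw [e1, e2, chi_one, chi_one]
  · refine muP_hom_ext fun m ↦ ?_
    rw [hjt, chi_comul, chi_comp, chi_comul, map_mul, ← chi_comp, ← chi_comp, tensorHom_fst,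
      tensorHom_snd, hjt, hjt]
  · have : Function.Surjective (pb j) := by
      change Function.Surjective (pb j).toLinearMap
      rw [← LinearMap.range_eq_top, eq_top_iff, ← (muBasis k p 1).span_eq,
        Submodule.span_le]
      rintro _ ⟨q, rfl⟩
      obtain ⟨m, hm⟩ := hsurj (q 0)
      refine ⟨muBasis k p n m, ?_⟩
      change pb j _ = _
      rw [pb_muBasis, hj', muBasis_apply]
      congr 1
      ext i
      rw [hm, Subsingleton.elim i 0]
    exact IsClosedImmersion.of_surjective_of_isAffine _ this
  · intro m hm
    rw [hj', hm]
    exact chi_zero _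

variable [CharP k p]

/-- For a faithful action, every weight occurs: otherwise a nonzero linear form vanishes on the
weights, and the corresponding subgroup `μ_p ⊆ μ_p^n` acts trivially. -/
lemma exists_isEigen_of_isFaithful {a : (muP k p n ⊗ X).left ⤏ X.left}
    (ha : IsRationalAction (muP k p n) X a) (hf : IsFaithful a)
    (haα : EvalAt a (muP k p n ◁ genIncl X) (α ≫ genIncl X)) (hα : IsActionMap α)
    (m : Fin n → ZMod p) : ∃ f, f ≠ 0 ∧ IsEigen α m f := by
  let M : Submodule (ZMod p) (Fin n → ZMod p) := AddSubgroup.toZModSubmodule p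
    { carrier := {m | ∃ f, f ≠ 0 ∧ IsEigen α m f}
      zero_mem' := ⟨1, one_ne_zero, isEigen_one⟩
      add_mem' := by
        rintro _ _ ⟨f, hf, h⟩ ⟨g, hg, h'⟩
        exact ⟨_, mul_ne_zero hf hg, h.mul h'⟩
      neg_mem' := by
        rintro _ ⟨f, hf, h⟩
        exact ⟨_, inv_ne_zero hf, h.inv⟩ }
  suffices hM : M = ⊤ by
    have : m ∈ M := hM ▸ Submodule.mem_top
    exact this
  by_contra hM
  obtain ⟨l, hl, hlM⟩ := Submodule.exists_le_ker_of_lt_top M (lt_top_iff_ne_top.mpr hM)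
  obtain ⟨j, hj, hjc, hjl⟩ := exists_muP_hom (k := k) l hl
  obtain ⟨W, hW, y, hy, -⟩ := ha.birational
  refine not_isIso_hom_muP_one (k := k) (p := p) (hf _ j hjc (restrictsTo_snd j hW hy haα ?_))
  refine hom_gen_ext fun f ↦ ?_
  obtain ⟨c, hc, rfl⟩ := hα.exists_eigen_decomposition f
  rw [map_sum, map_sum]
  refine Finset.sum_congr rfl fun m _ ↦ ?_
  have h2 : j ▷ gen X = lift (fst _ _ ≫ j) (snd _ _) := by ext1 <;> simp
  rw [h2, (hc m).pbK_lift]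
  by_cases h0 : c m = 0
  · simp [h0]
  · have : m ∈ M := ⟨c m, h0, hc m⟩
    rw [chi_comp, hjl m (hlM this), map_one, _root_.one_mul]

omit hp [CharP k p] in
lemma pb_genTo_injective (U : X.left.Opens) [Nonempty U] : Function.Injective (pb (genTo X U)) := by
  have : IsReduced (openSub U).left := inferInstanceAs (IsReduced (U : Scheme))
  have : IsSchemeTheoreticallyDominant (genTo X U).left := .of_isDominant _
  exact Scheme.Hom.app_injective (genTo X U).left ⊤

/-- An action with eigenfunctions of weights `e_1, …, e_n` is free where they are invertible. -/
lemma isGenericallyFree_of_isEigen {a : (muP k p n ⊗ X).left ⤏ X.left}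
    (ha : IsRationalAction (muP k p n) X a)
    (haα : EvalAt a (muP k p n ◁ genIncl X) (α ≫ genIncl X)) (hα : IsActionMap α)
    {x : Fin n → X.left.functionField} (hx : ∀ i, x i ≠ 0)
    (hi : ∀ i, IsEigen α (Pi.single i 1) (x i)) : IsGenericallyFree a := by
  classical
  obtain ⟨U, hU, hUa, hS, β, hβ⟩ := exists_spread (p := p) hp.out.ne_zero (α := α)
    (hα.pbK_pow heightLEOne_muP)
    (Finset.univ.image x ∪ Finset.univ.image fun i ↦ (x i)⁻¹)
  obtain ⟨W, hW, y, hy, -⟩ := ha.birational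
  refine ⟨U, dense_of_nonempty U, β, EvalAt.of_genTo hW hy U _ ?_, fun T g t ht ↦ ?_⟩
  · rwa [reassoc_of% hβ, genTo_openIncl]
  · apply eq_one_of_chi_single
    intro i
    obtain ⟨s, hs⟩ := mem_regFn_iff.mp (hS (x i) (by simp))
    obtain ⟨r, hr⟩ := mem_regFn_iff.mp (hS (x i)⁻¹ (by simp))
    have hsr : s * r = 1 := by
      apply pb_genTo_injective U
      rw [map_mul, hs, hr, ← map_mul, mul_inv_cancel₀ (hx i), map_one, map_one]
    have h1 : pb β s = chi (fst _ _) (Pi.single i 1) * pb (snd _ _) s := by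
      apply pb_whiskerLeft_genTo_injective (muP k p n) U
      rw [← pb_comp_apply, hβ, pb_comp_apply, hs, map_mul, ← chi_comp, ← pb_comp_apply,
        whiskerLeft_fst, whiskerLeft_snd, pb_comp_apply, hs]
      exact hi i
    have h2 := congrArg (fun q ↦ pb q s) ht
    simp only [pb_comp_apply, h1, map_mul] at h2
    rw [← chi_comp, ← pb_comp_apply, lift_fst, lift_snd] at h2
    exact ((IsUnit.of_mul_eq_one _ hsr).map (pb t)).mul_right_cancel
      (h2.trans (_root_.one_mul _).symm)

end Faithful

end RatAct

/-! ### Extensions of a faithful action of `μ_p^n` -/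

namespace RatAct

section Kernel

variable {C : Type*} [Category C] [CartesianMonoidalCategory C]

/-- A group structure on a subobject that is closed under the group operations. -/
lemma exists_grpObj_of_mono {N H : C} [GrpObj H] (j : N ⟶ H) [Mono j]
    (hone : ∃ e : 𝟙_ C ⟶ N, e ≫ j = η[H]) (hmul : ∃ m : N ⊗ N ⟶ N, m ≫ j = (j ⊗ₘ j) ≫ μ[H])
    (hinv : ∃ v : N ⟶ N, v ≫ j = j⁻¹) : ∃ _ : GrpObj N, IsMonHom j := by
  obtain ⟨e, he⟩ := hone
  obtain ⟨m, hm⟩ := hmul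
  obtain ⟨v, hv⟩ := hinv
  have hm' {T : C} (a b : T ⟶ N) : (lift a b ≫ m) ≫ j = (a ≫ j) * (b ≫ j) := by
    rw [Category.assoc, hm, Hom.mul_def, ← Category.assoc]
    congr 1
    ext1 <;> simp
  have he' {T : C} (t : T ⟶ 𝟙_ C) : (t ≫ e) ≫ j = 1 := by
    rw [Category.assoc, he, Hom.one_def, toUnit_unique t (toUnit T)]
  let G : GrpObj N :=
    { one := e
      mul := m
      inv := v
      one_mul := by
        have : e ▷ N = lift (fst _ _ ≫ e) (snd _ _) := by ext1 <;> simp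
        rw [← cancel_mono j, this, hm', he', _root_.one_mul, leftUnitor_hom]
      mul_one := by
        have : N ◁ e = lift (fst _ _) (snd _ _ ≫ e) := by ext1 <;> simp
        rw [← cancel_mono j, this, hm', he', _root_.mul_one, rightUnitor_hom]
      mul_assoc := by
        have h1 : m ▷ N ≫ m = lift (lift (fst _ _ ≫ fst _ _) (fst _ _ ≫ snd _ _) ≫ m) (snd _ _) ≫ m := by
          congr 1
          ext1
          · rw [← comp_lift, lift_fst_snd]
            simp
          · simp
        have h2 : (α_ N N N).hom ≫ N ◁ m ≫ m = lift (fst _ _ ≫ fst _ _)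
            (lift (fst _ _ ≫ snd _ _) (snd _ _) ≫ m) ≫ m := by
          rw [← Category.assoc]
          congr 1
          ext1
          · simp
          · rw [Category.assoc, whiskerLeft_snd, lift_snd, ← Category.assoc]
            congr 1
            ext1 <;> simp
        rw [h1, h2, ← cancel_mono j, hm', hm', hm', hm', _root_.mul_assoc]
      left_inv := by
        rw [← cancel_mono j, hm', he', hv, Category.id_comp, inv_mul_cancel]
      right_inv := by
        rw [← cancel_mono j, hm', he', hv, Category.id_comp, mul_inv_cancel] }
  exact ⟨G, ⟨he, hm⟩⟩

end Kernel

variable {k : Type u} [Field k] {p n : ℕ}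

section

variable {H T : Over (Spec (.of k))} [GrpObj H]

lemma muP_hom_ext_single [NeZero p] {t t' : T ⟶ muP k p n}
    (h : ∀ i, chi t (Pi.single i 1) = chi t' (Pi.single i 1)) : t = t' := by
  refine muP_hom_ext fun m ↦ ?_
  rw [chi_eq_prod, chi_eq_prod]
  simp [h]

lemma exists_chi_single_eq [NeZero p] (v : Fin n → Fn T) (hv : ∀ i, v i ^ p = 1) :
    ∃ t : T ⟶ muP k p n, ∀ i, chi t (Pi.single i 1) = v i := by
  have hmod (i) (r : ℕ) : v i ^ (r % p) = v i ^ r := by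
    conv_rhs => rw [← Nat.div_add_mod r p, pow_add, pow_mul, hv, one_pow, _root_.one_mul]
  let φ : Multiplicative (Fin n → ZMod p) →* Fn T :=
    { toFun m := ∏ i, v i ^ (m.toAdd i).val
      map_one' := by simp
      map_mul' m m' := by
        rw [← Finset.prod_mul_distrib]
        refine Finset.prod_congr rfl fun i _ ↦ ?_
        rw [toAdd_mul, Pi.add_apply, ZMod.val_add, hmod, pow_add] }
  obtain ⟨t, ht⟩ := exists_chi_eq φ
  refine ⟨t, fun i ↦ ?_⟩
  rw [ht]
  change ∏ j, v j ^ ((Pi.single i 1 : Fin n → ZMod p) j).val = _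
  rw [Finset.prod_eq_single i]
  · rw [Pi.single_eq_same, ← Nat.cast_one, ZMod.val_natCast, hmod, pow_one]
  · intro j _ hj
    rw [Pi.single_eq_of_ne hj, ZMod.val_zero, pow_zero]
  · simp

/-- A normal subgroup `μ_p^n` of a group scheme of height at most one is central: the conjugate of a
character is a combination of characters with idempotent coefficients, and these are constant as
they are `p`-th powers. -/
lemma conj_eq_of_isNormalSub [Fact p.Prime] [IsAffine H.left] (hH : HeightLEOne p H)
    {i : muP k p n ⟶ H} [IsMonHom i] [Mono i] (hi : IsNormalSub i) (h : T ⟶ H)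
    (g : T ⟶ muP k p n) : h * (g ≫ i) * h⁻¹ = g ≫ i := by
  obtain ⟨c, hc⟩ := hi (muP k p n ⊗ H) (snd _ _) (fst _ _)
  have hcT {T : Over (Spec (.of k))} (h : T ⟶ H) (g : T ⟶ muP k p n) :
      (lift g h ≫ c) ≫ i = h * (g ≫ i) * h⁻¹ := by
    rw [Category.assoc, hc, comp_mul, comp_mul, GrpObj.comp_inv, lift_snd, ← Category.assoc, lift_fst]
  have hcmul {T : Over (Spec (.of k))} (h : T ⟶ H) (g g' : T ⟶ muP k p n) :
      lift (g * g') h ≫ c = (lift g h ≫ c) * (lift g' h ≫ c) := by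
    rw [← cancel_mono i, hcT, MonObj.mul_comp, MonObj.mul_comp, hcT, hcT]
    group
  have hc1 {T : Over (Spec (.of k))} (g : T ⟶ muP k p n) : lift g 1 ≫ c = g := by
    rw [← cancel_mono i, hcT]
    group
  suffices hcg : c = fst _ _ by rw [← hcT, hcg, lift_fst]
  refine muP_hom_ext fun m ↦ ?_
  obtain ⟨w, hw⟩ := (bijective_expand (T := H) (muBasis k p n)).2 (chi c m)
  have key {T : Over (Spec (.of k))} (h : T ⟶ H) (g : T ⟶ muP k p n) :
      chi (lift g h ≫ c) m = ∑ q, chi g q * pb h (w q) := by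
    rw [chi_comp, ← hw, pb_lift_expand]
    simp only [pb_muBasis]
  -- The coefficients `w q` are idempotent, as `c` is multiplicative.
  have hidem (q) : w q * w q = w q := by
    have h1 := congrArg (chi · m) (hcmul (snd (muP k p n) (muP k p n ⊗ H) ≫ snd _ _) (fst _ _)
      (snd _ _ ≫ fst _ _))
    simp only [chi_mul, key, pb_comp_apply, chi_comp] at h1
    have h2 : ∑ q, chi (fst (muP k p n) (muP k p n ⊗ H)) q *
        pb (snd _ _) (chi (fst _ _) q * pb (snd _ _) (w q)) =
        ∑ q, chi (fst (muP k p n) (muP k p n ⊗ H)) q *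
        pb (snd _ _) (∑ r, chi (fst _ _) r * pb (snd _ _) (w q * w r)) := by
      simp only [map_mul, map_sum]
      convert h1 using 1
      · simp only [_root_.mul_assoc]
      · rw [Finset.sum_mul]
        refine Finset.sum_congr rfl fun q _ ↦ ?_
        rw [Finset.mul_sum, Finset.mul_sum]
        refine Finset.sum_congr rfl fun r _ ↦ ?_
        ring
    have h3 := congrFun (sum_chi_injective h2) q
    have h4 : ∑ r, chi (fst (muP k p n) H) r * pb (snd _ _) (if r = q then w q else 0) =
        ∑ r, chi (fst (muP k p n) H) r * pb (snd _ _) (w q * w r) := by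
      rw [← h3, Finset.sum_eq_single q]
      · simp
      · intro r _ hr
        simp [hr]
      · simp
    have h5 := congrFun (sum_chi_injective h4) q
    simpa using h5.symm
  have hcounit (q) : algebraMap k (Fn H) (counit H (w q)) = if q = m then 1 else 0 := by
    have h1 := congrArg (chi · m) (hc1 (fst (muP k p n) H))
    simp only [key, pb_one] at h1
    refine congrFun (sum_chi_injective (c := fun q ↦ algebraMap k (Fn H) (counit H (w q)))
      (d := fun q ↦ if q = m then 1 else 0) ?_) q
    simp only [AlgHom.commutes, h1]
    rw [Finset.sum_eq_single m]
    · simp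
    · intro q _ hq
      simp [hq]
    · simp
  have hw1 (q) : w q = if q = m then 1 else 0 := by
    have hp : p ≠ 0 := (Fact.out : p.Prime).ne_zero
    have h1 : w q = w q ^ p := (IsIdempotentElem.pow_eq (hidem q) hp).symm
    rw [h1, heightLEOne_iff.mp hH, hcounit, ite_pow, one_pow, zero_pow hp]
  rw [← hw, expand, Finset.sum_eq_single m]
  · rw [hw1, if_pos rfl, map_one, _root_.mul_one, pb_muBasis]
  · intro q _ hq
    rw [hw1, if_neg hq, map_zero, mul_zero]
  · simp

end

end RatAct

namespace RatAct

variable {k : Type u} [Field k]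

/-- Elements of a finite-dimensional subspace that is closed under multiplication are algebraic. -/
lemma isAlgebraic_of_sum_eq_mul {K : Type*} [Field K] [Algebra k K] {I : Type*} [Fintype I]
    (f : I → K) (hone : ∃ e : I → k, ∑ j, algebraMap k K (e j) * f j = 1)
    (hmul : ∀ r s, ∃ e : I → k, f r * f s = ∑ j, algebraMap k K (e j) * f j) (j : I) :
    IsAlgebraic k (f j) := by
  let V : Submodule k K := Submodule.span k (Set.range f)
  have hV (e : I → k) : ∑ j, algebraMap k K (e j) * f j ∈ V :=
    sum_mem fun j _ ↦ by
      rw [← Algebra.smul_def]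
      exact V.smul_mem _ (Submodule.subset_span ⟨j, rfl⟩)
  have h1 : (1 : K) ∈ V := by
    obtain ⟨e, he⟩ := hone
    exact he ▸ hV e
  have h2 : ∀ x y, x ∈ V → y ∈ V → x * y ∈ V := by
    intro x y hx hy
    have h3 : V * V ≤ V := by
      rw [Submodule.span_mul_span, Submodule.span_le]
      rintro _ ⟨_, ⟨r, rfl⟩, _, ⟨s, rfl⟩, rfl⟩
      obtain ⟨e, he⟩ := hmul r s
      exact (show f r * f s ∈ V from he ▸ hV e)
    exact h3 (Submodule.mul_mem_mul hx hy)
  refine IsIntegral.isAlgebraic (IsIntegral.of_mem_of_fg (V.toSubalgebra h1 h2) ?_ _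
    (Submodule.subset_span ⟨j, rfl⟩))
  rw [Submodule.toSubalgebra_toSubmodule]
  exact Submodule.fg_span (Set.finite_range f)

section Extension

variable {p n : ℕ} [hp : Fact p.Prime] [CharP k p] {X H : Over (Spec (.of k))} [IsVariety X]
  [GrpObj H] [IsFinite H.hom]

/-- Let `μ_p^n` be normal in a group scheme `H` of height at most one that acts on `Spec k(X)`, and
standard in the `p`-basis `x`. Then `H` acts on every `x_j` through multiplication by a function `v`
on `H`. -/
lemma exists_character (hH : HeightLEOne p H) {i : muP k p n ⟶ H} [IsMonHom i] [Mono i]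
    (hi : IsNormalSub i) {β : H ⊗ gen X ⟶ gen X} (hβ : IsActionMap β)
    {x : Fin n → X.left.functionField}
    (hx : IsPBasis p (algebraMap k X.left.functionField) x)
    (hF : ∀ f ∈ frobSubfield p (algebraMap k X.left.functionField), IsEigen (i ▷ gen X ≫ β) 0 f)
    (hxi : ∀ j, IsEigen (i ▷ gen X ≫ β) (Pi.single j 1) (x j)) (j : Fin n) :
    ∃ v : Fn H, ∀ {T : Over (Spec (.of k))} (h : T ⟶ H) (y : T ⟶ gen X),
      pbK (lift h y ≫ β) (x j) = pb h v * pbK y (x j) := by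
  have : IsAffine H.left := isAffine_of_isAffineHom H.hom
  have := module_finite_fn H
  have hx0 := hx.ne_zero j
  let b := Module.finBasis k (Fn H)
  let u : Fn (H ⊗ gen X) := pbK β (x j) * pbK (snd _ _) (x j)⁻¹
  have hu {T : Over (Spec (.of k))} (h : T ⟶ H) (y : T ⟶ gen X) :
      pb (lift h y) u = pbK (lift h y ≫ β) (x j) * pbK y (x j)⁻¹ := by
    rw [map_mul, ← pbK_comp, ← pbK_comp, lift_snd]
  obtain ⟨c', hc'⟩ := (bijective_expand (T := gen X) b).2 u
  let c (r) : X.left.functionField := (fnGen X).symm (c' r)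
  have huc {T : Over (Spec (.of k))} (h : T ⟶ H) (y : T ⟶ gen X) :
      pb (lift h y) u = ∑ r, pb h (b r) * pbK y (c r) := by
    rw [← hc', pb_lift_expand]
    simp only [pb_apply_gen]
    rfl
  have hrestr {T : Over (Spec (.of k))} (g : T ⟶ muP k p n) (y : T ⟶ gen X) :
      lift g y ≫ i ▷ gen X ≫ β = lift (g ≫ i) y ≫ β := by
    rw [← Category.assoc]
    congr 1
    ext1 <;> simp
  -- As `μ_p^n` is central, `u` is invariant under `μ_p^n`.
  have hinv {T : Over (Spec (.of k))} (h : T ⟶ H) (g : T ⟶ muP k p n) (y : T ⟶ gen X) :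
      pb (lift h (lift g y ≫ i ▷ gen X ≫ β)) u = pb (lift h y) u := by
    have hcomm : h * (g ≫ i) = (g ≫ i) * h := by
      conv_rhs => rw [← conj_eq_of_isNormalSub hH hi h g]
      group
    rw [hu, hu, (hxi j).inv.pbK_lift, hrestr, hβ.mul, hcomm, ← hβ.mul, ← hrestr,
      (hxi j).pbK_lift, _root_.mul_mul_mul_comm, ← chi_add, add_neg_cancel, chi_zero,
      _root_.one_mul]
  -- So its coefficients lie in `k K^p` and are fixed by `H`.
  have hcF (r) : c r ∈ frobSubfield p (algebraMap k X.left.functionField) := by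
    apply mem_frobSubfield_of_isEigen_zero hx hF hxi
    rw [isEigen_zero_iff]
    have h1 := hinv (fst H (muP k p n ⊗ gen X)) (snd _ _ ≫ fst _ _) (snd _ _ ≫ snd _ _)
    rw [← comp_lift_assoc, lift_fst_snd, Category.id_comp, huc, huc] at h1
    simp only [pbK_comp _ (i ▷ gen X ≫ β), pbK_comp _ (snd (muP k p n) (gen X))] at h1
    exact congrFun ((bijective_expand (T := muP k p n ⊗ gen X) b).1 h1) r
  have hcH {T : Over (Spec (.of k))} (h : T ⟶ H) (y : T ⟶ gen X) (r) :
      pbK (lift h y ≫ β) (c r) = pbK y (c r) := by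
    refine algHom_eq_of_mem_frobSubfield (p := p) (fun f ↦ ?_) (hcF r)
    rw [pbK_comp, hβ.pbK_pow hH, ← pbK_comp, lift_snd]
  have hmul {T : Over (Spec (.of k))} (g h : T ⟶ H) (y : T ⟶ gen X) :
      pb (lift (g * h) y) u = pb (lift g y) u * pb (lift h y) u := by
    have h1 : pb (lift g (lift h y ≫ β)) u = pb (lift g y) u := by
      rw [huc, huc]
      simp only [hcH]
    have h2 : pbK (lift h y ≫ β) (x j)⁻¹ * pbK (lift h y ≫ β) (x j) = 1 := by
      rw [← map_mul, inv_mul_cancel₀ hx0, map_one]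
    rw [← h1, hu, hu, hu, hβ.mul]
    linear_combination (-(pbK (lift (g * h) y ≫ β) (x j) * pbK y (x j)⁻¹)) * h2
  -- By multiplicativity of `u`, the coefficients span a finite-dimensional algebra over `k`.
  have hcalg (r) : IsAlgebraic k (c r) := by
    refine isAlgebraic_of_sum_eq_mul c ⟨fun r ↦ counit H (b r), ?_⟩ (fun r s ↦ ?_) r
    · have h1 := huc 1 (𝟙 (gen X))
      rw [hu, hβ.one, ← map_mul, mul_inv_cancel₀ hx0, map_one] at h1
      apply (pbK (𝟙 (gen X))).toRingHom.injective
      change pbK (𝟙 (gen X)) _ = pbK (𝟙 (gen X)) 1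
      rw [map_one, h1, map_sum]
      exact Finset.sum_congr rfl fun r _ ↦ by rw [map_mul, AlgHom.commutes, pb_one]
    · choose d hd using fun l ↦ (bijective_expand (Y := H) (T := H) b).2 (pb μ[H] (b l))
      refine ⟨fun l ↦ b.repr (d l r) s, ?_⟩
      have h1 := hmul (fst H (H ⊗ gen X)) (snd _ _ ≫ fst _ _) (snd _ _ ≫ snd _ _)
      simp only [huc, Hom.mul_def, pb_comp_apply, pbK_comp, ← hd, pb_lift_expand] at h1
      have h2 : expand b (fun r ↦ expand b fun s ↦ ∑ l, fnGen X
            (algebraMap k X.left.functionField (b.repr (d l r) s) * c l)) =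
          expand b (fun r ↦ expand b fun s ↦ fnGen X (c r * c s)) := by
        have hrepr (z : Fn H) : pb (fst H (gen X)) z =
            ∑ s, algebraMap k _ (b.repr z s) * pb (fst H (gen X)) (b s) := by
          conv_lhs => rw [← b.sum_repr z]
          simp only [map_sum, map_mul, AlgHom.commutes, Algebra.smul_def]
        simp only [expand, map_sum, map_mul, Finset.mul_sum, AlgHom.commutes, AlgEquiv.commutes]
        refine Eq.trans ?_ (h1.trans ?_)
        · rw [Finset.sum_congr rfl fun r _ ↦ Finset.sum_comm, Finset.sum_comm]
          refine Finset.sum_congr rfl fun l _ ↦ ?_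
          rw [Finset.sum_mul]
          refine Finset.sum_congr rfl fun r _ ↦ ?_
          rw [hrepr (d l r)]
          simp only [map_sum, map_mul, AlgHom.commutes, Finset.mul_sum, Finset.sum_mul, pbK_apply]
          exact Finset.sum_congr rfl fun s _ ↦ by ring
        · simp only [Finset.sum_mul_sum, pbK_apply]
          exact Finset.sum_congr rfl fun r _ ↦ Finset.sum_congr rfl fun s _ ↦ by ring
      have h3 := congrFun ((bijective_expand (T := gen X) b).1
        (congrFun ((bijective_expand (T := H ⊗ gen X) b).1 h2) r)) s
      apply (fnGen X).injective
      rw [← h3, map_sum]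
  choose e he using fun r ↦ mem_range_algebraMap_of_isAlgebraic (hcalg r)
  refine ⟨∑ r, e r • b r, fun {T} h y ↦ ?_⟩
  have h1 := huc h y
  have h2 : pbK y (x j)⁻¹ * pbK y (x j) = 1 := by
    rw [← map_mul, inv_mul_cancel₀ hx0, map_one]
  have h3 : ∑ r, pb h (b r) * pbK y (c r) = pb h (∑ r, e r • b r) := by
    rw [map_sum]
    refine Finset.sum_congr rfl fun r _ ↦ ?_
    rw [← he, AlgHom.commutes, map_smul, Algebra.smul_def, _root_.mul_comm]
  rw [hu, h3] at h1
  rw [← h1, _root_.mul_assoc, h2, _root_.mul_one]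

end Extension

end RatAct

namespace RatAct

variable {k : Type u} [Field k] {p n : ℕ} [hp : Fact p.Prime] [CharP k p]
  {X H : Over (Spec (.of k))} [IsVariety X] [GrpObj H] [IsFinite H.hom] [Subsingleton H.left]

/-- A normal subgroup `μ_p^n` of a group scheme `H` of height at most one that acts faithfully on a
variety is all of `H`, if the action of `μ_p^n` is standard: the characters by which `H` acts on the
coordinate functions define a retraction `H ⟶ μ_p^n` whose kernel acts trivially. -/
lemma isIso_of_isNormalSub (hH : HeightLEOne p H) {i : muP k p n ⟶ H} [IsMonHom i] [Mono i]
    (hi : IsNormalSub i) {b : (H ⊗ X).left ⤏ X.left} (hb : IsRationalAction H X b)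
    (hf : IsFaithful b) {β : H ⊗ gen X ⟶ gen X}
    (hbβ : EvalAt b (H ◁ genIncl X) (β ≫ genIncl X)) (hβ : IsActionMap β)
    {x : Fin n → X.left.functionField}
    (hx : IsPBasis p (algebraMap k X.left.functionField) x)
    (hF : ∀ f ∈ frobSubfield p (algebraMap k X.left.functionField), IsEigen (i ▷ gen X ≫ β) 0 f)
    (hxi : ∀ j, IsEigen (i ▷ gen X ≫ β) (Pi.single j 1) (x j)) : IsIso i := by
  have : IsAffine H.left := isAffine_of_isAffineHom H.hom
  choose v hv using fun j ↦ exists_character hH hi hβ hx hF hxi j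
  have hunit (j) {T : Over (Spec (.of k))} (y : T ⟶ gen X) : IsUnit (pbK y (x j)) :=
    (isUnit_iff_ne_zero.mpr (hx.ne_zero j)).map _
  have hvmul (j) {T : Over (Spec (.of k))} [IsAffine T.left] (g h : T ⟶ H) :
      pb (g * h) (v j) = pb g (v j) * pb h (v j) := by
    apply pb_fst_injective (X := X) T
    apply (hunit j (snd T (gen X))).mul_right_cancel
    rw [map_mul, ← pb_comp_apply, ← pb_comp_apply, ← pb_comp_apply, comp_mul, ← hv, ← hβ.mul, hv,
      hv, _root_.mul_assoc]
  have hv1 (j) : algebraMap k (Fn H) (counit H (v j)) = 1 := by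
    rw [← pb_one]
    apply pb_fst_injective (X := X) H
    apply (hunit j (snd H (gen X))).mul_right_cancel
    rw [map_one, ← pb_comp_apply, comp_one, ← hv, hβ.one, _root_.one_mul]
  obtain ⟨χ, hχ⟩ := exists_chi_single_eq (p := p) (T := H) v fun j ↦ by
    rw [heightLEOne_iff.mp hH, hv1, one_pow]
  have hχmul {T : Over (Spec (.of k))} [IsAffine T.left] (g h : T ⟶ H) :
      (g * h) ≫ χ = (g ≫ χ) * (h ≫ χ) := by
    refine muP_hom_ext_single fun j ↦ ?_
    rw [chi_mul, chi_comp, chi_comp, chi_comp, hχ, hvmul]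
  have hχ1 {T : Over (Spec (.of k))} [IsAffine T.left] : (1 : T ⟶ H) ≫ χ = 1 := by
    have := hχmul (1 : T ⟶ H) 1
    rwa [_root_.one_mul, left_eq_mul] at this
  have hχinv {T : Over (Spec (.of k))} [IsAffine T.left] (g : T ⟶ H) : g⁻¹ ≫ χ = (g ≫ χ)⁻¹ := by
    rw [eq_inv_iff_mul_eq_one, ← hχmul, inv_mul_cancel, hχ1]
  have hiχ : i ≫ χ = 𝟙 _ := by
    refine muP_hom_ext_single fun j ↦ ?_
    rw [chi_comp, hχ]
    apply pb_fst_injective (X := X) (muP k p n)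
    apply (hunit j (snd (muP k p n) (gen X))).mul_right_cancel
    rw [← pb_comp_apply, ← hv, ← chi_comp, Category.comp_id, ← hxi j]
    congr 3
  -- The kernel of the retraction `χ` acts trivially, hence is trivial.
  let N : Over (Spec (.of k)) := Limits.equalizer χ (1 : H ⟶ muP k p n)
  let j : N ⟶ H := Limits.equalizer.ι χ 1
  have hjχ : j ≫ χ = 1 := (Limits.equalizer.condition χ 1).trans (comp_one _)
  have hlift {T : Over (Spec (.of k))} (t : T ⟶ H) (ht : t ≫ χ = 1) : ∃ s : T ⟶ N, s ≫ j = t :=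
    ⟨Limits.equalizer.lift t (ht.trans (comp_one _).symm), Limits.equalizer.lift_ι _ _⟩
  have hjc : IsClosedImmersion j.left := isClosedImmersion_equalizer_ι_left _ _
  have : IsAffine N.left := isAffine_of_isAffineHom j.left
  have : IsAffine (N ⊗ N).left :=
    inferInstanceAs (IsAffine (Limits.pullback N.hom N.hom))
  have : IsAffine (𝟙_ (Over (Spec (.of k)))).left := inferInstanceAs (IsAffine (Spec (.of k)))
  obtain ⟨_, hj⟩ := exists_grpObj_of_mono j
    (hlift _ (by
      have h : η[H] = 1 := by rw [Hom.one_def, toUnit_unique (toUnit _) (𝟙 _), Category.id_comp]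
      rw [h, hχ1]))
    (hlift _ (by
      have h : (j ⊗ₘ j) ≫ μ[H] = (fst N N ≫ j) * (snd N N ≫ j) := by
        rw [Hom.mul_def]
        congr 1
      rw [h, hχmul, Category.assoc, Category.assoc, hjχ, comp_one, comp_one, _root_.one_mul]))
    (hlift _ (by rw [hχinv, hjχ, inv_one]))
  have := subsingleton_of_isClosedImmersion j
  have hact : j ▷ gen X ≫ β = snd _ _ := by
    have h0 : j ▷ gen X ≫ β = lift (fst _ _ ≫ j) (snd _ _) ≫ β := by
      congr 1
    refine hom_gen_ext fun f ↦ DFunLike.congr_fun (algHom_ext_of_isPBasis hx ?_ ?_) f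
    · intro f hf
      refine algHom_eq_of_mem_frobSubfield (p := p) (fun f ↦ ?_) hf
      rw [pbK_comp, hβ.pbK_pow hH, ← pbK_comp, whiskerRight_snd]
    · intro l
      rw [h0, hv, ← hχ l, ← chi_comp, Category.assoc, hjχ, comp_one, chi_one, _root_.one_mul]
  obtain ⟨W, hW, y, hy, -⟩ := hb.birational
  have hN : IsIso N.hom := hf N j hjc (restrictsTo_snd j hW hy hbβ hact)
  have hj1 : j = 1 := by
    have h1 : (toUnit N).left = N.hom := by simp
    have h2 : IsIso ((Over.forget _).map (toUnit N)) :=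
      (congrArg IsIso h1).mpr hN
    have h3 : IsIso (toUnit N) := isIso_of_reflects_iso _ (Over.forget _)
    have h4 : 𝟙 N = toUnit N ≫ η[N] := (cancel_mono (toUnit N)).mp (toUnit_unique _ _)
    rw [← Category.id_comp j, h4, Category.assoc, IsMonHom.one_hom, Hom.one_def]
  have hχi : χ ≫ i = 𝟙 H := by
    obtain ⟨s, hs⟩ := hlift (𝟙 H * (χ ≫ i)⁻¹) (by
      rw [hχmul, hχinv, Category.assoc, hiχ, Category.comp_id, Category.id_comp, mul_inv_cancel])
    rw [hj1, comp_one, eq_comm, mul_inv_eq_one] at hs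
    exact hs.symm
  exact ⟨χ, hiχ, hχi⟩

end RatAct

/-! ### Uniqueness of the `p`-basis -/

namespace RatAct

variable {k : Type u} [Field k] {p n : ℕ} [hp : Fact p.Prime] [CharP k p]
  {X : Over (Spec (.of k))} [IsVariety X] {α : muP k p n ⊗ gen X ⟶ gen X}
  {x y : Fin n → X.left.functionField}

lemma IsActionMap.isEigen_zero (hα : IsActionMap α) {f : X.left.functionField}
    (hf : f ∈ frobSubfield p (algebraMap k X.left.functionField)) : IsEigen α 0 f :=
  isEigen_zero_iff.mpr (algHom_eq_of_mem_frobSubfield (p := p) (hα.pbK_pow heightLEOne_muP) hf)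

/-- The eigenfunctions of weight `e_i` form a one-dimensional space over `k K^p`. -/
lemma isPBasis_and_isStandard_iff (hn : topologicalKrullDim X.left = n)
    {a : (muP k p n ⊗ X).left ⤏ X.left} (haα : EvalAt a (muP k p n ◁ genIncl X) (α ≫ genIncl X))
    (hF : ∀ f ∈ frobSubfield p (algebraMap k X.left.functionField), IsEigen α 0 f)
    (hx : ∀ i, x i ≠ 0) (hi : ∀ i, IsEigen α (Pi.single i 1) (x i)) :
    (IsPBasis p (algebraMap k X.left.functionField) y ∧ IsStandard a y) ↔
      ∃ c : Fin n → X.left.functionField, ∀ i,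
        c i ∈ frobSubfield p (algebraMap k X.left.functionField) ∧ c i ≠ 0 ∧ y i = c i * x i := by
  rw [isStandard_iff]
  constructor
  · rintro ⟨hy, α', ha', -, hi'⟩
    obtain rfl : α' = α := by
      rw [← cancel_mono (genIncl X)]
      exact ha'.unique isGenericPt_whiskerLeft_genIncl haα
    refine ⟨fun i ↦ y i * (x i)⁻¹, fun i ↦ ⟨?_, mul_ne_zero (hy.ne_zero i) (inv_ne_zero (hx i)), ?_⟩⟩
    · refine mem_frobSubfield_of_isEigen_zero (isPBasis_of_isEigen hn hF hx hi) hF hi ?_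
      rw [← add_neg_cancel (Pi.single i 1 : Fin n → ZMod p)]
      exact (hi' i).mul (hi i).inv
    · rw [inv_mul_cancel_right₀ (hx i)]
  · rintro ⟨c, hc⟩
    have hy (i) : IsEigen α (Pi.single i 1) (y i) := by
      rw [(hc i).2.2, ← zero_add (Pi.single i 1 : Fin n → ZMod p)]
      exact (hF _ (hc i).1).mul (hi i)
    have hy0 (i) : y i ≠ 0 := by
      rw [(hc i).2.2]
      exact mul_ne_zero (hc i).2.1 (hx i)
    exact ⟨isPBasis_of_isEigen hn hF hy0 hy, α, haα, hF, hy⟩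

end RatAct

theorem lemma3p6 {k : Type u} [Field k] (p : ℕ) [Fact p.Prime] [CharP k p]
    (X : Over (Spec (.of k))) [RatAct.IsVariety X]
    (n : ℕ) (hn : topologicalKrullDim X.left = n) :
    (∃ a : (RatAct.muP k p n ⊗ X).left ⤏ X.left,
      RatAct.IsRationalAction (RatAct.muP k p n) X a ∧ RatAct.IsFaithful a) ∧
    ∀ a : (RatAct.muP k p n ⊗ X).left ⤏ X.left,
      RatAct.IsRationalAction (RatAct.muP k p n) X a → RatAct.IsFaithful a →
      RatAct.IsGenericallyFree a ∧
      (∃ x : Fin n → X.left.functionField,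
        RatAct.IsPBasis p (RatAct.constMap X) x ∧ RatAct.IsStandard a x ∧
        ∀ y : Fin n → X.left.functionField,
          (RatAct.IsPBasis p (RatAct.constMap X) y ∧ RatAct.IsStandard a y) ↔
          ∃ c : Fin n → X.left.functionField, ∀ i,
            c i ∈ RatAct.frobSubfield p (RatAct.constMap X) ∧ c i ≠ 0 ∧ y i = c i * x i) ∧
      ∀ (H : Over (Spec (.of k))) [GrpObj H], RatAct.IsInfinitesimal H → RatAct.HeightLEOne p H →
        ∀ (i : RatAct.muP k p n ⟶ H) [IsMonHom i], IsClosedImmersion i.left →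
          RatAct.IsNormalSub i →
          ∀ b : (H ⊗ X).left ⤏ X.left,
            RatAct.IsRationalAction H X b → RatAct.IsFaithful b →
            RatAct.RestrictsTo i b a → IsIso i := by
  refine ⟨RatAct.exists_faithful_rationalAction X hn, fun a ha hf ↦ ?_⟩
  obtain ⟨α, haα, hα⟩ := ha.exists_gen
  choose x hx0 hxi using fun i ↦ RatAct.exists_isEigen_of_isFaithful ha hf haα hα (Pi.single i 1)
  have hF : ∀ f ∈ RatAct.frobSubfield p (algebraMap k X.left.functionField),
      RatAct.IsEigen α 0 f := fun f hf ↦ hα.isEigen_zero hf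
  have hx := RatAct.isPBasis_of_isEigen hn hF hx0 hxi
  refine ⟨RatAct.isGenericallyFree_of_isEigen ha haα hα hx0 hxi,
    ⟨x, hx, RatAct.isStandard_iff.mpr ⟨α, haα, hF, hxi⟩,
      fun y ↦ RatAct.isPBasis_and_isStandard_iff hn haα hF hx0 hxi⟩, ?_⟩
  intro H _ hH hH1 i _ hi hiN b hb hbf hba
  have := hH.finite
  obtain ⟨_⟩ := hH.uniquePoint
  have : Subsingleton H.left := inferInstance
  have : Mono i := RatAct.mono_of_isClosedImmersion i
  obtain ⟨β, hbβ, hβ⟩ := hb.exists_gen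
  have h : i ▷ RatAct.gen X ≫ β = α := by
    rw [← cancel_mono (RatAct.genIncl X), Category.assoc]
    exact hba.comp_eq hbβ haα
  subst h
  exact RatAct.isIso_of_isNormalSub hH1 hiN hb hbf hbβ hβ hx hF hxi
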